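/- Let $n\ge 1$ and $n\le k\le 2n-1$. On $\mathbb R^{2n}$ with coordinates ordered as $(x_1,\dots,x_n,y_1,\dots,y_n)$ let $\Pi_k$ be the subspace spanned by the last $k$ standard basis vectors, and let $U=S^{2n-1}\setminus\Pi_k$ with the contact form $\alpha=\frac12\sum_{i=1}^n(x_i\,dy_i-y_i\,dx_i)|_U$ and the contact structure $\xi_{\rm st}=\ker\alpha$. Let $G$ be the identity component of the group of compactly supported contactomorphisms of $(U,\xi_{\rm st})$: those joined to the identity by a smooth path of contactomorphisms with supports in a common compact set. Identify the Lie algebra $\mathfrak g$ of $G$ with $C^\infty_c(U)$ via $\alpha$, so that $\mathrm{Ad}_\psi K=(c_\psi K)\circ\psi^{-1}$, where $c_\psi>0$ and $\psi^*\alpha=c_\psi\alpha$; write $H\le K$ for the pointwise order. Let $\mathcal E$ be the set of contact embeddings $\sigma:U\to U$ that are isotopic to the identity through contact embeddings and have $\overline{\sigma(U)}$ compact in $U$, and let $$\mathfrak g^+=\{H\in\mathfrak g\mid H\ge 0,\ H|_{\sigma(U)}>0\text{ for some }\sigma\in\mathcal E\}.$$ Then $\mathfrak g^+$ is non-orderable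 up to conjugation, that is: (a) there exist $H\in\mathfrak g^+$, $g\in G$ and $0<s<1$ with $\mathrm{Ad}_gH\le sH$; and (b) for all $K_1,K_2\in\mathfrak g^+$ there exists $h\in G$ with $\mathrm{Ad}_hK_1\le K_2$. -/

import Mathlib

open Set Metric Module Topology
open scoped Manifold ContDiff

noncomputable section

namespace ContactCone

section General

/-! ### Contact manifolds, contactomorphisms and the maximal dominating cone

`M` is a manifold without boundary whose (cooriented) contact structure is the kernel of a
`1`-form `α`. -/

variable {E : Type*} [NormedAddCommGroup E] [NormedSpace ℝ E]
  {M : Type*} [TopologicalSpace M] [ChartedSpace E M]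

/-- A (not necessarily continuous) `1`-form on `M`. -/
abbrev OneForm (E : Type*) [NormedAddCommGroup E] [NormedSpace ℝ E]
    (M : Type*) [TopologicalSpace M] [ChartedSpace E M] : Type _ :=
  ∀ x : M, TangentSpace 𝓘(ℝ, E) x →L[ℝ] ℝ

/-- A coorientation preserving contactomorphism of `(M, ker α)`: a diffeomorphism `ψ` with
`ψ^* α = c_ψ α` for a positive function `c_ψ`. As `α` vanishes nowhere, `c_ψ` is determined
by `ψ`. -/
structure Contactomorphism (α : OneForm E M) where
  /-- The underlying diffeomorphism `ψ`. -/
  toDiffeo : Diffeomorph 𝓘(ℝ, E) 𝓘(ℝ, E) M M ∞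
  /-- The conformal factor `c_ψ`. -/
  factor : M → ℝ
  factor_pos : ∀ x, 0 < factor x
  pullback_eq : ∀ (x : M) (v : TangentSpace 𝓘(ℝ, E) x),
    α (toDiffeo x) (mfderiv 𝓘(ℝ, E) 𝓘(ℝ, E) toDiffeo x v) = factor x * α x v

/-- The group `G = Diff_c(M, ker α)`: the identity component of the group of compactly supported
contactomorphisms, that is, all `ψ` that are joined to the identity by a smooth path
`ψ_t`, `t ∈ [0, 1]`, of contactomorphisms supported in one compact set `C`. -/
def contactGroup (α : OneForm E M) : Set (Contactomorphism α) :=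
  {ψ | ∃ (Ψ : ℝ → Contactomorphism α) (C : Set M),
      ContMDiffOn (𝓘(ℝ, ℝ).prod 𝓘(ℝ, E)) 𝓘(ℝ, E) ∞
        (fun p : ℝ × M => (Ψ p.1).toDiffeo p.2) (Icc (0 : ℝ) 1 ×ˢ univ) ∧
      IsCompact C ∧
      (∀ t ∈ Icc (0 : ℝ) 1, ∀ x ∉ C, (Ψ t).toDiffeo x = x) ∧
      (∀ x, (Ψ 0).toDiffeo x = x) ∧ Ψ 1 = ψ}

/-- The Lie algebra of `G`, identified through `α` with the compactly supported smooth
functions on `M`. -/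
def lieAlg (E : Type*) [NormedAddCommGroup E] [NormedSpace ℝ E]
    (M : Type*) [TopologicalSpace M] [ChartedSpace E M] : Set (M → ℝ) :=
  {H | ContMDiff 𝓘(ℝ, E) 𝓘(ℝ, ℝ) ∞ H ∧ HasCompactSupport H}

/-- The adjoint action `Ad_ψ K = (c_ψ K) ∘ ψ⁻¹`. -/
def Ad {α : OneForm E M} (ψ : Contactomorphism α) (K : M → ℝ) : M → ℝ :=
  fun x => ψ.factor (ψ.toDiffeo.symm x) * K (ψ.toDiffeo.symm x)

/-- A contact embedding `σ : M → M`: a smooth embedding (a topological embedding which is smooth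
with injective differentials) with `σ^* ξ = ξ` for `ξ = ker α`. -/
structure IsContactEmbedding (α : OneForm E M) (σ : M → M) : Prop where
  smooth : ContMDiff 𝓘(ℝ, E) 𝓘(ℝ, E) ∞ σ
  embedding : IsEmbedding σ
  immersion : ∀ x, Function.Injective (mfderiv 𝓘(ℝ, E) 𝓘(ℝ, E) σ x)
  contact : ∀ (x : M) (v : TangentSpace 𝓘(ℝ, E) x),
    α (σ x) (mfderiv 𝓘(ℝ, E) 𝓘(ℝ, E) σ x v) = 0 ↔ α x v = 0

/-- The map `σ` is joined to the identity by a smooth family `σ_t`, `t ∈ [0, 1]`, of contact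
embeddings `M → M`. -/
def ContactlyIsotopicToId (α : OneForm E M) (σ : M → M) : Prop :=
  ∃ S : ℝ → M → M,
    ContMDiffOn (𝓘(ℝ, ℝ).prod 𝓘(ℝ, E)) 𝓘(ℝ, E) ∞
      (fun p : ℝ × M => S p.1 p.2) (Icc (0 : ℝ) 1 ×ˢ univ) ∧
    (∀ t ∈ Icc (0 : ℝ) 1, IsContactEmbedding α (S t)) ∧ S 0 = id ∧ S 1 = σ

/-- The space `ℰ(M, ξ)` of contact embeddings `σ : M → M` that are contactly isotopic to the
identity and whose image has compact closure in `M`. (`M` is convex at infinity when this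
set is non-empty.) -/
def contractingEmbeddings (α : OneForm E M) : Set (M → M) :=
  {σ | IsContactEmbedding α σ ∧ ContactlyIsotopicToId α σ ∧ IsCompact (closure (range σ))}

/-- The maximal dominating cone `𝔤⁺`: the non-negative elements of the Lie algebra that are
positive on `σ(M)` for some `σ ∈ ℰ(M, ξ)`. -/
def gPlus (α : OneForm E M) : Set (M → ℝ) :=
  {H | H ∈ lieAlg E M ∧ (∀ x, 0 ≤ H x) ∧
    ∃ σ ∈ contractingEmbeddings α, ∀ x ∈ range σ, 0 < H x}

/-- Some `H ∈ 𝔤⁺` and `g ∈ G` satisfy `Ad_g H ≤ s H` with `0 < s < 1`. -/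
def HasSelfContraction (α : OneForm E M) : Prop :=
  ∃ H ∈ gPlus α, ∃ g ∈ contactGroup α, ∃ s : ℝ, 0 < s ∧ s < 1 ∧ ∀ x, Ad g H x ≤ s * H x

/-- Any element of `𝔤⁺` can be conjugated below any other one. -/
def AllComparable (α : OneForm E M) : Prop :=
  ∀ K₁ ∈ gPlus α, ∀ K₂ ∈ gPlus α, ∃ h ∈ contactGroup α, ∀ x, Ad h K₁ x ≤ K₂ x

/-- The cone `𝔤⁺` is non-orderable up to conjugation. The two conditions are equivalent when
`M` is connected and convex at infinity; both are demanded here, so that nothing is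
presupposed. -/
def NonOrderableUpToConjugation (α : OneForm E M) : Prop :=
  HasSelfContraction α ∧ AllComparable α

end General

/-! ### The standard contact sphere minus a coordinate subspace -/

/-- `ℝ²ⁿ` with its coordinates ordered as `(x₁, …, xₙ, y₁, …, yₙ)`. -/
abbrev R2 (n : ℕ) : Type := EuclideanSpace ℝ (Fin (n + n))

/-- The coordinate `x_i`. -/
def xCoord {n : ℕ} (i : Fin n) : R2 n →L[ℝ] ℝ := EuclideanSpace.proj (Fin.castAdd n i)

/-- The coordinate `y_i`. -/
def yCoord {n : ℕ} (i : Fin n) : R2 n →L[ℝ] ℝ := EuclideanSpace.proj (Fin.natAdd n i)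

/-- The standard Liouville form `½ ∑ (x_i dy_i - y_i dx_i)` at the point `p`. -/
def liouvilleForm (n : ℕ) (p : R2 n) : R2 n →L[ℝ] ℝ :=
  (1 / 2 : ℝ) • ∑ i : Fin n, (xCoord i p • yCoord i - yCoord i p • xCoord i)

/-- The coordinate subspace `Π_k` spanned by the last `k` vectors of the standard basis. -/
def coordSubspace (n k : ℕ) : Submodule ℝ (R2 n) :=
  Submodule.span ℝ {v | ∃ j : Fin (n + n), n + n ≤ (j : ℕ) + k ∧ v = EuclideanSpace.single j 1}

/-- Makes Mathlib's manifold structure on the unit sphere of `ℝ²ⁿ` available. -/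
instance finrankR2 (n : ℕ) [NeZero n] : Fact (finrank ℝ (R2 n) = (n + n - 1) + 1) :=
  ⟨by have := NeZero.pos n; rw [finrank_euclideanSpace_fin]; omega⟩

/-- The open subset `U_k = S²ⁿ⁻¹ ∖ Π_k` of the unit sphere. -/
def sphereMinus (n k : ℕ) : TopologicalSpace.Opens (sphere (0 : R2 n) 1) :=
  ⟨{p | (p : R2 n) ∉ coordSubspace n k},
    ((coordSubspace n k).closed_of_finiteDimensional.preimage
      continuous_subtype_val).isOpen_compl⟩

/-- The standard contact form on `U_k`: the pull-back of the Liouville form under the inclusion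
`U_k → ℝ²ⁿ`. -/
def alphaSt (n k : ℕ) [NeZero n] :
    OneForm (EuclideanSpace ℝ (Fin (n + n - 1))) (sphereMinus n k) := fun p =>
  (liouvilleForm n ((p : sphere (0 : R2 n) 1) : R2 n)).comp
    (mfderiv (𝓡 (n + n - 1)) 𝓘(ℝ, R2 n)
      (fun q : sphereMinus n k => ((q : sphere (0 : R2 n) 1) : R2 n)) p)

end ContactCone

end

/-! The orthogonal complement V of Π_k is spanned by 2n - k ≤ n of the x-directions, so it is
isotropic. With J the standard complex structure and P the projection to V, every point is p = x + J
y + z with x, y in V and z orthogonal to V and J V, and U_k is the part of the unit sphere where x ≠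
0. A map Φ of the cone {x ≠ 0} that is homogeneous of degree one and preserves the Liouville form
descends to a contact embedding of U_k with conformal factor |Φ|⁻² (`IsHomogeneousIsotopy`). Two
such isotopies carry the proof.

The linear flow `scaling`, with x ↦ e^τ x and y ↦ e^{-τ} y, pushes any compact subset of U_k into
the fixed compact set {|x|² ≥ 1/2}, and its conformal factor tends to 0 uniformly on that subset.
The map `squeeze` sends all of U_k into {|x|² ≥ 1/3}. Indeed the cone is T*V without its zero
section times a symplectic vector space, with momentum ξ = |x| x, position U and transversal part z.
A cotangent lift bounds U, and the Hamiltonian flow of |z|²⟪ξ, U⟫/|ξ| then raises |ξ| by |z|². Hence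
contracting embeddings exist and 𝔤⁺ is non-empty.

For (b), let K₂ be positive on the image of σ. On the support of K₁ take the scaling up to a large
time, followed by σ. The quotient of the conformal factor of σ by K₂ ∘ σ is bounded on {|x|² ≥ 1/2},
and the factor of the scaling is as small as desired, so the transported K₁ lies below K₂. Contact
isotopy extension (`ContactlyIsotopicToId.exists_contactGroup`) replaces this composite by an
element of G that agrees with it near the support. Elsewhere K₂ ≥ 0 suffices. Part (a) is (b) for H
and H/2.

Isotopy extension rests on smooth dependence of flows on initial data, by the implicit function
theorem for continuous curves (`exists_smooth_flow`), on contact Hamiltonian flows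
(`exists_contact_flow`), and on the fact that a contact vector field is determined by its
Hamiltonian (`IsContactIsotopy.exists_hamiltonian`). -/

noncomputable section

namespace ContactCone

/-! ### Smoothness of superposition operators -/

section Superposition

variable {I : Type} [TopologicalSpace I] [CompactSpace I]
  {F G : Type} [NormedAddCommGroup F] [NormedSpace ℝ F] [NormedAddCommGroup G] [NormedSpace ℝ G]

/-- Pointwise application of a continuous family of operators. -/
def pointwiseApply : C(I, F →L[ℝ] G) →L[ℝ] C(I, F) →L[ℝ] C(I, G) :=
  LinearMap.mkContinuous₂
    (LinearMap.mk₂ ℝ (fun (A : C(I, F →L[ℝ] G)) (γ : C(I, F)) =>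
        (⟨fun t => A t (γ t), A.continuous.clm_apply γ.continuous⟩ : C(I, G)))
      (fun _ _ _ => by ext; simp) (fun _ _ _ => by ext; simp)
      (fun _ _ _ => by ext; simp) (fun _ _ _ => by ext; simp)) 1
    (fun A γ => by
      rw [ContinuousMap.norm_le _ (by positivity)]
      intro t
      rw [one_mul]
      exact ((A t).le_opNorm _).trans
        (mul_le_mul (A.norm_coe_le_norm t) (γ.norm_coe_le_norm t) (norm_nonneg _)
          (norm_nonneg A)))

@[simp]
lemma pointwiseApply_apply (A : C(I, F →L[ℝ] G)) (γ : C(I, F)) (t : I) :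
    pointwiseApply A γ t = A t (γ t) := rfl

lemma norm_pointwiseApply_le (A : C(I, F →L[ℝ] G)) {K : ℝ} (hK : 0 ≤ K) (hA : ∀ t, ‖A t‖ ≤ K) :
    ‖pointwiseApply A‖ ≤ K := by
  refine ContinuousLinearMap.opNorm_le_bound _ hK fun γ => ?_
  rw [ContinuousMap.norm_le _ (by positivity)]
  intro t
  exact ((A t).le_opNorm _).trans
    (mul_le_mul (hA t) (γ.norm_coe_le_norm t) (norm_nonneg _) hK)

/-- Compact support makes `fderiv ℝ Z` uniformly continuous, so one δ serves the mean value
inequality at all times simultaneously, and the remainder is small in the sup norm. -/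
lemma hasFDerivAt_comp_left (Z : C(F, G)) (hZ : ContDiff ℝ 1 Z)
    (hs : HasCompactSupport (fderiv ℝ Z)) (γ : C(I, F)) :
    HasFDerivAt (fun γ : C(I, F) => Z.comp γ)
      (pointwiseApply ((⟨fderiv ℝ Z, hZ.continuous_fderiv one_ne_zero⟩ : C(F, F →L[ℝ] G)).comp γ))
      γ := by
  rw [hasFDerivAt_iff_isLittleO_nhds_zero, Asymptotics.isLittleO_iff]
  intro ε hε
  have hu : UniformContinuous (fderiv ℝ Z) :=
    hs.uniformContinuous_of_continuous (hZ.continuous_fderiv one_ne_zero)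
  obtain ⟨δ, hδ, hu⟩ := Metric.uniformContinuous_iff.1 hu ε hε
  filter_upwards [Metric.ball_mem_nhds (0 : C(I, F)) hδ] with h hh
  rw [mem_ball_zero_iff] at hh
  rw [ContinuousMap.norm_le _ (by positivity)]
  intro t
  have hht : ‖h t‖ < δ := (h.norm_coe_le_norm t).trans_lt hh
  have key := (convex_ball (γ t) δ).norm_image_sub_le_of_norm_fderiv_le' (𝕜 := ℝ) (f := Z)
    (φ := fderiv ℝ Z (γ t)) (C := ε) (x := γ t) (y := γ t + h t)
    (fun x _ => hZ.differentiable one_ne_zero x)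
    (fun x hx => by
      rw [← dist_eq_norm]
      exact (hu hx).le)
    (mem_ball_self hδ) (by simpa using hht)
  simp only [add_sub_cancel_left] at key
  exact key.trans (mul_le_mul_of_nonneg_left (h.norm_coe_le_norm t) hε.le)

/-- The derivative is `pointwiseApply` after the superposition operator of `fderiv ℝ Z`, so each
step gains one order. The target space changes with each derivative and is therefore quantified
inside the induction. -/
lemma contDiff_comp_left_nat (n : ℕ) : ∀ (G : Type) [NormedAddCommGroup G] [NormedSpace ℝ G]
    (Z : C(F, G)), ContDiff ℝ ∞ Z → HasCompactSupport (fderiv ℝ Z) →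
    ContDiff ℝ n (fun γ : C(I, F) => Z.comp γ) := by
  induction n with
  | zero =>
    intro G _ _ Z _ _
    exact contDiff_zero.2 (ContinuousMap.continuous_postcomp Z)
  | succ n ih =>
    intro G _ _ Z hZ hs
    have hd := hasFDerivAt_comp_left (I := I) Z (hZ.of_le (by simp)) hs
    push_cast
    rw [contDiff_succ_iff_fderiv]
    refine ⟨fun γ => (hd γ).differentiableAt, by simp, ?_⟩
    rw [show fderiv ℝ (fun γ : C(I, F) => Z.comp γ) = fun γ => _ from funext fun γ => (hd γ).fderiv]
    exact pointwiseApply.contDiff.comp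
      (ih (F →L[ℝ] G) ⟨fderiv ℝ Z, _⟩ (hZ.fderiv_right (by simp)) (hs.fderiv (𝕜 := ℝ)))

lemma contDiff_comp_left (Z : C(F, G)) (hZ : ContDiff ℝ ∞ Z)
    (hs : HasCompactSupport (fderiv ℝ Z)) :
    ContDiff ℝ ∞ (fun γ : C(I, F) => Z.comp γ) :=
  contDiff_infty.2 fun n => contDiff_comp_left_nat n G Z hZ hs

end Superposition

/-! ### Flows of bounded vector fields with compactly supported derivative -/

section Flow

variable {F : Type} [NormedAddCommGroup F] [NormedSpace ℝ F]

/-- The primitive vanishing at `0` of a continuous curve on the unit interval. -/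
def primitive : C(unitInterval, F) →L[ℝ] C(unitInterval, F) :=
  LinearMap.mkContinuous
    { toFun := fun γ => ⟨fun t => ∫ s in (0 : ℝ)..t, IccExtend zero_le_one γ s,
        (intervalIntegral.continuous_primitive
          (fun _ _ => (γ.continuous.Icc_extend' (h := zero_le_one)).intervalIntegrable _ _) 0).comp
          continuous_subtype_val⟩
      map_add' := fun γ γ' => by
        ext t
        exact intervalIntegral.integral_add
          ((γ.continuous.Icc_extend' (h := zero_le_one)).intervalIntegrable _ _)
          ((γ'.continuous.Icc_extend' (h := zero_le_one)).intervalIntegrable _ _)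
      map_smul' := fun c γ => by
        ext t
        exact intervalIntegral.integral_smul c _ } 1
    (fun γ => by
      rw [ContinuousMap.norm_le _ (by positivity)]
      intro t
      refine (intervalIntegral.norm_integral_le_of_norm_le_const (C := ‖γ‖)
        fun s _ => γ.norm_coe_le_norm _).trans ?_
      rw [one_mul, sub_zero, abs_of_nonneg t.2.1]
      exact mul_le_of_le_one_right (norm_nonneg _) t.2.2)

lemma primitive_apply (γ : C(unitInterval, F)) (t : unitInterval) :
    primitive γ t = ∫ s in (0 : ℝ)..t, IccExtend zero_le_one γ s := rfl

lemma norm_primitive_apply_le (γ : C(unitInterval, F)) : ‖primitive γ‖ ≤ ‖γ‖ := by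
  refine (ContinuousMap.norm_le _ (norm_nonneg _)).2 fun t => ?_
  refine (intervalIntegral.norm_integral_le_of_norm_le_const (C := ‖γ‖)
    fun s _ => γ.norm_coe_le_norm _).trans ?_
  rw [sub_zero, abs_of_nonneg t.2.1]
  exact mul_le_of_le_one_right (norm_nonneg _) t.2.2

/-- A global bound and a global Lipschitz constant let Picard–Lindelöf run on [-T, T] for every T,
and uniqueness glues the solutions. -/
lemma exists_global_solution [CompleteSpace F] {Z : F → F} {K M : NNReal} (hK : LipschitzWith K Z)
    (hM : ∀ x, ‖Z x‖ ≤ M) (p : F) :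
    ∃ c : ℝ → F, c 0 = p ∧ ∀ t, HasDerivAt c (Z (c t)) t := by
  have h : ∀ T : ℝ, 0 < T → ∃ c : ℝ → F, c 0 = p ∧
      ∀ t ∈ Ioo (-T) T, HasDerivAt c (Z (c t)) t := by
    intro T hT
    have hpl : IsPicardLindelof (fun _ : ℝ => Z) (tmin := -T) (tmax := T)
        ⟨0, by constructor <;> linarith⟩ p (M * T.toNNReal) 0 M K :=
      IsPicardLindelof.of_time_independent (fun x _ => hM x) hK.lipschitzOnWith
        (by simp [hT.le])
    obtain ⟨c, h0, hc⟩ := hpl.exists_eq_forall_mem_Icc_hasDerivWithinAt₀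
    exact ⟨c, h0, fun t ht =>
      (hc t (Ioo_subset_Icc_self ht)).hasDerivAt (Icc_mem_nhds ht.1 ht.2)⟩
  choose! c hc0 hc using h
  have hagree : ∀ T T' : ℝ, 0 < T → T ≤ T' → EqOn (c T) (c T') (Ioo (-T) T) := by
    intro T T' hT hTT'
    refine ODE_solution_unique_of_mem_Ioo (v := fun _ => Z) (s := fun _ => univ) (K := K)
      (t₀ := 0) (fun _ _ => hK.lipschitzOnWith) (by constructor <;> linarith)
      (fun t ht => ⟨hc T hT t ht, mem_univ _⟩)
      (fun t ht => ⟨hc T' (hT.trans_le hTT') t ⟨by linarith [ht.1], by linarith [ht.2]⟩,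
        mem_univ _⟩) ?_
    rw [hc0 T hT, hc0 T' (hT.trans_le hTT')]
  -- Reading off the solution with T = |t| + 1 keeps t in the interior of its interval.
  refine ⟨fun t => c (|t| + 1) t, hc0 _ (by positivity), fun t => ?_⟩
  have hpos : ∀ s : ℝ, 0 < |s| + 1 := fun s => by positivity
  have hmem : ∀ s : ℝ, s ∈ Ioo (-(|s| + 1)) (|s| + 1) := fun s =>
    abs_lt.1 (lt_add_one _)
  have hev : (fun s => c (|s| + 1) s) =ᶠ[𝓝 t] c (|t| + 2) := by
    filter_upwards [Metric.ball_mem_nhds t one_pos] with s hs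
    have : |s| ≤ |t| + 1 := by
      have h1 := abs_sub_abs_le_abs_sub s t
      rw [mem_ball, Real.dist_eq] at hs
      linarith
    exact hagree _ _ (hpos s) (by linarith) (hmem s)
  have h2 := hc (|t| + 2) (by positivity) t (abs_lt.1 (by linarith))
  rw [← hev.eq_of_nhds] at h2
  exact h2.congr_of_eventuallyEq hev

/-- The defect of a curve `γ` on the unit interval in the integral equation
`γ t = p + τ ∫₀ᵗ Z (γ s) ds`. -/
def integralDefect (Z : C(F, F)) (u : (ℝ × F) × C(unitInterval, F)) : C(unitInterval, F) :=
  u.2 - ContinuousLinearMap.const ℝ unitInterval u.1.2 - u.1.1 • primitive (Z.comp u.2)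

lemma contDiff_integralDefect (Z : C(F, F)) (hZ : ContDiff ℝ ∞ Z)
    (hs : HasCompactSupport (fderiv ℝ Z)) : ContDiff ℝ ∞ (integralDefect Z) := by
  have h1 := contDiff_comp_left (I := unitInterval) Z hZ hs
  have h2 : ContDiff ℝ ∞ fun u : (ℝ × F) × C(unitInterval, F) => u.1.1 :=
    contDiff_fst.comp contDiff_fst
  have h3 : ContDiff ℝ ∞ fun u : (ℝ × F) × C(unitInterval, F) => primitive (Z.comp u.2) :=
    primitive.contDiff.comp (h1.comp contDiff_snd)
  have h4 : ContDiff ℝ ∞ fun u : (ℝ × F) × C(unitInterval, F) =>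
      ContinuousLinearMap.const ℝ unitInterval u.1.2 :=
    (ContinuousLinearMap.contDiff _).comp (contDiff_snd.comp contDiff_fst)
  exact (contDiff_snd.sub h4).sub (h2.smul h3)

/-- For |τ| K < 1 the integral equation is a contraction. Uniqueness among all curves is what later
identifies the implicit function with the flow. -/
lemma integralDefect_injective (Z : C(F, F)) {K : NNReal} (hK : LipschitzWith K Z) {q : ℝ × F}
    (hq : |q.1| * K < 1) {γ γ' : C(unitInterval, F)}
    (h : integralDefect Z (q, γ) = 0) (h' : integralDefect Z (q, γ') = 0) : γ = γ' := by
  have hsub : γ - γ' = q.1 • primitive (Z.comp γ - Z.comp γ') := by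
    rw [map_sub, smul_sub, ← sub_eq_zero]
    have h3 := congrArg₂ (· - ·) h h'
    simp only [sub_zero, integralDefect] at h3
    rw [← h3]
    abel
  have hle : ‖γ - γ'‖ ≤ |q.1| * (K * ‖γ - γ'‖) := by
    conv_lhs => rw [hsub]
    rw [norm_smul, Real.norm_eq_abs]
    refine mul_le_mul_of_nonneg_left ?_ (abs_nonneg _)
    refine (norm_primitive_apply_le _).trans ?_
    have hpos : 0 ≤ (K : ℝ) * ‖γ - γ'‖ := mul_nonneg K.coe_nonneg (norm_nonneg (γ - γ'))
    refine (ContinuousMap.norm_le _ hpos).2 fun t => ?_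
    refine (hK.norm_sub_le (γ t) (γ' t)).trans ?_
    exact mul_le_mul_of_nonneg_left ((γ - γ').norm_coe_le_norm t) K.coe_nonneg
  rw [← sub_eq_zero, ← norm_eq_zero]
  have := norm_nonneg (γ - γ')
  nlinarith

/-- The partial derivative in the curve is the identity minus an operator of norm at most |τ| K < 1,
inverted by a Neumann series. -/
lemma isInvertible_fderiv_integralDefect [CompleteSpace F] (Z : C(F, F)) (hZ : ContDiff ℝ ∞ Z)
    (hs : HasCompactSupport (fderiv ℝ Z)) {K : NNReal} (hK : LipschitzWith K Z) {q : ℝ × F}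
    (hq : |q.1| * K < 1) (γ : C(unitInterval, F)) :
    (fderiv ℝ (integralDefect Z) (q, γ) ∘L .inr ℝ (ℝ × F) C(unitInterval, F)).IsInvertible := by
  let D := pointwiseApply
    ((⟨fderiv ℝ Z, hZ.continuous_fderiv (by simp)⟩ : C(F, F →L[ℝ] F)).comp γ)
  have hD : HasFDerivAt (fun γ : C(unitInterval, F) => integralDefect Z (q, γ))
      (ContinuousLinearMap.id ℝ _ - q.1 • primitive ∘L D) γ := by
    have h1 := hasFDerivAt_comp_left (I := unitInterval) Z (hZ.of_le (by simp)) hs γ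
    have h2 := (primitive.hasFDerivAt.comp γ h1).const_smul q.1
    exact HasFDerivAt.sub ((hasFDerivAt_id γ).sub_const
      (ContinuousLinearMap.const ℝ unitInterval q.2)) h2
  have hD' : HasFDerivAt (fun γ : C(unitInterval, F) => integralDefect Z (q, γ))
      (fderiv ℝ (integralDefect Z) (q, γ) ∘L .inr ℝ (ℝ × F) C(unitInterval, F)) γ :=
    HasFDerivAt.comp (f := fun γ : C(unitInterval, F) => (q, γ)) _
      ((contDiff_integralDefect Z hZ hs).differentiable (by simp) _).hasFDerivAt
      (hasFDerivAt_prodMk_right _ _)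
  rw [hD'.unique hD]
  have hnorm : ‖q.1 • primitive ∘L D‖ < 1 := by
    have hDn : ‖D‖ ≤ K := norm_pointwiseApply_le _ K.2 fun t => norm_fderiv_le_of_lipschitz ℝ hK
    refine (ContinuousLinearMap.opNorm_le_bound _ (by positivity) fun η => ?_).trans_lt hq
    calc ‖q.1 • primitive (D η)‖ = |q.1| * ‖primitive (D η)‖ := by
          rw [norm_smul, Real.norm_eq_abs]
      _ ≤ |q.1| * (K * ‖η‖) := mul_le_mul_of_nonneg_left
          ((norm_primitive_apply_le _).trans (D.le_of_opNorm_le hDn η)) (abs_nonneg _)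
      _ = |q.1| * K * ‖η‖ := by ring
  exact ⟨ContinuousLinearEquiv.ofUnit (Units.oneSub (q.1 • primitive ∘L D) hnorm), rfl⟩

/-- Rescaling to the unit interval turns the time τ into a parameter, so the implicit function
theorem yields smoothness in time and initial point at once. -/
lemma integralDefect_solution {Z : C(F, F)} {c : ℝ → F}
    (hc : ∀ t, HasDerivAt c (Z (c t)) t) (τ : ℝ) [CompleteSpace F] (γ : C(unitInterval, F))
    (hγ : ∀ t : unitInterval, γ t = c (τ * t)) :
    integralDefect Z ((τ, c 0), γ) = 0 := by
  ext t
  have hcc : Continuous c := continuous_iff_continuousAt.2 fun t => (hc t).continuousAt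
  have hcont : Continuous fun s : ℝ => Z (c (τ * s)) :=
    Z.continuous.comp (hcc.comp (continuous_const.mul continuous_id))
  have hint := intervalIntegral.integral_eq_sub_of_hasDerivAt (a := 0) (b := (t : ℝ))
    (f := fun s => c (τ * s)) (f' := fun s => τ • Z (c (τ * s)))
    (fun s _ => by
      have h1 : HasDerivAt (fun s => τ * s) τ s := by
        simpa using (hasDerivAt_id s).const_mul τ
      exact (hc (τ * s)).scomp s h1)
    ((hcont.const_smul τ).intervalIntegrable _ _)
  rw [intervalIntegral.integral_smul] at hint
  have hpr : primitive (Z.comp γ) t = ∫ s in (0 : ℝ)..t, Z (c (τ * s)) := by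
    rw [primitive_apply]
    refine intervalIntegral.integral_congr fun s hs => ?_
    rw [uIcc_of_le t.2.1] at hs
    have hs' : s ∈ Icc (0 : ℝ) 1 := ⟨hs.1, hs.2.trans t.2.2⟩
    simp only [IccExtend_of_mem zero_le_one _ hs', ContinuousMap.comp_apply, hγ]
  have : integralDefect Z ((τ, c 0), γ) t = γ t - c 0 - τ • primitive (Z.comp γ) t := rfl
  rw [this, hpr, hint, mul_zero, hγ]
  simp

/-- The implicit function of `integralDefect` is a smooth family of curves. By uniqueness these are
the rescaled flow lines, and evaluation at 1 gives the flow at time τ. -/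
lemma contDiffAt_solution [CompleteSpace F] (Z : C(F, F)) {K : NNReal} (hZ : ContDiff ℝ ∞ Z)
    (hs : HasCompactSupport (fderiv ℝ Z)) (hK : LipschitzWith K Z)
    {c : F → ℝ → F} (hc0 : ∀ p, c p 0 = p) (hc : ∀ p t, HasDerivAt (c p) (Z (c p t)) t)
    {τ : ℝ} (hτ : |τ| * K < 1) (p : F) :
    ContDiffAt ℝ ∞ (fun q : ℝ × F => c q.2 q.1) (τ, p) := by
  have hcc : ∀ p, Continuous (c p) := fun p =>
    continuous_iff_continuousAt.2 fun t => (hc p t).continuousAt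
  let sol : ℝ × F → C(unitInterval, F) := fun q =>
    ⟨fun t => c q.2 (q.1 * t), (hcc q.2).comp (continuous_const.mul continuous_subtype_val)⟩
  have hsol : ∀ q, integralDefect Z (q, sol q) = 0 := by
    rintro ⟨τ, p⟩
    have := integralDefect_solution (hc p) τ (sol (τ, p)) fun _ => rfl
    rwa [hc0] at this
  have cdf : ContDiffAt ℝ ∞ (integralDefect Z) ((τ, p), sol (τ, p)) :=
    (contDiff_integralDefect Z hZ hs).contDiffAt
  have hinv := isInvertible_fderiv_integralDefect Z hZ hs hK (q := (τ, p)) hτ (sol (τ, p))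
  have hψ := cdf.contDiffAt_implicitFunction (by simp) hinv
  have h1 := cdf.eventually_apply_implicitFunction (by simp) hinv
  set ψ := cdf.implicitFunction (by simp) hinv
  have hev : ∀ᶠ q in 𝓝 (τ, p), ψ q = sol q := by
    have h2 : ∀ᶠ q : ℝ × F in 𝓝 (τ, p), |q.1| * K < 1 :=
      ContinuousAt.eventually_lt
        ((continuous_abs.comp continuous_fst).mul continuous_const).continuousAt
        continuousAt_const hτ
    filter_upwards [h1, h2] with q hq1 hq2
    exact integralDefect_injective Z hK hq2 (hq1.trans (hsol _)) (hsol q)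
  have hfin : ContDiffAt ℝ ∞ (fun q => (ContinuousMap.evalCLM ℝ (1 : unitInterval)) (ψ q)) (τ, p) :=
    (ContinuousLinearMap.contDiff _).contDiffAt.comp _ hψ
  refine hfin.congr_of_eventuallyEq ?_
  filter_upwards [hev] with q hq
  rw [hq]
  simp [sol]

/-- Compact support is asked of `fderiv ℝ Z` and not of `Z`, because the suspension (1, X) of a
time-dependent field never vanishes. -/
lemma exists_smooth_flow [CompleteSpace F] {Z : F → F} (hZ : ContDiff ℝ ∞ Z)
    (hs : HasCompactSupport (fderiv ℝ Z)) {M : NNReal} (hM : ∀ x, ‖Z x‖ ≤ M) :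
    ∃ c : F → ℝ → F, (∀ p, c p 0 = p) ∧ (∀ p t, HasDerivAt (c p) (Z (c p t)) t) ∧
      (∀ p s t, c p (s + t) = c (c p s) t) ∧ ContDiff ℝ ∞ (fun q : ℝ × F => c q.2 q.1) := by
  obtain ⟨K₀, hK₀⟩ := hs.exists_bound_of_continuous (hZ.continuous_fderiv (by simp))
  have hK : LipschitzWith K₀.toNNReal Z :=
    lipschitzWith_of_nnnorm_fderiv_le (hZ.differentiable (by simp)) fun x => by
      rw [← NNReal.coe_le_coe, coe_nnnorm]
      exact (hK₀ x).trans (Real.le_coe_toNNReal _)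
  choose c hc0 hc using exists_global_solution hK hM
  have hadd : ∀ p s t, c p (s + t) = c (c p s) t := by
    intro p s t
    have := ODE_solution_unique_univ (v := fun _ => Z) (s := fun _ => univ)
      (K := K₀.toNNReal) (f := fun t => c p (s + t)) (g := c (c p s)) (t₀ := 0)
      (fun _ => hK.lipschitzOnWith) (fun t => ⟨(hc p (s + t)).comp_const_add s t, mem_univ _⟩)
      (fun t => ⟨hc _ t, mem_univ _⟩) (by simp [hc0])
    exact congrFun this t
  refine ⟨c, hc0, hc, hadd, ?_⟩
  set K := K₀.toNNReal
  have hloc : ∀ τ : ℝ, |τ| * K < 1 → ContDiff ℝ ∞ (c · τ) := fun τ hτ =>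
    contDiff_iff_contDiffAt.2 fun p =>
      (contDiffAt_solution ⟨Z, hZ.continuous⟩ hZ hs hK hc0 hc hτ p).comp p (contDiffAt_const.prodMk contDiffAt_id)
  have hnat : ∀ (n : ℕ) (τ : ℝ), |τ| * K < 1 → ContDiff ℝ ∞ (c · (n * τ)) := by
    intro n τ hτ
    induction n with
    | zero => simpa [hc0] using (contDiff_fun_id : ContDiff ℝ ∞ fun x : F => x)
    | succ n ih =>
      have : (fun p => c p ((n + 1 : ℕ) * τ)) = fun p => c (c p (n * τ)) τ := by
        funext p
        rw [← hadd]
        push_cast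
        ring_nf
      rw [this]
      exact (hloc τ hτ).comp ih
  -- Any t consists of n steps t / n that are short enough for the local result.
  have hall : ∀ t : ℝ, ContDiff ℝ ∞ (c · t) := by
    intro t
    obtain ⟨n, hn⟩ := exists_nat_gt (|t| * K)
    have hn0 : (0 : ℝ) < n := lt_of_le_of_lt (by positivity) hn
    have := hnat n (t / n) (by
      rw [abs_div, abs_of_pos hn0, div_mul_eq_mul_div, div_lt_one hn0]
      exact hn)
    rwa [mul_div_cancel₀ _ hn0.ne'] at this
  rw [contDiff_iff_contDiffAt]
  rintro ⟨t, p⟩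
  -- Near (t, p) the flow is the map at the fixed time t followed by the flow for the short time s -
  -- t, and the latter is jointly smooth near (0, c p t).
  have h0 : ContDiffAt ℝ ∞ (fun q : ℝ × F => c q.2 q.1) (0, c p t) :=
    contDiffAt_solution ⟨Z, hZ.continuous⟩ hZ hs hK hc0 hc (by simp) _
  have hcomp : ContDiffAt ℝ ∞ (fun q : ℝ × F => (q.1 - t, c q.2 t)) (t, p) :=
    ((contDiff_fst.sub contDiff_const).prodMk ((hall t).comp contDiff_snd)).contDiffAt
  have h0' : ContDiffAt ℝ ∞ (fun q : ℝ × F => c q.2 q.1)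
      ((fun q : ℝ × F => (q.1 - t, c q.2 t)) (t, p)) := by simpa using h0
  refine (h0'.comp (t, p) hcomp).congr_of_eventuallyEq (Filter.Eventually.of_forall ?_)
  rintro ⟨s, q⟩
  simp [← hadd]

/-- A compactly supported smooth time-dependent vector field has a smooth flow consisting of
diffeomorphisms with smooth inverses. -/
theorem exists_timeDependent_flow {E : Type} [NormedAddCommGroup E] [NormedSpace ℝ E]
    [CompleteSpace E] {X : ℝ × E → E} (hX : ContDiff ℝ ∞ X) (hs : HasCompactSupport X) :
    ∃ φ φ' : ℝ × E → E, ContDiff ℝ ∞ φ ∧ ContDiff ℝ ∞ φ' ∧ (∀ p, φ (0, p) = p) ∧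
      (∀ s p, HasDerivAt (fun s => φ (s, p)) (X (s, φ (s, p))) s) ∧
      (∀ s p, φ' (s, φ (s, p)) = p) ∧ (∀ s p, φ (s, φ' (s, p)) = p) := by
  -- Time becomes a coordinate of speed 1, which makes the field autonomous.
  let Z : ℝ × E → ℝ × E := fun z => (1, X z)
  have hZ : ContDiff ℝ ∞ Z := contDiff_const.prodMk hX
  have hZs : HasCompactSupport (fderiv ℝ Z) := by
    have : fderiv ℝ Z = fun z => (0 : ℝ × E →L[ℝ] ℝ).prod (fderiv ℝ X z) := funext fun z =>
      ((hasFDerivAt_const (1 : ℝ) z).prodMk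
        (hX.differentiable (by simp) z).hasFDerivAt).fderiv
    rw [this]
    refine (hs.fderiv (𝕜 := ℝ)).comp_left (g := fun A => (0 : ℝ × E →L[ℝ] ℝ).prod A) ?_
    ext <;> simp
  obtain ⟨M, hM⟩ := hs.exists_bound_of_continuous hX.continuous
  have hZM : ∀ z, ‖Z z‖ ≤ (max 1 M).toNNReal := fun z => by
    refine le_trans ?_ (Real.le_coe_toNNReal _)
    rw [Prod.norm_def]
    exact max_le_max (by simp [Z]) (hM z)
  obtain ⟨c, hc0, hc, hadd, hsm⟩ := exists_smooth_flow hZ hZs hZM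
  have hfst : ∀ z t, (c z t).1 = z.1 + t := by
    intro z t
    have hd : ∀ t, HasDerivAt (fun t => (c z t).1 - t) 0 t := fun t => by
      have h1 : HasDerivAt (fun t => (c z t).1) 1 t :=
        (ContinuousLinearMap.fst ℝ ℝ E).hasFDerivAt.comp_hasDerivAt t (hc z t)
      simpa using h1.fun_sub (hasDerivAt_id' t)
    have := is_const_of_deriv_eq_zero (fun t => (hd t).differentiableAt)
      (fun t => (hd t).deriv) t 0
    simp only [hc0, sub_zero] at this
    linarith
  have hinv : ∀ z t, c (c z t) (-t) = z := fun z t => by rw [← hadd, add_neg_cancel, hc0]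
  refine ⟨fun q => (c (0, q.2) q.1).2, fun q => (c q (-q.1)).2, ?_, ?_, fun p => by simp [hc0],
    fun s p => ?_, fun s p => ?_, fun s p => ?_⟩
  · exact contDiff_snd.comp (hsm.comp (contDiff_fst.prodMk (contDiff_const.prodMk contDiff_snd)))
  · exact contDiff_snd.comp (hsm.comp (contDiff_fst.neg.prodMk contDiff_id))
  · have h1 : HasDerivAt (fun s => (c (0, p) s).2) (Z (c (0, p) s)).2 s :=
      (ContinuousLinearMap.snd ℝ ℝ E).hasFDerivAt.comp_hasDerivAt s (hc (0, p) s)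
    have h2 : c (0, p) s = (s, (c (0, p) s).2) := Prod.ext (by simp [hfst]) rfl
    have h3 : (Z (c (0, p) s)).2 = X (s, (c (0, p) s).2) := by rw [← h2]
    rwa [h3] at h1
  · have h2 : (s, (c (0, p) s).2) = c (0, p) s := Prod.ext (by simp [hfst]) rfl
    simp only [h2, hinv]
  · have h2 : c (s, p) (-s) = (0, (c (s, p) (-s)).2) := Prod.ext (by simp [hfst]) rfl
    simp only
    rw [← h2]
    have := hinv (s, p) (-s)
    rw [neg_neg] at this
    rw [this]

end Flow

/-! ### Calculus preliminaries -/

section Calculus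

variable {E E' : Type} [NormedAddCommGroup E] [NormedSpace ℝ E]
  [NormedAddCommGroup E'] [NormedSpace ℝ E']

/-- Time and space derivatives of a time-dependent map commute. -/
lemma hasDerivAt_fderiv_space {f : ℝ × E → E'} {s : ℝ} {p : E} (hf : ContDiffAt ℝ 2 f (s, p))
    (v : E) :
    HasDerivAt (fun s => fderiv ℝ f (s, p) (0, v))
      (fderiv ℝ (fun z => fderiv ℝ f z (1, 0)) (s, p) (0, v)) s := by
  have hd : DifferentiableAt ℝ (fderiv ℝ f) (s, p) :=
    (hf.fderiv_right (m := 1) (by norm_num)).differentiableAt one_ne_zero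
  have hline : HasDerivAt (fun s : ℝ => (s, p)) ((1 : ℝ), (0 : E)) s :=
    (hasDerivAt_id' s).prodMk (hasDerivAt_const s p)
  have h1 : HasDerivAt (fun s => fderiv ℝ f (s, p)) (fderiv ℝ (fderiv ℝ f) (s, p) (1, 0)) s :=
    hd.hasFDerivAt.comp_hasDerivAt s hline
  have h2 := h1.clm_apply (hasDerivAt_const s ((0 : ℝ), v))
  have h3 := (hd.hasFDerivAt.clm_apply (hasFDerivAt_const ((1 : ℝ), (0 : E)) (s, p))).fderiv
  rw [h3]
  refine h2.congr_deriv ?_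
  have hsymm : IsSymmSndFDerivAt ℝ f (s, p) := hf.isSymmSndFDerivAt (by simp)
  simpa using hsymm (1, 0) (0, v)

lemma hasDerivAt_time {f : ℝ × E → E'} {s : ℝ} {p : E} (hf : DifferentiableAt ℝ f (s, p)) :
    HasDerivAt (fun s => f (s, p)) (fderiv ℝ f (s, p) (1, 0)) s :=
  hf.hasFDerivAt.comp_hasDerivAt s ((hasDerivAt_id' s).prodMk (hasDerivAt_const s p))

lemma hasFDerivAt_space {f : ℝ × E → E'} {s : ℝ} {p : E} (hf : DifferentiableAt ℝ f (s, p)) :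
    HasFDerivAt (fun p => f (s, p)) (fderiv ℝ f (s, p) ∘L .inr ℝ ℝ E) p :=
  HasFDerivAt.comp (f := fun p => (s, p)) p hf.hasFDerivAt (hasFDerivAt_prodMk_right s p)

/-- The variational equation of a flow. -/
lemma hasDerivAt_fderiv_flow {X φ : ℝ × E → E} (hX : Differentiable ℝ X) (hφ : ContDiff ℝ ∞ φ)
    (hd : ∀ s p, HasDerivAt (fun s => φ (s, p)) (X (s, φ (s, p))) s) (s : ℝ) (p v : E) :
    HasDerivAt (fun s => fderiv ℝ φ (s, p) (0, v))
      (fderiv ℝ X (s, φ (s, p)) (0, fderiv ℝ φ (s, p) (0, v))) s := by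
  have hdiff := hφ.differentiable (by simp)
  have h2 := hasDerivAt_fderiv_space (s := s) (p := p)
    ((hφ.of_le (by norm_cast)).contDiffAt (n := 2)) v
  have h3 : (fun z => fderiv ℝ φ z (1, 0)) = fun z => X (z.1, φ z) :=
    funext fun z => (hasDerivAt_time (hdiff (z.1, z.2))).unique (hd z.1 z.2)
  have hpair : HasFDerivAt (fun z : ℝ × E => (z.1, φ z))
      ((ContinuousLinearMap.fst ℝ ℝ E).prod (fderiv ℝ φ (s, p))) (s, p) :=
    hasFDerivAt_fst.prodMk (hdiff (s, p)).hasFDerivAt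
  have h4 := (hX (s, φ (s, p))).hasFDerivAt.comp (s, p) hpair
  rw [h3] at h2
  have h5 : fderiv ℝ (fun z : ℝ × E => X (z.1, φ z)) (s, p) = _ := h4.fderiv
  rw [h5] at h2
  simpa using h2

/-- An injective smooth map with injective differentials between spaces of the same dimension
has open image and a smooth inverse. -/
lemma exists_smooth_inverse [FiniteDimensional ℝ E] {f : E → E} {Ω : Set E}
    (hΩ : IsOpen Ω) (hf : ContDiffOn ℝ ∞ f Ω) (hinj : InjOn f Ω)
    (hd : ∀ x ∈ Ω, Function.Injective (fderiv ℝ f x)) :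
    IsOpen (f '' Ω) ∧ ∃ g : E → E, ContDiffOn ℝ ∞ g (f '' Ω) ∧ ∀ x ∈ Ω, g (f x) = x := by
  have hloc : ∀ x ∈ Ω, ∃ e : OpenPartialHomeomorph E E, x ∈ e.source ∧ e.source ⊆ Ω ∧
      (∀ y, e y = f y) ∧ ContDiffAt ℝ ∞ e.symm (f x) := by
    intro x hx
    have hfx : ContDiffAt ℝ ∞ f x := hf.contDiffAt (hΩ.mem_nhds hx)
    let e' : E ≃L[ℝ] E := (LinearEquiv.ofInjectiveEndo (fderiv ℝ f x : E →ₗ[ℝ] E)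
      (hd x hx)).toContinuousLinearEquiv
    have he' : HasFDerivAt f (e' : E →L[ℝ] E) x := by
      convert! (hfx.differentiableAt (by simp)).hasFDerivAt
    let e := hfx.toOpenPartialHomeomorph f he' (by simp)
    have hxe : x ∈ e.source := hfx.mem_toOpenPartialHomeomorph_source he' (by simp)
    refine ⟨e.restrOpen Ω hΩ, ⟨hxe, hx⟩, fun y hy => hy.2, fun y => rfl, ?_⟩
    exact hfx.to_localInverse he' (by simp)
  have hopen : IsOpen (f '' Ω) := by
    rw [isOpen_iff_mem_nhds]
    rintro _ ⟨x, hx, rfl⟩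
    obtain ⟨e, hxe, heΩ, hef, -⟩ := hloc x hx
    refine Filter.mem_of_superset (e.open_target.mem_nhds (x := f x) ?_) ?_
    · rw [← hef]
      exact e.map_source hxe
    · intro y hy
      refine ⟨e.symm y, heΩ (e.map_target hy), ?_⟩
      rw [← hef, e.right_inv hy]
  refine ⟨hopen, Function.invFunOn f Ω, ?_, fun x hx => hinj.leftInvOn_invFunOn hx⟩
  rintro _ ⟨x, hx, rfl⟩
  obtain ⟨e, hxe, heΩ, hef, hsm⟩ := hloc x hx
  refine (hsm.congr_of_eventuallyEq ?_).contDiffWithinAt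
  have ht : f x ∈ e.target := hef x ▸ e.map_source hxe
  filter_upwards [e.open_target.mem_nhds ht] with y hy
  have : y = f (e.symm y) := by rw [← hef, e.right_inv hy]
  conv_lhs => rw [this]
  exact hinj.leftInvOn_invFunOn (heΩ (e.map_target hy))

end Calculus

/-! ### Contact Hamiltonian vector fields on spheres -/

section ContactField

variable {E : Type} [NormedAddCommGroup E] [InnerProductSpace ℝ E]

/-- `J` is an orthogonal complex structure; it gives the symplectic form `⟪J p, v⟫`. -/
structure IsComplexStructure (J : E →L[ℝ] E) : Prop where
  skew : ∀ x y, inner ℝ (J x) y = - inner ℝ x (J y)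
  sq : ∀ x, J (J x) = - x

variable {J : E →L[ℝ] E}

lemma IsComplexStructure.inner_self (hJ : IsComplexStructure J) (x : E) :
    inner ℝ (J x) x = 0 := by
  have := hJ.skew x x
  rw [real_inner_comm x (J x)] at this
  linarith [real_inner_comm x (J x)]

lemma IsComplexStructure.inner_map_map (hJ : IsComplexStructure J) (x y : E) :
    inner ℝ (J x) (J y) = inner ℝ x y := by
  rw [hJ.skew, hJ.sq, inner_neg_right, neg_neg]

variable [FiniteDimensional ℝ E]

/-- The vector representing a linear functional. -/
def sharp : (E →L[ℝ] ℝ) →L[ℝ] E :=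
  ∑ i, (ContinuousLinearMap.apply ℝ ℝ (stdOrthonormalBasis ℝ E i)).smulRight
    (stdOrthonormalBasis ℝ E i)

lemma inner_sharp (f : E →L[ℝ] ℝ) (w : E) : inner ℝ (sharp f) w = f w := by
  conv_rhs => rw [← (stdOrthonormalBasis ℝ E).sum_repr' w]
  simp [sharp, sum_inner, inner_smul_left, mul_comm]

/-- The gradient in the space directions of a time-dependent function. -/
def spaceGrad (k : ℝ × E → ℝ) (z : ℝ × E) : E := sharp (fderiv ℝ k z ∘L .inr ℝ ℝ E)

lemma inner_spaceGrad (k : ℝ × E → ℝ) (z : ℝ × E) (w : E) :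
    inner ℝ (spaceGrad k z) w = fderiv ℝ k z (0, w) := by
  rw [spaceGrad, inner_sharp]
  simp

/-- A vector field which is tangent to all spheres around `0` and restricts to the contact vector
field of the Hamiltonian `k` on the unit sphere. -/
def contactField (J : E →L[ℝ] E) (k : ℝ × E → ℝ) (z : ℝ × E) : E :=
  (inner ℝ z.2 z.2 : ℝ) • J (spaceGrad k z) - (inner ℝ (J (spaceGrad k z)) z.2 : ℝ) • z.2
    + (2 * k z - fderiv ℝ k z (0, z.2)) • J z.2

variable {k : ℝ × E → ℝ}

lemma contDiff_spaceGrad (hk : ContDiff ℝ ∞ k) : ContDiff ℝ ∞ (spaceGrad k) := by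
  have h1 : ContDiff ℝ ∞ (fderiv ℝ k) := hk.fderiv_right (by simp)
  exact sharp.contDiff.comp (h1.clm_comp contDiff_const)

lemma contDiff_contactField (hk : ContDiff ℝ ∞ k) : ContDiff ℝ ∞ (contactField J k) := by
  have h1 : ContDiff ℝ ∞ (fderiv ℝ k) := hk.fderiv_right (by simp)
  have h2 : ContDiff ℝ ∞ fun z => J (spaceGrad k z) := J.contDiff.comp (contDiff_spaceGrad hk)
  have h3 : ContDiff ℝ ∞ fun z : ℝ × E => fderiv ℝ k z (0, z.2) :=
    h1.clm_apply (contDiff_const.prodMk contDiff_snd)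
  have h4 : ContDiff ℝ ∞ fun z : ℝ × E => J z.2 := J.contDiff.comp contDiff_snd
  exact (((contDiff_snd.inner ℝ contDiff_snd).smul h2).sub
    ((h2.inner ℝ contDiff_snd).smul contDiff_snd)).add
    (((contDiff_const.mul hk).sub h3).smul h4)

lemma contactField_eq_zero {z : ℝ × E} (hz : z ∉ tsupport k) : contactField J k z = 0 := by
  have h1 : k z = 0 := image_eq_zero_of_notMem_tsupport hz
  have h2 : fderiv ℝ k z = 0 := image_eq_zero_of_notMem_tsupport fun h =>
    hz (tsupport_fderiv_subset ℝ h)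
  have h3 : spaceGrad k z = 0 := by simp [spaceGrad, h2]
  simp [contactField, h1, h2, h3]

lemma hasCompactSupport_contactField (hs : HasCompactSupport k) :
    HasCompactSupport (contactField J k) :=
  hs.of_isClosed_subset (isClosed_tsupport _) <| closure_minimal
    (fun _ hz => by_contra fun h => hz (contactField_eq_zero h)) (isClosed_tsupport _)

lemma inner_contactField_self (hJ : IsComplexStructure J) (z : ℝ × E) :
    inner ℝ (contactField J k z) z.2 = 0 := by
  simp only [contactField, inner_add_left, inner_sub_left, inner_smul_left, hJ.inner_self]
  simp
  ring

/-- As α is half of ⟪J p, ·⟫, on the unit sphere this reads α(X) = k. The factor |p|² makes it an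
identity on the whole space, which can be differentiated in every direction. -/
lemma symp_self_contactField (hJ : IsComplexStructure J) (z : ℝ × E) :
    inner ℝ (J z.2) (contactField J k z) = 2 * k z * inner ℝ z.2 z.2 := by
  simp only [contactField, inner_add_right, inner_sub_right, inner_smul_right, hJ.inner_self,
    hJ.inner_map_map]
  rw [real_inner_comm (spaceGrad k z) z.2, inner_spaceGrad]
  ring

/-- For a unit vector `z.2` and `w` in the contact hyperplane only the term with `fderiv ℝ k z (0,
w)` survives. -/
lemma symp_contactField (hJ : IsComplexStructure J) (z : ℝ × E) (w : E) :
    inner ℝ (J (contactField J k z)) w = - inner ℝ z.2 z.2 * fderiv ℝ k z (0, w)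
      - inner ℝ (J (spaceGrad k z)) z.2 * inner ℝ (J z.2) w
      - (2 * k z - fderiv ℝ k z (0, z.2)) * inner ℝ z.2 w := by
  simp only [contactField, map_add, map_sub, map_smul, inner_add_left, inner_sub_left,
    inner_smul_left, hJ.sq, inner_neg_left, inner_spaceGrad]
  simp
  ring

/-- The infinitesimal contact condition. -/
lemma contactField_conformal (hJ : IsComplexStructure J) (hk : ContDiff ℝ ∞ k) {s : ℝ} {p w : E}
    (hp : inner ℝ p p = (1 : ℝ)) (hw : inner ℝ p w = (0 : ℝ)) :
    inner ℝ (J (contactField J k (s, p))) w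
        + inner ℝ (J p) (fderiv ℝ (contactField J k) (s, p) (0, w))
      = -2 * inner ℝ (J (spaceGrad k (s, p))) p * inner ℝ (J p) w := by
  have hX := ((contDiff_contactField (J := J) hk).differentiable (by simp) (s, p)).hasFDerivAt
  have hk' := (hk.differentiable (by simp) (s, p)).hasFDerivAt
  have hsnd : HasFDerivAt (fun z : ℝ × E => z.2) (.snd ℝ ℝ E) (s, p) := hasFDerivAt_snd
  have hJs : HasFDerivAt (fun z : ℝ × E => J z.2) (J ∘L .snd ℝ ℝ E) (s, p) :=
    J.hasFDerivAt.comp (s, p) hsnd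
  have h1 := hJs.inner ℝ hX
  have h2 := (hk'.const_mul 2).mul (hsnd.inner ℝ hsnd)
  -- Differentiating this identity in the direction w expresses ⟪J p, DX w⟫ through dk(w) and ⟪J X,
  -- w⟫; `symp_contactField` then eliminates dk(w).
  have h3 : (fun z : ℝ × E => inner ℝ (J z.2) (contactField J k z))
      = fun z => 2 * k z * inner ℝ z.2 z.2 := funext fun z => symp_self_contactField hJ z
  rw [h3] at h1
  have h4 := congrArg (fun A => A (0, w)) (h1.unique h2)
  have h5 : inner ℝ (J w) (contactField J k (s, p)) = - inner ℝ (J (contactField J k (s, p))) w := by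
    rw [hJ.skew, real_inner_comm]
  have hp' : ‖p‖ ^ 2 = 1 := by rw [← real_inner_self_eq_norm_sq, hp]
  have h6 := symp_contactField (k := k) hJ (s, p) w
  simp [fderivInnerCLM_apply, hp', hw, real_inner_comm p w] at h4 h6 ⊢
  linarith

/-- The flow of a compactly supported contact Hamiltonian. -/
theorem exists_contact_flow (hJ : IsComplexStructure J) (hk : ContDiff ℝ ∞ k)
    (hs : HasCompactSupport k) :
    ∃ φ φ' : ℝ × E → E, ContDiff ℝ ∞ φ ∧ ContDiff ℝ ∞ φ' ∧ (∀ p, φ (0, p) = p) ∧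
      (∀ s p, HasDerivAt (fun s => φ (s, p)) (contactField J k (s, φ (s, p))) s) ∧
      (∀ s p, φ' (s, φ (s, p)) = p) ∧ (∀ s p, φ (s, φ' (s, p)) = p) ∧
      (∀ s p, ‖φ (s, p)‖ = ‖p‖) ∧
      (∀ s p, p ∉ Prod.snd '' tsupport k → φ (s, p) = p) ∧
      ∃ c : ℝ × E → ℝ, (∀ z, 0 < c z) ∧ ∀ s p v, inner ℝ p p = (1 : ℝ) → inner ℝ p v = (0 : ℝ) →
        inner ℝ (J (φ (s, p))) (fderiv ℝ φ (s, p) (0, v)) = c (s, p) * inner ℝ (J p) v := by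
  have hX := contDiff_contactField (J := J) hk
  have hXs := hasCompactSupport_contactField (J := J) hs
  obtain ⟨φ, φ', hφ, hφ', h0, hd, hl, hr⟩ := exists_timeDependent_flow hX hXs
  have hsq : ∀ s p, inner ℝ (φ (s, p)) (φ (s, p)) = (inner ℝ p p : ℝ) := by
    intro s p
    have hd' : ∀ s, HasDerivAt (fun s => (inner ℝ (φ (s, p)) (φ (s, p)) : ℝ)) 0 s := fun s => by
      refine ((hd s p).inner ℝ (hd s p)).congr_deriv ?_
      have := inner_contactField_self (k := k) hJ (s, φ (s, p))
      rw [this, real_inner_comm, this, add_zero]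
    have := is_const_of_deriv_eq_zero (fun s => (hd' s).differentiableAt)
      (fun s => (hd' s).deriv) s 0
    simpa [h0] using this
  refine ⟨φ, φ', hφ, hφ', h0, hd, hl, hr, fun s p => ?_, fun s p hp => ?_, ?_⟩
  · rw [← sq_eq_sq₀ (norm_nonneg _) (norm_nonneg _), ← real_inner_self_eq_norm_sq,
      ← real_inner_self_eq_norm_sq, hsq]
  -- Outside the projected support the constant curve solves the same equation.
  · obtain ⟨K, hK⟩ := hX.lipschitzWith_of_hasCompactSupport hXs (by simp)
    have hconst : ∀ s, contactField J k (s, p) = 0 := fun s =>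
      contactField_eq_zero fun h => hp ⟨_, h, rfl⟩
    have := ODE_solution_unique_univ (v := fun s q => contactField J k (s, q))
      (s := fun _ => univ) (K := K) (f := fun s => φ (s, p)) (g := fun _ => p) (t₀ := 0)
      (fun s => (by simpa [Function.comp_def] using hK.comp (LipschitzWith.prodMk_left s) :
        LipschitzWith K fun q => contactField J k (s, q)).lipschitzOnWith)
      (fun s => ⟨hd s p, mem_univ _⟩)
      (fun s => ⟨by simpa [hconst] using hasDerivAt_const s p, mem_univ _⟩) (h0 p)
    exact congrFun this s
  -- For tangent v the function L = ⟪J φ, dφ v⟫ satisfies L' = a L by `contactField_conformal`, with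
  -- `a` independent of v. Hence L is exp(∫ a) times its initial value.
  · let a : E → ℝ → ℝ := fun p s => -2 * inner ℝ (J (spaceGrad k (s, φ (s, p)))) (φ (s, p))
    have ha : ∀ p, Continuous (a p) := fun p => by
      have h1 : Continuous fun s : ℝ => φ (s, p) := hφ.continuous.comp (by fun_prop)
      have h2 : Continuous fun s : ℝ => J (spaceGrad k (s, φ (s, p))) :=
        J.continuous.comp ((contDiff_spaceGrad hk).continuous.comp (continuous_id.prodMk h1))
      exact continuous_const.mul (h2.inner h1)
    refine ⟨fun z => Real.exp (∫ t in (0 : ℝ)..z.1, a z.2 t), fun z => Real.exp_pos _,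
      fun s p v hp hv => ?_⟩
    have hdiff := hφ.differentiable (by simp)
    have horth : ∀ s, inner ℝ (φ (s, p)) (fderiv ℝ φ (s, p) (0, v)) = (0 : ℝ) := by
      intro s
      have h1 := hasFDerivAt_space (hdiff (s, p))
      have h2 := (h1.inner ℝ h1)
      have h3 : (fun p => (inner ℝ (φ (s, p)) (φ (s, p)) : ℝ)) = fun p => inner ℝ p p :=
        funext fun p => hsq s p
      rw [h3] at h2
      have h4 := congrArg (fun A => A v)
        (h2.unique ((hasFDerivAt_id p).inner ℝ (hasFDerivAt_id p)))
      simp [fderivInnerCLM_apply, hv, real_inner_comm p v,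
        real_inner_comm (φ (s, p)) (fderiv ℝ φ (s, p) (0, v))] at h4
      linarith
    have hL : ∀ s, HasDerivAt
        (fun s => (inner ℝ (J (φ (s, p))) (fderiv ℝ φ (s, p) (0, v)) : ℝ))
        (a p s * inner ℝ (J (φ (s, p))) (fderiv ℝ φ (s, p) (0, v))) s := by
      intro s
      have h1 := J.hasFDerivAt.comp_hasDerivAt s (hd s p)
      have h2 := hasDerivAt_fderiv_flow (hX.differentiable (by simp)) hφ hd s p v
      refine (h1.inner ℝ h2).congr_deriv ?_
      exact (add_comm _ _).trans <| contactField_conformal hJ hk (by rw [hsq, hp]) (horth s)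
    have hA : ∀ s, HasDerivAt (fun s => ∫ t in (0 : ℝ)..s, a p t) (a p s) s := fun s =>
      intervalIntegral.integral_hasDerivAt_right ((ha p).intervalIntegrable _ _)
        ((ha p).stronglyMeasurableAtFilter _ _) (ha p).continuousAt
    have hq : ∀ s, HasDerivAt (fun s => (inner ℝ (J (φ (s, p))) (fderiv ℝ φ (s, p) (0, v)) : ℝ)
        * Real.exp (-∫ t in (0 : ℝ)..s, a p t)) 0 s := fun s => by
      refine ((hL s).mul (hA s).neg.exp).congr_deriv ?_
      ring
    have := is_const_of_deriv_eq_zero (fun s => (hq s).differentiableAt)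
      (fun s => (hq s).deriv) s 0
    have hid : fderiv ℝ φ (0, p) (0, v) = v := by
      have h1 := hasFDerivAt_space (hdiff (0, p))
      rw [show (fun p => φ (0, p)) = id from funext h0] at h1
      have := congrArg (fun A => A v) (h1.unique (hasFDerivAt_id p))
      simpa using this
    simp only [intervalIntegral.integral_same, neg_zero, Real.exp_zero, mul_one, h0, hid] at this
    rw [← this, Real.exp_neg]
    field_simp

end ContactField

/-! ### Extension of contact isotopies in homogeneous form -/

section IsotopyExtension

variable {E : Type} [NormedAddCommGroup E] [InnerProductSpace ℝ E] {J : E →L[ℝ] E}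

/-- A smooth isotopy, defined for all times, of norm preserving embeddings of the open set `C`
into itself which preserve the contact hyperplanes. -/
structure IsContactIsotopy (J : E →L[ℝ] E) (C : Set E) (S : ℝ × E → E) : Prop where
  smooth : ContDiffOn ℝ ∞ S (univ ×ˢ C)
  mapsTo : ∀ s, ∀ p ∈ C, S (s, p) ∈ C
  norm_eq : ∀ s, ∀ p ∈ C, ‖S (s, p)‖ = ‖p‖
  injOn : ∀ s, InjOn (fun p => S (s, p)) C
  immersion : ∀ s, ∀ p ∈ C, ∀ v, fderiv ℝ S (s, p) (0, v) = 0 → v = 0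
  zero_apply : ∀ p ∈ C, S (0, p) = p
  contact : ∀ s, ∀ p ∈ C, ∀ v, inner ℝ p v = (0 : ℝ) →
    (inner ℝ (J (S (s, p))) (fderiv ℝ S (s, p) (0, v)) = (0 : ℝ) ↔ inner ℝ (J p) v = (0 : ℝ))

variable {C : Set E} {S : ℝ × E → E}

lemma IsContactIsotopy.contDiffAt (hS : IsContactIsotopy J C S) (hC : IsOpen C) (s : ℝ) {p : E}
    (hp : p ∈ C) : ContDiffAt ℝ ∞ S (s, p) :=
  hS.smooth.contDiffAt ((isOpen_univ.prod hC).mem_nhds ⟨mem_univ _, hp⟩)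

lemma IsContactIsotopy.inner_fderiv_space (hS : IsContactIsotopy J C S) (hC : IsOpen C) (s : ℝ)
    {p : E} (hp : p ∈ C) (v : E) :
    inner ℝ (S (s, p)) (fderiv ℝ S (s, p) (0, v)) = (inner ℝ p v : ℝ) := by
  have h1 := hasFDerivAt_space ((hS.contDiffAt hC s hp).differentiableAt (by simp))
  have h2 : HasFDerivAt (fun p => (inner ℝ (S (s, p)) (S (s, p)) : ℝ)) _ p :=
    ((hasFDerivAt_id p).inner ℝ (hasFDerivAt_id p)).congr_of_eventuallyEq <| by
      filter_upwards [hC.mem_nhds hp] with q hq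
      simp [hS.norm_eq s q hq]
  have h3 := congrArg (fun A => A v) ((h1.inner ℝ h1).unique h2)
  simp [fderivInnerCLM_apply, real_inner_comm p v,
    real_inner_comm (S (s, p)) (fderiv ℝ S (s, p) (0, v))] at h3
  linarith

/-- The vector field of a contact isotopy: it is tangent to spheres and infinitesimally contact. -/
lemma IsContactIsotopy.exists_velocity [FiniteDimensional ℝ E] (hS : IsContactIsotopy J C S)
    (hC : IsOpen C) :
    ∃ (O : Set (ℝ × E)) (X : ℝ × E → E), IsOpen O ∧ (∀ z ∈ O, z.2 ∈ C) ∧ ContDiffOn ℝ ∞ X O ∧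
      ∀ s, ∀ p ∈ C, (s, S (s, p)) ∈ O ∧ HasDerivAt (fun s => S (s, p)) (X (s, S (s, p))) s ∧
        inner ℝ (S (s, p)) (X (s, S (s, p))) = (0 : ℝ) ∧
        ∀ w, inner ℝ (S (s, p)) w = (0 : ℝ) → inner ℝ (J (S (s, p))) w = (0 : ℝ) →
          inner ℝ (J (X (s, S (s, p)))) w
            + inner ℝ (J (S (s, p))) (fderiv ℝ X (s, S (s, p)) (0, w)) = 0 := by
  let Ω : Set (ℝ × E) := univ ×ˢ C
  have hΩ : IsOpen Ω := isOpen_univ.prod hC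
  -- The track map is an injective immersion in equal dimensions, so it has open image and a smooth
  -- inverse `g`. The velocity field is the time derivative of `S` composed with `g`.
  let T : ℝ × E → ℝ × E := fun z => (z.1, S z)
  have hT : ContDiffOn ℝ ∞ T Ω := contDiff_fst.contDiffOn.prodMk hS.smooth
  have hSd : ∀ s, ∀ p ∈ C, DifferentiableAt ℝ S (s, p) := fun s p hp =>
    (hS.contDiffAt hC s hp).differentiableAt (by simp)
  have hTd : ∀ z ∈ Ω, fderiv ℝ T z = (ContinuousLinearMap.fst ℝ ℝ E).prod (fderiv ℝ S z) :=
    fun z hz => (hasFDerivAt_fst.prodMk (hSd z.1 z.2 hz.2).hasFDerivAt).fderiv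
  obtain ⟨hO, g, hg, hgT⟩ := exists_smooth_inverse hΩ hT
    (by
      rintro ⟨s, p⟩ hp ⟨s', p'⟩ hp' h
      obtain ⟨rfl, h2⟩ := Prod.ext_iff.1 h
      exact Prod.ext rfl (hS.injOn s hp.2 hp'.2 h2))
    (by
      intro z hz
      rw [injective_iff_map_eq_zero, hTd z hz]
      rintro ⟨a, v⟩ h
      obtain ⟨rfl, h2⟩ := Prod.ext_iff.1 h
      exact Prod.ext rfl (hS.immersion z.1 z.2 hz.2 v h2))
  let V : ℝ × E → E := fun z => fderiv ℝ S z (1, 0)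
  have hV : ContDiffOn ℝ ∞ V Ω :=
    (hS.smooth.fderiv_of_isOpen hΩ (by simp)).clm_apply contDiffOn_const
  have hgmaps : MapsTo g (T '' Ω) Ω := by
    rintro _ ⟨z, hz, rfl⟩
    rwa [hgT z hz]
  refine ⟨T '' Ω, V ∘ g, hO, ?_, hV.comp hg hgmaps, fun s p hp => ?_⟩
  · rintro _ ⟨z, hz, rfl⟩
    exact hS.mapsTo z.1 z.2 hz.2
  have hz : (s, p) ∈ Ω := ⟨mem_univ _, hp⟩
  have hgz : g (s, S (s, p)) = (s, p) := hgT (s, p) hz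
  have hTz : (s, S (s, p)) ∈ T '' Ω := ⟨(s, p), hz, rfl⟩
  have hXz : (V ∘ g) (s, S (s, p)) = fderiv ℝ S (s, p) (1, 0) := by
    simp only [Function.comp_apply, hgz, V]
  have hder : ∀ s, HasDerivAt (fun s => S (s, p)) (fderiv ℝ S (s, p) (1, 0)) s := fun s =>
    hasDerivAt_time (hSd s p hp)
  have hXd : DifferentiableAt ℝ (V ∘ g) (s, S (s, p)) :=
    ((hV.comp hg hgmaps).contDiffAt (hO.mem_nhds hTz)).differentiableAt (by simp)
  refine ⟨hTz, by rw [hXz]; exact hder s, ?_, fun w hw hJw => ?_⟩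
  · rw [hXz]
    have h1 := (hder s).inner ℝ (hder s)
    have h2 : (fun s => (inner ℝ (S (s, p)) (S (s, p)) : ℝ)) = fun _ => ‖p‖ ^ 2 := funext fun s => by
      rw [real_inner_self_eq_norm_sq, hS.norm_eq s p hp]
    rw [h2] at h1
    have h3 := h1.unique (hasDerivAt_const s _)
    rw [real_inner_comm (S (s, p))] at h3
    linarith
  -- `w` is the image of a fixed `v` in the contact hyperplane at `p`. So ⟪J S, dS v⟫ vanishes at
  -- all times, and its time derivative gives the claim.
  · obtain ⟨v, rfl⟩ : ∃ v, fderiv ℝ S (s, p) (0, v) = w := by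
      have : Function.Injective (fderiv ℝ S (s, p) ∘L .inr ℝ ℝ E : E →L[ℝ] E) := by
        rw [injective_iff_map_eq_zero]
        intro v hv
        exact hS.immersion s p hp v (by simpa using hv)
      obtain ⟨v, hv⟩ := (LinearMap.injective_iff_surjective
        (f := ((fderiv ℝ S (s, p) ∘L .inr ℝ ℝ E : E →L[ℝ] E) : E →ₗ[ℝ] E))).1 this w
      exact ⟨v, by simpa using hv⟩
    have hv : inner ℝ p v = (0 : ℝ) := by
      rw [← hS.inner_fderiv_space hC s hp v, hw]
    have hJv : inner ℝ (J p) v = (0 : ℝ) := (hS.contact s p hp v hv).1 hJw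
    have h1 := J.hasFDerivAt.comp_hasDerivAt s (hder s)
    have h2 := hasDerivAt_fderiv_space
      ((hS.contDiffAt hC s hp).of_le (by norm_cast : (2 : ℕ∞ω) ≤ ∞)) v
    have h3 := h1.inner ℝ h2
    have h4 : (fun s => (inner ℝ (J (S (s, p))) (fderiv ℝ S (s, p) (0, v)) : ℝ)) = fun _ => 0 :=
      funext fun s => (hS.contact s p hp v hv).2 hJv
    have hVX : V =ᶠ[𝓝 (s, p)] (V ∘ g) ∘ T := by
      filter_upwards [hΩ.mem_nhds hz] with z hz
      simp only [Function.comp_apply, hgT z hz]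
    have h5 : fderiv ℝ V (s, p) (0, v)
        = fderiv ℝ (V ∘ g) (s, S (s, p)) (0, fderiv ℝ S (s, p) (0, v)) := by
      have hTf := hasFDerivAt_fst.prodMk (hSd s p hp).hasFDerivAt
      have h6 : HasFDerivAt ((V ∘ g) ∘ T) _ (s, p) := hXd.hasFDerivAt.comp (s, p) hTf
      rw [hVX.fderiv_eq, h6.fderiv]
      simp
    have h7 := h3.unique (h4 ▸ hasDerivAt_const s (0 : ℝ))
    rw [hXz, ← h5]
    exact (add_comm _ _).trans h7

/-- A contact isotopy is generated, on a compact set of unit vectors and for times in `[0, 1]`,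
by a compactly supported Hamiltonian. -/
lemma IsContactIsotopy.exists_hamiltonian [FiniteDimensional ℝ E] (hJ : IsComplexStructure J)
    (hS : IsContactIsotopy J C S) (hC : IsOpen C) {L : Set E} (hL : IsCompact L) (hLC : L ⊆ C)
    (hL1 : ∀ p ∈ L, ‖p‖ = 1) :
    ∃ k : ℝ × E → ℝ, ContDiff ℝ ∞ k ∧ HasCompactSupport k ∧ (∀ z ∈ tsupport k, z.2 ∈ C) ∧
      ∀ s ∈ Icc (0 : ℝ) 1, ∀ p ∈ L,
        HasDerivAt (fun s => S (s, p)) (contactField J k (s, S (s, p))) s := by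
  obtain ⟨O, X, hO, hOC, hX, hvel⟩ := hS.exists_velocity hC
  let Q : Set (ℝ × E) := (fun z : ℝ × E => (z.1, S z)) '' (Icc (0 : ℝ) 1 ×ˢ L)
  have hQ : IsCompact Q := by
    refine (isCompact_Icc.prod hL).image_of_continuousOn ?_
    exact continuousOn_fst.prodMk
      (hS.smooth.continuousOn.mono (prod_mono (subset_univ _) hLC))
  have hQO : Q ⊆ O := by
    rintro _ ⟨z, hz, rfl⟩
    exact (hvel z.1 z.2 (hLC hz.2)).1
  obtain ⟨Q₁, hQ₁, hQQ₁, hQ₁O⟩ := exists_compact_between hQ hO hQO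
  obtain ⟨χ, hχ1, hχ0, -⟩ := exists_contMDiffMap_one_nhds_of_subset_interior (n := ⊤)
    𝓘(ℝ, ℝ × E) hQ.isClosed hQQ₁
  have hχ : ContDiff ℝ ∞ χ := χ.contMDiff.contDiff
  -- This is α(X), the only possible Hamiltonian; the cut-off leaves it unchanged near the track
  -- `Q`.
  let K : ℝ × E → ℝ := fun z => 2⁻¹ * inner ℝ (J z.2) (X z)
  let k : ℝ × E → ℝ := fun z => χ z * K z
  have hJs : ContDiff ℝ ∞ fun z : ℝ × E => J z.2 := J.contDiff.comp contDiff_snd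
  have hkoff : ∀ z ∉ Q₁, k z = 0 := fun z hz => by simp [k, hχ0 z hz]
  have hksupp : tsupport k ⊆ Q₁ := closure_minimal
    (fun z hz => by_contra fun h => hz (hkoff z h)) hQ₁.isClosed
  have hk : ContDiff ℝ ∞ k := contDiff_iff_contDiffAt.2 fun z => by
    by_cases hz : z ∈ O
    · exact hχ.contDiffAt.mul (contDiffAt_const.mul
        (hJs.contDiffAt.inner ℝ (hX.contDiffAt (hO.mem_nhds hz))))
    · refine (contDiffAt_const (c := (0 : ℝ))).congr_of_eventuallyEq ?_
      filter_upwards [hQ₁.isClosed.isOpen_compl.mem_nhds fun h => hz (hQ₁O h)] with y hy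
      exact hkoff y hy
  refine ⟨k, hk, hQ₁.of_isClosed_subset (isClosed_tsupport _) hksupp,
    fun z hz => hOC z (hQ₁O (hksupp hz)), fun s hs p hp => ?_⟩
  obtain ⟨hzO, hder, horth, hcont⟩ := hvel s p (hLC hp)
  have hzQ : (s, S (s, p)) ∈ Q := ⟨(s, p), ⟨hs, hp⟩, rfl⟩
  have hq1 : inner ℝ (S (s, p)) (S (s, p)) = (1 : ℝ) := by
    rw [real_inner_self_eq_norm_sq, hS.norm_eq s p (hLC hp), hL1 p hp, one_pow]
  have hkK : k =ᶠ[𝓝 (s, S (s, p))] K := by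
    filter_upwards [Filter.Eventually.filter_mono (nhds_le_nhdsSet hzQ) hχ1] with z hz
    simp [k, hz]
  have hKd : ∀ w, fderiv ℝ k (s, S (s, p)) (0, w) = 2⁻¹ * (inner ℝ (J w) (X (s, S (s, p)))
      + inner ℝ (J (S (s, p))) (fderiv ℝ X (s, S (s, p)) (0, w))) := by
    intro w
    have h1 : HasFDerivAt (fun z : ℝ × E => J z.2) (J ∘L .snd ℝ ℝ E) (s, S (s, p)) :=
      J.hasFDerivAt.comp (s, S (s, p)) hasFDerivAt_snd
    have h2 := ((hX.contDiffAt (hO.mem_nhds hzO)).differentiableAt (by simp)).hasFDerivAt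
    have h3 : HasFDerivAt K _ (s, S (s, p)) := (h1.inner ℝ h2).const_mul 2⁻¹
    rw [hkK.fderiv_eq, h3.fderiv]
    simp [fderivInnerCLM_apply]
    ring
  have hk0 : k (s, S (s, p)) = 2⁻¹ * inner ℝ (J (S (s, p))) (X (s, S (s, p))) :=
    hkK.eq_of_nhds
  have hsymp := fun w => symp_contactField (k := k) hJ (s, S (s, p)) w
  have hself := symp_self_contactField (k := k) hJ (s, S (s, p))
  have horth' := inner_contactField_self (k := k) hJ (s, S (s, p))
  simp only at hsymp hself horth'
  set q := S (s, p)
  set Y := contactField J k (s, q)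
  -- Both fields are tangent to the sphere and have the same Hamiltonian, so `D` lies in the contact
  -- hyperplane, and so does `J D`. Testing the infinitesimal contact condition on `J D` gives |J
  -- D|² = 0, which is the nondegeneracy of dα on the hyperplane.
  set D := X (s, q) - Y with hD
  have hqD : inner ℝ q D = (0 : ℝ) := by
    rw [hD, inner_sub_right, horth, real_inner_comm, horth', sub_zero]
  have hJqD : inner ℝ (J q) D = (0 : ℝ) := by
    rw [hD, inner_sub_right, hself, hk0, hq1]
    ring
  have h1 : inner ℝ q (J D) = (0 : ℝ) := by
    have := hJ.skew q D
    linarith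
  have h2 : inner ℝ (J q) (J D) = (0 : ℝ) := by rw [hJ.inner_map_map, hqD]
  have h3 : inner ℝ (J D) (J D) = (0 : ℝ) := by
    have e1 := hsymp (J D)
    have e2 := hcont (J D) h1 h2
    have e3 := hKd (J D)
    have e4 : inner ℝ (J (J D)) (X (s, q)) = - inner ℝ (J (X (s, q))) (J D) := by
      rw [hJ.skew, real_inner_comm]
    rw [h1, h2, hq1] at e1
    have e5 : inner ℝ (J D) (J D) = inner ℝ (J (X (s, q))) (J D) - inner ℝ (J Y) (J D) := by
      rw [← inner_sub_left, ← map_sub]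
    linarith
  rw [hJ.inner_map_map, inner_self_eq_zero, hD, sub_eq_zero] at h3
  rwa [h3] at hder

/-- **Contact isotopy extension.** -/
theorem IsContactIsotopy.exists_extension [FiniteDimensional ℝ E] (hJ : IsComplexStructure J)
    (hS : IsContactIsotopy J C S) (hC : IsOpen C) {L : Set E} (hL : IsCompact L) (hLC : L ⊆ C)
    (hL1 : ∀ p ∈ L, ‖p‖ = 1) :
    ∃ φ φ' : ℝ × E → E, ContDiff ℝ ∞ φ ∧ ContDiff ℝ ∞ φ' ∧ (∀ p, φ (0, p) = p) ∧
      (∀ s p, φ' (s, φ (s, p)) = p) ∧ (∀ s p, φ (s, φ' (s, p)) = p) ∧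
      (∀ s p, ‖φ (s, p)‖ = ‖p‖) ∧
      (∃ B ⊆ C, IsCompact B ∧ ∀ s, ∀ p ∉ B, φ (s, p) = p) ∧
      (∃ c : ℝ × E → ℝ, (∀ z, 0 < c z) ∧ ∀ s p v, inner ℝ p p = (1 : ℝ) →
        inner ℝ p v = (0 : ℝ) →
        inner ℝ (J (φ (s, p))) (fderiv ℝ φ (s, p) (0, v)) = c (s, p) * inner ℝ (J p) v) ∧
      ∀ p ∈ L, φ (1, p) = S (1, p) := by
  obtain ⟨k, hk, hks, hkC, hkS⟩ := hS.exists_hamiltonian hJ hC hL hLC hL1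
  obtain ⟨φ, φ', hφ, hφ', h0, hd, hl, hr, hn, hfix, hc⟩ := exists_contact_flow hJ hk hks
  refine ⟨φ, φ', hφ, hφ', h0, hl, hr, hn, ⟨Prod.snd '' tsupport k, ?_,
    hks.isCompact.image continuous_snd, hfix⟩, hc, fun p hp => ?_⟩
  · rintro _ ⟨z, hz, rfl⟩
    exact hkC z hz
  · obtain ⟨K, hK⟩ := (contDiff_contactField (J := J) hk).lipschitzWith_of_hasCompactSupport
      (hasCompactSupport_contactField hks) (by simp)
    -- The velocity of `S` is known to equal the Hamiltonian field only along tracks of `L` and for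
    -- times in [0, 1]; this suffices for agreement at time 1.
    refine ODE_solution_unique (v := fun s q => contactField J k (s, q)) (K := K) (a := 0) (b := 1)
      (f := fun s => φ (s, p)) (g := fun s => S (s, p))
      (fun s => by simpa [Function.comp_def] using hK.comp (LipschitzWith.prodMk_left s))
      (fun s _ => (hd s p).continuousAt.continuousWithinAt)
      (fun s _ => (hd s p).hasDerivWithinAt)
      (fun s hs => (hkS s hs p hp).continuousAt.continuousWithinAt)
      (fun s hs => (hkS s (Ico_subset_Icc_self hs) p hp).hasDerivWithinAt)
      ?_ (right_mem_Icc.2 zero_le_one)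
    rw [h0, hS.zero_apply p (hLC hp)]

end IsotopyExtension

/-! ### The standard complex structure -/

section StandardStructure

variable {n : ℕ}

/-- The complex structure `(x, y) ↦ (-y, x)` on `ℝ²ⁿ`. -/
def stdJ (n : ℕ) : R2 n →L[ℝ] R2 n :=
  LinearMap.toContinuousLinearMap
    { toFun := fun p => WithLp.toLp 2
        (Fin.addCases (fun i => - p (Fin.natAdd n i)) fun i => p (Fin.castAdd n i))
      map_add' := fun p q => by
        ext j
        refine Fin.addCases (fun i => ?_) (fun i => ?_) j <;>
          simp [add_comm, -Fin.natAdd_eq_addNat]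
      map_smul' := fun c p => by
        ext j
        refine Fin.addCases (fun i => ?_) (fun i => ?_) j <;> simp [-Fin.natAdd_eq_addNat] }

@[simp]
lemma stdJ_castAdd (p : R2 n) (i : Fin n) : stdJ n p (Fin.castAdd n i) = - p (Fin.natAdd n i) := by
  simp [stdJ, -Fin.natAdd_eq_addNat]

lemma stdJ_natAdd (p : R2 n) (i : Fin n) : stdJ n p (Fin.natAdd n i) = p (Fin.castAdd n i) := by
  simp [stdJ, -Fin.natAdd_eq_addNat]

lemma inner_R2 (p q : R2 n) : inner ℝ p q = ∑ i : Fin n, p (Fin.castAdd n i) * q (Fin.castAdd n i)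
    + ∑ i : Fin n, p (Fin.natAdd n i) * q (Fin.natAdd n i) := by
  rw [PiLp.inner_apply, Fin.sum_univ_add]
  simp [mul_comm]

lemma isComplexStructure_stdJ (n : ℕ) : IsComplexStructure (stdJ n) where
  skew p q := by
    simp only [inner_R2, stdJ_castAdd, stdJ_natAdd, neg_mul, mul_neg, Finset.sum_neg_distrib]
    ring
  sq p := by
    ext j
    refine Fin.addCases (fun i => ?_) (fun i => ?_) j <;>
      simp only [stdJ_castAdd, stdJ_natAdd, PiLp.neg_apply]

lemma liouvilleForm_apply (p v : R2 n) : liouvilleForm n p v = 2⁻¹ * inner ℝ (stdJ n p) v := by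
  rw [inner_R2, ← Finset.sum_add_distrib]
  simp only [liouvilleForm, xCoord, yCoord, one_div, smul_apply, sum_apply,
    sub_apply, smul_eq_mul, PiLp.proj_apply, stdJ_castAdd, stdJ_natAdd]
  congr 1
  exact Finset.sum_congr rfl fun i _ => by ring

lemma mem_coordSubspace {k : ℕ} {p : R2 n} :
    p ∈ coordSubspace n k ↔ ∀ j : Fin (n + n), (j : ℕ) + k < n + n → p j = 0 := by
  constructor
  · intro hp j hj
    induction hp using Submodule.span_induction with
    | mem v hv =>
      obtain ⟨i, hi, rfl⟩ := hv
      have : j ≠ i := by rintro rfl; omega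
      simp [this]
    | zero => rfl
    | add v w _ _ hv hw => simp [hv, hw]
    | smul c v _ hv => simp [hv]
  · intro h
    have hp : p = ∑ j, p j • EuclideanSpace.single j (1 : ℝ) := by
      ext i
      simp [Finset.sum_apply, Pi.single_apply]
    rw [hp]
    refine Submodule.sum_mem _ fun j _ => ?_
    by_cases hj : (j : ℕ) + k < n + n
    · simp [h j hj]
    · exact Submodule.smul_mem _ _ (Submodule.subset_span ⟨j, by omega, rfl⟩)

end StandardStructure

/-! ### The sphere minus a subspace as a retract of an open cone -/

section Bridge

variable {n k : ℕ}

/-- The open cone over `U_k`. -/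
def cone (n k : ℕ) : Set (R2 n) := {p | p ∉ coordSubspace n k}

lemma isOpen_cone : IsOpen (cone n k) :=
  (coordSubspace n k).closed_of_finiteDimensional.isOpen_compl

lemma ne_zero_of_mem_cone {p : R2 n} (hp : p ∈ cone n k) : p ≠ 0 := fun h =>
  hp (h ▸ Submodule.zero_mem _)

lemma norm_pos_of_mem_cone {p : R2 n} (hp : p ∈ cone n k) : 0 < ‖p‖ :=
  norm_pos_iff.2 (ne_zero_of_mem_cone hp)

lemma smul_mem_cone {c : ℝ} (hc : c ≠ 0) {p : R2 n} (hp : p ∈ cone n k) : c • p ∈ cone n k :=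
  fun h => hp (((coordSubspace n k).smul_mem_iff hc).1 h)

/-- The inclusion `U_k → ℝ²ⁿ`. -/
def incl (x : sphereMinus n k) : R2 n := ((x : sphere (0 : R2 n) 1) : R2 n)

@[simp]
lemma norm_incl (x : sphereMinus n k) : ‖incl x‖ = 1 := norm_eq_of_mem_sphere _

lemma inner_incl_self (x : sphereMinus n k) : inner ℝ (incl x) (incl x) = (1 : ℝ) := by
  rw [real_inner_self_eq_norm_sq, norm_incl, one_pow]

lemma incl_mem (x : sphereMinus n k) : incl x ∈ cone n k := x.2

lemma incl_injective : Function.Injective (incl : sphereMinus n k → R2 n) :=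
  Subtype.val_injective.comp Subtype.val_injective

/-- The radial projection of the cone to `U_k`, extended by a constant. -/
def radial (x₀ : sphereMinus n k) (p : R2 n) : sphereMinus n k :=
  open Classical in
  if hp : p ∈ cone n k then
    ⟨⟨‖p‖⁻¹ • p, by
      simp [norm_smul, (norm_pos_of_mem_cone hp).ne']⟩,
      smul_mem_cone (inv_ne_zero (norm_pos_of_mem_cone hp).ne') hp⟩
  else x₀

lemma incl_radial (x₀ : sphereMinus n k) {p : R2 n} (hp : p ∈ cone n k) :
    incl (radial x₀ p) = ‖p‖⁻¹ • p := by
  simp [radial, hp, incl]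

lemma radial_incl (x₀ x : sphereMinus n k) : radial x₀ (incl x) = x :=
  incl_injective (by simp [incl_radial x₀ (incl_mem x)])

lemma continuous_incl : Continuous (incl : sphereMinus n k → R2 n) :=
  continuous_subtype_val.comp continuous_subtype_val

lemma contDiffAt_normalize {E : Type*} [NormedAddCommGroup E] [InnerProductSpace ℝ E] {p : E}
    (hp : p ≠ 0) : ContDiffAt ℝ ∞ (fun p : E => ‖p‖⁻¹ • p) p :=
  ((contDiffAt_norm ℝ hp).inv (norm_ne_zero_iff.2 hp)).smul contDiffAt_id

lemma hasFDerivAt_norm {E : Type*} [NormedAddCommGroup E] [InnerProductSpace ℝ E] {p : E}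
    (hp : p ≠ 0) : HasFDerivAt (fun p : E => ‖p‖) (‖p‖⁻¹ • innerSL ℝ p) p := by
  have h1 : HasFDerivAt (fun p : E => ‖p‖) _ p :=
    ((contDiffAt_norm ℝ hp (n := 1)).differentiableAt one_ne_zero).hasFDerivAt
  have h2 : HasFDerivAt (fun p : E => ‖p‖ * ‖p‖) (2 • innerSL ℝ p) p := by
    simpa only [pow_two] using (hasStrictFDerivAt_norm_sq p).hasFDerivAt
  have hp' := norm_ne_zero_iff.2 hp
  convert! h1
  ext v
  have h3 := congrArg (fun A => A v) (h2.unique (h1.fun_mul h1))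
  simp at h3
  simp only [smul_apply, innerSL_apply_apply, smul_eq_mul]
  field_simp
  linarith

variable [NeZero n]

lemma contMDiff_incl :
    ContMDiff (𝓡 (n + n - 1)) 𝓘(ℝ, R2 n) ∞ (incl : sphereMinus n k → R2 n) :=
  contMDiff_coe_sphere.comp contMDiff_subtype_val

lemma contMDiffAt_radial (x₀ : sphereMinus n k) {p : R2 n} (hp : p ∈ cone n k) :
    ContMDiffAt 𝓘(ℝ, R2 n) (𝓡 (n + n - 1)) ∞ (radial x₀) p := by
  let C : TopologicalSpace.Opens (R2 n) := ⟨cone n k, isOpen_cone⟩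
  have h1 : ContMDiff 𝓘(ℝ, R2 n) 𝓘(ℝ, R2 n) ∞ (fun q : C => ‖(q : R2 n)‖⁻¹ • (q : R2 n)) := by
    intro q
    exact (contMDiffAt_subtype_iff (f := fun q : R2 n => ‖q‖⁻¹ • q)).2
      (contDiffAt_normalize (ne_zero_of_mem_cone q.2)).contMDiffAt
  have h2 := h1.codRestrict_sphere (n := n + n - 1) (fun q : C => by
    simp [norm_smul, (norm_pos_of_mem_cone q.2).ne'])
  have h3 : ContMDiff 𝓘(ℝ, R2 n) (𝓡 (n + n - 1)) ∞ (fun q : C => radial x₀ (q : R2 n)) := by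
    rw [← ContMDiff.subtypeVal_comp_iff]
    refine h2.congr fun q => Subtype.ext ?_
    exact incl_radial x₀ q.2
  exact (contMDiffAt_subtype_iff (U := C) (x := ⟨p, hp⟩) (f := radial x₀)).1 (h3 _)

lemma contMDiffOn_radial (x₀ : sphereMinus n k) :
    ContMDiffOn 𝓘(ℝ, R2 n) (𝓡 (n + n - 1)) ∞ (radial x₀) (cone n k) := fun _ hp =>
  (contMDiffAt_radial x₀ hp).contMDiffWithinAt

/-- A map to `U_k` is smooth if it is smooth as a map to `ℝ²ⁿ`. -/
lemma contMDiffOn_of_incl {F : Type*} [NormedAddCommGroup F] [NormedSpace ℝ F] {H : Type*}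
    [TopologicalSpace H] {I : ModelWithCorners ℝ F H} {N : Type*} [TopologicalSpace N]
    [ChartedSpace H N] {f : N → sphereMinus n k} {s : Set N}
    (hf : ContMDiffOn I 𝓘(ℝ, R2 n) ∞ (fun x => incl (f x)) s) :
    ContMDiffOn I (𝓡 (n + n - 1)) ∞ f s := by
  rcases s.eq_empty_or_nonempty with rfl | ⟨x, _⟩
  · exact fun x hx => hx.elim
  · have := (contMDiffOn_radial (f x)).comp hf fun y _ => incl_mem (f y)
    exact this.congr fun y _ => (radial_incl (f x) (f y)).symm

lemma contMDiff_of_incl {F : Type*} [NormedAddCommGroup F] [NormedSpace ℝ F] {H : Type*}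
    [TopologicalSpace H] {I : ModelWithCorners ℝ F H} {N : Type*} [TopologicalSpace N]
    [ChartedSpace H N] {f : N → sphereMinus n k}
    (hf : ContMDiff I 𝓘(ℝ, R2 n) ∞ (fun x => incl (f x))) :
    ContMDiff I (𝓡 (n + n - 1)) ∞ f :=
  contMDiffOn_univ.1 (contMDiffOn_of_incl hf.contMDiffOn)

/-! ### Differentials of the inclusion and of the radial projection -/

/-- The differential of the inclusion. -/
def dincl (x : sphereMinus n k) : EuclideanSpace ℝ (Fin (n + n - 1)) →L[ℝ] R2 n :=
  mfderiv (𝓡 (n + n - 1)) 𝓘(ℝ, R2 n) (incl : sphereMinus n k → R2 n) x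

/-- The differential of the radial projection. -/
def dradial (x₀ : sphereMinus n k) (p : R2 n) : R2 n →L[ℝ] EuclideanSpace ℝ (Fin (n + n - 1)) :=
  mfderiv 𝓘(ℝ, R2 n) (𝓡 (n + n - 1)) (radial x₀) p

/-- The differential of a self-map of `U_k`. -/
def dmap (f : sphereMinus n k → sphereMinus n k) (x : sphereMinus n k) :
    EuclideanSpace ℝ (Fin (n + n - 1)) →L[ℝ] EuclideanSpace ℝ (Fin (n + n - 1)) :=
  mfderiv (𝓡 (n + n - 1)) (𝓡 (n + n - 1)) f x

lemma alphaSt_apply (x : sphereMinus n k) (v : EuclideanSpace ℝ (Fin (n + n - 1))) :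
    alphaSt n k x v = 2⁻¹ * inner ℝ (stdJ n (incl x)) (dincl x v) :=
  liouvilleForm_apply _ _

lemma hasMFDerivAt_incl (x : sphereMinus n k) :
    HasMFDerivAt (𝓡 (n + n - 1)) 𝓘(ℝ, R2 n) (incl : sphereMinus n k → R2 n) x (dincl x) :=
  (contMDiff_incl.mdifferentiable (by simp) x).hasMFDerivAt

lemma hasMFDerivAt_radial (x₀ : sphereMinus n k) {p : R2 n} (hp : p ∈ cone n k) :
    HasMFDerivAt 𝓘(ℝ, R2 n) (𝓡 (n + n - 1)) (radial x₀) p (dradial x₀ p) :=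
  ((contMDiffAt_radial x₀ hp).mdifferentiableAt (by simp)).hasMFDerivAt

lemma hasMFDerivAt_dmap {f : sphereMinus n k → sphereMinus n k}
    (hf : ContMDiff (𝓡 (n + n - 1)) (𝓡 (n + n - 1)) ∞ f) (x : sphereMinus n k) :
    HasMFDerivAt (𝓡 (n + n - 1)) (𝓡 (n + n - 1)) f x (dmap f x) :=
  (hf.mdifferentiable (by simp) x).hasMFDerivAt

lemma dradial_dincl (x₀ x : sphereMinus n k) (v : EuclideanSpace ℝ (Fin (n + n - 1))) :
    dradial x₀ (incl x) (dincl x v) = v := by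
  have h1 := (hasMFDerivAt_radial x₀ (incl_mem x)).comp x (hasMFDerivAt_incl x)
  have h2 : radial x₀ ∘ incl = (id : sphereMinus n k → sphereMinus n k) :=
    funext fun y => radial_incl x₀ y
  rw [h2] at h1
  exact congrArg (fun A => A v) (hasMFDerivAt_unique h1 (hasMFDerivAt_id x))

lemma dincl_injective (x : sphereMinus n k) : Function.Injective (dincl x) :=
  Function.LeftInverse.injective (dradial_dincl x x)

/-- The derivative of the factor ‖p‖⁻¹ vanishes on the orthogonal complement of p. -/
lemma dincl_dradial (x₀ : sphereMinus n k) {p : R2 n} (hp : p ∈ cone n k) (v : R2 n)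
    (hv : inner ℝ p v = (0 : ℝ)) : dincl (radial x₀ p) (dradial x₀ p v) = ‖p‖⁻¹ • v := by
  have h1 := (hasMFDerivAt_incl (radial x₀ p)).comp p (hasMFDerivAt_radial x₀ hp)
  have h2 : HasMFDerivAt 𝓘(ℝ, R2 n) 𝓘(ℝ, R2 n) (fun p : R2 n => ‖p‖⁻¹ • p) p
      (dincl (radial x₀ p) ∘L dradial x₀ p) := by
    refine h1.congr_of_eventuallyEq ?_
    filter_upwards [isOpen_cone.mem_nhds hp] with q hq
    exact (incl_radial x₀ hq).symm
  have hp0 := ne_zero_of_mem_cone hp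
  have h3 : HasFDerivAt (fun p : R2 n => ‖p‖⁻¹) _ p :=
    (hasDerivAt_inv (norm_ne_zero_iff.2 hp0)).comp_hasFDerivAt p (hasFDerivAt_norm hp0)
  have h4 := h3.fun_smul (hasFDerivAt_id p)
  have h5 : dincl (radial x₀ p) (dradial x₀ p v)
      = ‖p‖⁻¹ • v + (-(‖p‖ ^ 2)⁻¹ * (‖p‖⁻¹ * inner ℝ p v)) • p :=
    congrArg (fun A => A v) (hasMFDerivAt_unique h2 h4.hasMFDerivAt)
  simp [h5, hv]

lemma inner_incl_dincl (x : sphereMinus n k) (v : EuclideanSpace ℝ (Fin (n + n - 1))) :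
    inner ℝ (incl x) (dincl x v) = (0 : ℝ) := by
  have h1 : HasFDerivAt (fun p : R2 n => ‖p‖ ^ 2) _ (incl x) :=
    (hasFDerivAt_id (incl x)).norm_sq
  have h2 := h1.hasMFDerivAt.comp x (hasMFDerivAt_incl x)
  have h3 : (fun p : R2 n => ‖p‖ ^ 2) ∘ incl = fun _ : sphereMinus n k => (1 : ℝ) :=
    funext fun y => by simp
  rw [h3] at h2
  have h4 := congrArg (fun A => A v) (hasMFDerivAt_unique h2 (hasMFDerivAt_const (1 : ℝ) x))
  have h5 : 2 • (inner ℝ (incl x) (dincl x v) : ℝ) = 0 := h4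
  simpa using h5

/-- The tangent space is the whole orthogonal complement. In particular J p is tangent, and the
contact form does not vanish on it. -/
lemma exists_dincl_eq (x : sphereMinus n k) {w : R2 n} (hw : inner ℝ (incl x) w = (0 : ℝ)) :
    ∃ v, dincl x v = w := by
  refine ⟨dradial x (incl x) w, ?_⟩
  have := dincl_dradial x (incl_mem x) w hw
  rwa [radial_incl, norm_incl, inv_one, one_smul] at this

/-- The differential of a self-map of `U_k` in terms of an extension to `ℝ²ⁿ`. -/
lemma dincl_dmap {f : sphereMinus n k → sphereMinus n k}
    (hf : ContMDiff (𝓡 (n + n - 1)) (𝓡 (n + n - 1)) ∞ f) {F : R2 n → R2 n}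
    (hfF : ∀ x, incl (f x) = F (incl x)) (x : sphereMinus n k)
    (hF : DifferentiableAt ℝ F (incl x)) (v : EuclideanSpace ℝ (Fin (n + n - 1))) :
    dincl (f x) (dmap f x v) = fderiv ℝ F (incl x) (dincl x v) := by
  have h1 := (hasMFDerivAt_incl (f x)).comp x (hasMFDerivAt_dmap hf x)
  have h2 := hF.hasFDerivAt.hasMFDerivAt.comp x (hasMFDerivAt_incl x)
  rw [show incl ∘ f = F ∘ incl from funext hfF] at h1
  exact congrArg (fun A => A v) (hasMFDerivAt_unique h1 h2)

end Bridge

/-! ### Extension of contact isotopies of `U_k` -/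

section Extension

variable {n k : ℕ} [NeZero n]

lemma IsContactEmbedding.inner_eq_zero_iff {f : sphereMinus n k → sphereMinus n k}
    (hf : IsContactEmbedding (alphaSt n k) f) (x : sphereMinus n k)
    (v : EuclideanSpace ℝ (Fin (n + n - 1))) :
    inner ℝ (stdJ n (incl (f x))) (dincl (f x) (dmap f x v)) = (0 : ℝ) ↔
      inner ℝ (stdJ n (incl x)) (dincl x v) = (0 : ℝ) := by
  have h1 : alphaSt n k (f x) (dmap f x v) = 0 ↔ alphaSt n k x v = 0 := hf.contact x v
  rw [alphaSt_apply, alphaSt_apply] at h1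
  simpa using h1

/-- The extension to the cone, homogeneous of degree one, of a self-map of `U_k`. -/
def coneMap (x₀ : sphereMinus n k) (f : sphereMinus n k → sphereMinus n k) (p : R2 n) : R2 n :=
  ‖p‖ • incl (f (radial x₀ p))

omit [NeZero n] in
lemma norm_coneMap (x₀ : sphereMinus n k) (f : sphereMinus n k → sphereMinus n k) (p : R2 n) :
    ‖coneMap x₀ f p‖ = ‖p‖ := by
  simp [coneMap, norm_smul]

omit [NeZero n] in
lemma coneMap_incl (x₀ : sphereMinus n k) (f : sphereMinus n k → sphereMinus n k)
    (x : sphereMinus n k) : coneMap x₀ f (incl x) = incl (f x) := by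
  simp [coneMap, radial_incl]

omit [NeZero n] in
lemma coneMap_mem (x₀ : sphereMinus n k) (f : sphereMinus n k → sphereMinus n k) {p : R2 n}
    (hp : p ∈ cone n k) : coneMap x₀ f p ∈ cone n k :=
  smul_mem_cone (norm_pos_of_mem_cone hp).ne' (incl_mem _)

lemma hasFDerivAt_coneMap (x₀ : sphereMinus n k) {f : sphereMinus n k → sphereMinus n k}
    (hf : ContMDiff (𝓡 (n + n - 1)) (𝓡 (n + n - 1)) ∞ f) {p : R2 n} (hp : p ∈ cone n k) :
    HasFDerivAt (coneMap x₀ f)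
      (‖p‖ • (dincl (f (radial x₀ p)) ∘L dmap f (radial x₀ p) ∘L dradial x₀ p)
        + (‖p‖⁻¹ • innerSL ℝ p).smulRight (incl (f (radial x₀ p)))) p := by
  have h1 := (hasMFDerivAt_incl (f (radial x₀ p))).comp p
    ((hasMFDerivAt_dmap hf (radial x₀ p)).comp p (hasMFDerivAt_radial x₀ hp))
  have h2 : HasFDerivAt (fun p => incl (f (radial x₀ p)))
    (dincl (f (radial x₀ p)) ∘L dmap f (radial x₀ p) ∘L dradial x₀ p) p := h1.hasFDerivAt
  exact (hasFDerivAt_norm (ne_zero_of_mem_cone hp)).smul h2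

/-- The homogeneous extension moves the isotopy to an open subset of a vector space, where isotopy
extension is available. Its differential splits into orthogonal tangential and radial parts, which
can be treated separately. -/
lemma isContactIsotopy_coneMap (x₀ : sphereMinus n k)
    {S : ℝ → sphereMinus n k → sphereMinus n k}
    (hS : ContMDiff (𝓘(ℝ, ℝ).prod (𝓡 (n + n - 1))) (𝓡 (n + n - 1)) ∞
      fun z : ℝ × sphereMinus n k => S z.1 z.2)
    (hSe : ∀ s, IsContactEmbedding (alphaSt n k) (S s)) (hS0 : S 0 = id) :
    IsContactIsotopy (stdJ n) (cone n k) fun z => coneMap x₀ (S z.1) z.2 := by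
  have hsm : ContDiffOn ℝ ∞ (fun z : ℝ × R2 n => coneMap x₀ (S z.1) z.2) (univ ×ˢ cone n k) := by
    have h1 : ContMDiffOn 𝓘(ℝ, ℝ × R2 n) (𝓘(ℝ, ℝ).prod (𝓡 (n + n - 1))) ∞
        (fun z : ℝ × R2 n => (z.1, radial x₀ z.2)) (univ ×ˢ cone n k) :=
      contDiff_fst.contMDiff.contMDiffOn.prodMk
        ((contMDiffOn_radial x₀).comp contDiff_snd.contMDiff.contMDiffOn fun z hz => hz.2)
    have h2 : ContDiffOn ℝ ∞ (fun z : ℝ × R2 n => incl (S z.1 (radial x₀ z.2)))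
        (univ ×ˢ cone n k) :=
      ((contMDiff_incl.comp hS).comp_contMDiffOn h1).contDiffOn
    exact (contDiff_snd.contDiffOn.norm ℝ fun z hz => ne_zero_of_mem_cone hz.2).smul h2
  have hder : ∀ s, ∀ p ∈ cone n k, ∀ v,
      fderiv ℝ (fun z : ℝ × R2 n => coneMap x₀ (S z.1) z.2) (s, p) (0, v)
        = ‖p‖ • dincl (S s (radial x₀ p)) (dmap (S s) (radial x₀ p) (dradial x₀ p v))
          + (‖p‖⁻¹ * inner ℝ p v) • incl (S s (radial x₀ p)) := by
    intro s p hp v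
    have hd : DifferentiableAt ℝ (fun z : ℝ × R2 n => coneMap x₀ (S z.1) z.2) (s, p) :=
      (hsm.contDiffAt ((isOpen_univ.prod isOpen_cone).mem_nhds
        ⟨mem_univ _, hp⟩)).differentiableAt (by simp)
    have h1 := congrArg (fun A => A v)
      ((hasFDerivAt_space hd).unique (hasFDerivAt_coneMap x₀ (hSe s).smooth hp))
    simpa using h1
  refine ⟨hsm, fun s p hp => coneMap_mem x₀ _ hp, fun s p hp => norm_coneMap x₀ _ p,
    fun s p hp q hq h => ?_, fun s p hp v hv => ?_, fun p hp => ?_, fun s p hp v hv => ?_⟩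
  · have hn : ‖p‖ = ‖q‖ := by
      rw [← norm_coneMap x₀ (S s) p, ← norm_coneMap x₀ (S s) q]
      exact congrArg norm h
    have h1 : ‖p‖ • incl (S s (radial x₀ p)) = ‖p‖ • incl (S s (radial x₀ q)) := by
      rw [show ‖p‖ • incl (S s (radial x₀ q)) = ‖q‖ • incl (S s (radial x₀ q)) by rw [hn]]
      exact h
    have h2 := (hSe s).embedding.injective
      (incl_injective (smul_right_injective _ (norm_pos_of_mem_cone hp).ne' h1))
    have h3 := congrArg incl h2
    rw [incl_radial x₀ hp, incl_radial x₀ hq, hn] at h3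
    exact smul_right_injective _ (inv_ne_zero (norm_pos_of_mem_cone hq).ne') h3
  · rw [hder s p hp v] at hv
    have hpos := norm_pos_of_mem_cone hp
    -- Pairing with the image point kills the tangential part and shows that v is orthogonal to p.
    have h1 := congrArg (fun w => (inner ℝ (incl (S s (radial x₀ p))) w : ℝ)) hv
    simp only [inner_add_right, inner_smul_right, inner_incl_dincl, inner_incl_self,
      inner_zero_right, mul_zero, zero_add, mul_one, mul_eq_zero, inv_eq_zero, hpos.ne',
      false_or] at h1
    rw [h1, mul_zero, zero_smul, add_zero, smul_eq_zero, or_iff_right hpos.ne'] at hv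
    have h2 : dmap (S s) (radial x₀ p) (dradial x₀ p v) = 0 :=
      dincl_injective _ (by rw [hv, map_zero])
    have h3 : dradial x₀ p v = 0 :=
      (hSe s).immersion (radial x₀ p) (h2.trans (map_zero (dmap (S s) (radial x₀ p))).symm)
    have h4 := dincl_dradial x₀ hp v h1
    rw [h3, map_zero] at h4
    exact ((smul_eq_zero.1 h4.symm).resolve_left (inv_ne_zero hpos.ne'))
  · simp only [hS0, coneMap, id, incl_radial x₀ hp]
    rw [smul_smul, mul_inv_cancel₀ (norm_pos_of_mem_cone hp).ne', one_smul]
  · have hpos := norm_pos_of_mem_cone hp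
    rw [hder s p hp v, hv, mul_zero, zero_smul, add_zero]
    simp only [coneMap, map_smul, inner_smul_left, inner_smul_right]
    simp only [RCLike.conj_to_real, mul_eq_zero, hpos.ne', false_or]
    rw [(hSe s).inner_eq_zero_iff, dincl_dradial x₀ hp v hv, incl_radial x₀ hp]
    simp [inner_smul_left, inner_smul_right, hpos.ne']

/-- An isotopy parametrised by `[0, 1]` can be reparametrised by all of `ℝ`. -/
lemma ContactlyIsotopicToId.exists_isotopy {σ : sphereMinus n k → sphereMinus n k}
    (hσ : ContactlyIsotopicToId (alphaSt n k) σ) :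
    ∃ S : ℝ → sphereMinus n k → sphereMinus n k,
      ContMDiff (𝓘(ℝ, ℝ).prod (𝓡 (n + n - 1))) (𝓡 (n + n - 1)) ∞
        (fun z : ℝ × sphereMinus n k => S z.1 z.2) ∧
      (∀ s, IsContactEmbedding (alphaSt n k) (S s)) ∧ S 0 = id ∧ S 1 = σ := by
  obtain ⟨S, hS, hSe, hS0, hS1⟩ := hσ
  have hmem : ∀ s, Real.smoothTransition s ∈ Icc (0 : ℝ) 1 := fun s =>
    ⟨Real.smoothTransition.nonneg s, Real.smoothTransition.le_one s⟩
  refine ⟨fun s => S (Real.smoothTransition s), ?_, fun s => hSe _ (hmem s), ?_, ?_⟩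
  · have h1 : ContMDiff (𝓘(ℝ, ℝ).prod (𝓡 (n + n - 1))) (𝓘(ℝ, ℝ).prod (𝓡 (n + n - 1))) ∞
        fun z : ℝ × sphereMinus n k => (Real.smoothTransition z.1, z.2) :=
      (Real.smoothTransition.contDiff.contMDiff.comp contMDiff_fst).prodMk contMDiff_snd
    exact contMDiffOn_univ.1 (hS.comp h1.contMDiffOn fun z _ => ⟨hmem z.1, mem_univ _⟩)
  · simpa using hS0
  · simpa using hS1

/-- A contact isotopy of embeddings agrees near any given compact set with a compactly supported
contactomorphism that is isotopic to the identity. -/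
theorem ContactlyIsotopicToId.exists_contactGroup {σ : sphereMinus n k → sphereMinus n k}
    (hσ : ContactlyIsotopicToId (alphaSt n k) σ) {L : Set (sphereMinus n k)} (hL : IsCompact L)
    (x₀ : sphereMinus n k) :
    ∃ h ∈ contactGroup (alphaSt n k), ∀ x ∈ L, ∀ᶠ y in 𝓝 x, h.toDiffeo y = σ y := by
  obtain ⟨S, hS, hSe, hS0, hS1⟩ := hσ.exists_isotopy
  have : LocallyCompactSpace (sphereMinus n k) :=
    ChartedSpace.locallyCompactSpace (EuclideanSpace ℝ (Fin (n + n - 1))) _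
  -- Agreement on a neighbourhood of `L` gives equal differentials on `L`, hence equal conformal
  -- factors there.
  obtain ⟨L', hL', hLL'⟩ := exists_compact_superset hL
  obtain ⟨φ, φ', hφ, hφ', h0, hl, hr, hn, ⟨B, hBC, hB, hfix⟩, ⟨c, hc, hconf⟩, hφS⟩ :=
    (isContactIsotopy_coneMap x₀ hS hSe hS0).exists_extension (isComplexStructure_stdJ n)
      isOpen_cone (hL'.image continuous_incl) (by rintro _ ⟨x, _, rfl⟩; exact incl_mem x)
      (by rintro _ ⟨x, _, rfl⟩; exact norm_incl x)
  have hfix' : ∀ s, ∀ p ∉ B, φ' (s, p) = p := fun s p hp => by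
    conv_lhs => rw [← hfix s p hp]
    exact hl s p
  -- A bijection that fixes everything outside `B ⊆ cone n k` preserves the cone.
  have hmaps : ∀ s, ∀ p ∈ cone n k, φ (s, p) ∈ cone n k := fun s p hp => by
    by_contra h
    have h1 := hfix' s (φ (s, p)) fun hb => h (hBC hb)
    rw [hl] at h1
    exact h (h1 ▸ hp)
  have hmaps' : ∀ s, ∀ p ∈ cone n k, φ' (s, p) ∈ cone n k := fun s p hp => by
    by_contra h
    have h1 := hfix s (φ' (s, p)) fun hb => h (hBC hb)
    rw [hr] at h1
    exact h (h1 ▸ hp)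
  have hn' : ∀ s p, ‖φ' (s, p)‖ = ‖p‖ := fun s p => by rw [← hn s (φ' (s, p)), hr]
  have hincl : ∀ s x, incl (radial x₀ (φ (s, incl x))) = φ (s, incl x) := fun s x => by
    rw [incl_radial x₀ (hmaps s _ (incl_mem x)), hn, norm_incl, inv_one, one_smul]
  have hincl' : ∀ s x, incl (radial x₀ (φ' (s, incl x))) = φ' (s, incl x) := fun s x => by
    rw [incl_radial x₀ (hmaps' s _ (incl_mem x)), hn', norm_incl, inv_one, one_smul]
  have hsm : ContMDiff (𝓘(ℝ, ℝ).prod (𝓡 (n + n - 1))) (𝓡 (n + n - 1)) ∞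
      fun z : ℝ × sphereMinus n k => radial x₀ (φ (z.1, incl z.2)) := by
    refine contMDiff_of_incl ?_
    simp only [hincl]
    exact hφ.contMDiff.comp
      (contMDiff_fst.prodMk_space (contMDiff_incl.comp contMDiff_snd))
  have hsms : ∀ s, ContMDiff (𝓡 (n + n - 1)) (𝓡 (n + n - 1)) ∞
      fun x : sphereMinus n k => radial x₀ (φ (s, incl x)) := fun s =>
    hsm.comp (contMDiff_const.prodMk contMDiff_id)
  have hsms' : ∀ s, ContMDiff (𝓡 (n + n - 1)) (𝓡 (n + n - 1)) ∞
      fun x : sphereMinus n k => radial x₀ (φ' (s, incl x)) := fun s => by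
    refine contMDiff_of_incl ?_
    simp only [hincl']
    exact hφ'.contMDiff.comp (contMDiff_const.prodMk_space contMDiff_incl)
  have hpull : ∀ s x (v : EuclideanSpace ℝ (Fin (n + n - 1))),
      alphaSt n k (radial x₀ (φ (s, incl x))) (dmap (fun x => radial x₀ (φ (s, incl x))) x v)
        = c (s, incl x) * alphaSt n k x v := by
    intro s x v
    have hd : HasFDerivAt (fun p => φ (s, p)) _ (incl x) :=
      hasFDerivAt_space (hφ.differentiable (by simp) (s, incl x))
    have h1 := dincl_dmap (hsms s) (F := fun p => φ (s, p)) (hincl s) x hd.differentiableAt v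
    have h2 := hconf s (incl x) (dincl x v) (inner_incl_self x) (inner_incl_dincl x v)
    rw [alphaSt_apply, alphaSt_apply, h1, hd.fderiv, hincl]
    simp only [ContinuousLinearMap.comp_apply, ContinuousLinearMap.inr_apply]
    rw [h2]
    ring
  let Ψ : ℝ → Contactomorphism (alphaSt n k) := fun s =>
    { toDiffeo :=
        { toFun := fun x => radial x₀ (φ (s, incl x))
          invFun := fun x => radial x₀ (φ' (s, incl x))
          left_inv := fun x => incl_injective (by rw [hincl', hincl, hl])
          right_inv := fun x => incl_injective (by rw [hincl, hincl', hr])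
          contMDiff_toFun := hsms s
          contMDiff_invFun := hsms' s }
      factor := fun x => c (s, incl x)
      factor_pos := fun x => hc _
      pullback_eq := fun x v => hpull s x v }
  refine ⟨Ψ 1, ⟨Ψ, radial x₀ '' (B ∩ sphere 0 1), hsm.contMDiffOn, ?_, ?_, fun x => ?_, rfl⟩,
    fun x hx => ?_⟩
  · exact (hB.inter_right isClosed_sphere).image_of_continuousOn
      ((contMDiffOn_radial x₀).continuousOn.mono fun p hp => hBC hp.1)
  · intro s _ x hx
    have hxB : incl x ∉ B := fun h => hx ⟨incl x, ⟨h, by simp⟩, radial_incl x₀ x⟩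
    change radial x₀ (φ (s, incl x)) = x
    rw [hfix s _ hxB, radial_incl]
  · change radial x₀ (φ (0, incl x)) = x
    rw [h0, radial_incl]
  · filter_upwards [mem_interior_iff_mem_nhds.1 (hLL' hx)] with y hy
    change radial x₀ (φ (1, incl y)) = σ y
    rw [hφS _ ⟨y, hy, rfl⟩]
    simp only
    rw [coneMap_incl, radial_incl, hS1]

end Extension

/-! ### Composition of contact embeddings -/

section Composition

variable {E : Type*} [NormedAddCommGroup E] [NormedSpace ℝ E]
  {M : Type*} [TopologicalSpace M] [ChartedSpace E M] {α : OneForm E M}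

lemma IsContactEmbedding.comp {σ ρ : M → M} (hσ : IsContactEmbedding α σ)
    (hρ : IsContactEmbedding α ρ) : IsContactEmbedding α (σ ∘ ρ) := by
  have h : ∀ x, mfderiv 𝓘(ℝ, E) 𝓘(ℝ, E) (σ ∘ ρ) x
      = (mfderiv 𝓘(ℝ, E) 𝓘(ℝ, E) σ (ρ x)).comp (mfderiv 𝓘(ℝ, E) 𝓘(ℝ, E) ρ x) := fun x =>
    mfderiv_comp x (hσ.smooth.mdifferentiable (by simp) _) (hρ.smooth.mdifferentiable (by simp) _)
  refine ⟨hσ.smooth.comp hρ.smooth, hσ.embedding.comp hρ.embedding, fun x => ?_, fun x v => ?_⟩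
  · rw [h]
    exact (hσ.immersion (ρ x)).comp (hρ.immersion x)
  · rw [h]
    exact (hσ.contact _ _).trans (hρ.contact x v)

lemma ContactlyIsotopicToId.comp {σ ρ : M → M} (hσ : ContactlyIsotopicToId α σ)
    (hρ : ContactlyIsotopicToId α ρ) : ContactlyIsotopicToId α (σ ∘ ρ) := by
  obtain ⟨S, hS, hSe, hS0, hS1⟩ := hσ
  obtain ⟨R, hR, hRe, hR0, hR1⟩ := hρ
  refine ⟨fun t => S t ∘ R t, ?_, fun t ht => (hSe t ht).comp (hRe t ht), by simp [hS0, hR0],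
    by simp [hS1, hR1]⟩
  exact hS.comp (contMDiffOn_fst.prodMk hR) fun z hz => ⟨hz.1, mem_univ _⟩

/-- A map with a left inverse that is continuous along its image is an embedding. -/
lemma isEmbedding_of_leftInverse {X Y : Type*} [TopologicalSpace X] [TopologicalSpace Y]
    {f : X → Y} {g : Y → X} (hf : Continuous f) (hg : ∀ x, ContinuousAt g (f x))
    (h : Function.LeftInverse g f) : IsEmbedding f := by
  refine ⟨isInducing_iff_nhds.2 fun x => le_antisymm (hf.tendsto x).le_comap ?_, h.injective⟩
  have h1 : Filter.Tendsto (g ∘ f) (Filter.comap f (𝓝 (f x))) (𝓝 (g (f x))) :=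
    (hg x).tendsto.comp Filter.tendsto_comap
  rw [h.comp_eq_id, h x] at h1
  exact h1

end Composition

/-! ### Contact embeddings from homogeneous symplectic maps -/

section Homogeneous

/-- A smooth isotopy of positively homogeneous maps of the cone `C` which preserve the
Liouville form, with left inverses `Γ`. -/
structure IsHomogeneousIsotopy {E : Type*} [NormedAddCommGroup E] [InnerProductSpace ℝ E]
    (J : E →L[ℝ] E) (C : Set E) (Φ Γ : ℝ × E → E) : Prop where
  smooth : ContDiffOn ℝ ∞ Φ (univ ×ˢ C)
  mapsTo : ∀ τ, ∀ p ∈ C, Φ (τ, p) ∈ C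
  map_smul : ∀ τ, ∀ c : ℝ, 0 < c → ∀ p ∈ C, Φ (τ, c • p) = c • Φ (τ, p)
  left_inv : ∀ τ, ∀ p ∈ C, Γ (τ, Φ (τ, p)) = p
  differentiableAt_inv : ∀ τ, ∀ p ∈ C, DifferentiableAt ℝ (fun q => Γ (τ, q)) (Φ (τ, p))
  symp : ∀ τ, ∀ p ∈ C, ∀ v,
    inner ℝ (J (Φ (τ, p))) (fderiv ℝ (fun p => Φ (τ, p)) p v) = (inner ℝ (J p) v : ℝ)
  zero_apply : ∀ p ∈ C, Φ (0, p) = p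

variable {n k : ℕ} [NeZero n] {Φ Γ : ℝ × R2 n → R2 n}

omit [NeZero n] in
lemma IsHomogeneousIsotopy.incl_radial (hΦ : IsHomogeneousIsotopy (stdJ n) (cone n k) Φ Γ)
    (x₀ : sphereMinus n k) (τ : ℝ) (x : sphereMinus n k) :
    incl (radial x₀ (Φ (τ, incl x))) = ‖Φ (τ, incl x)‖⁻¹ • Φ (τ, incl x) :=
  ContactCone.incl_radial x₀ (hΦ.mapsTo τ _ (incl_mem x))

lemma IsHomogeneousIsotopy.contMDiff_radial
    (hΦ : IsHomogeneousIsotopy (stdJ n) (cone n k) Φ Γ) (x₀ : sphereMinus n k) :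
    ContMDiff (𝓘(ℝ, ℝ).prod (𝓡 (n + n - 1))) (𝓡 (n + n - 1)) ∞
      fun z : ℝ × sphereMinus n k => radial x₀ (Φ (z.1, incl z.2)) := by
  have h1 : ContMDiff (𝓘(ℝ, ℝ).prod (𝓡 (n + n - 1))) 𝓘(ℝ, ℝ × R2 n) ∞
      fun z : ℝ × sphereMinus n k => (z.1, incl z.2) :=
    contMDiff_fst.prodMk_space (contMDiff_incl.comp contMDiff_snd)
  have h2 := hΦ.smooth.contMDiffOn.comp (t := univ ×ˢ cone n k) h1.contMDiffOn (s := univ)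
    fun z _ => ⟨mem_univ _, incl_mem _⟩
  exact contMDiffOn_univ.1 <| (contMDiffOn_radial x₀).comp h2 fun z _ =>
    hΦ.mapsTo _ _ (incl_mem _)

/-- Differentiating the factor ‖Φ‖⁻¹ adds a multiple of Φ, which ⟪J Φ, ·⟫ kills. What remains is
divided by ‖Φ‖ twice, once for the point and once for the vector. -/
lemma IsHomogeneousIsotopy.alphaSt_dmap
    (hΦ : IsHomogeneousIsotopy (stdJ n) (cone n k) Φ Γ) (x₀ : sphereMinus n k) (τ : ℝ)
    (x : sphereMinus n k) (v : EuclideanSpace ℝ (Fin (n + n - 1))) :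
    alphaSt n k (radial x₀ (Φ (τ, incl x))) (dmap (fun x => radial x₀ (Φ (τ, incl x))) x v)
      = (‖Φ (τ, incl x)‖ ^ 2)⁻¹ * alphaSt n k x v := by
  have hd : DifferentiableAt ℝ (fun p => Φ (τ, p)) (incl x) :=
    (hasFDerivAt_space ((hΦ.smooth.contDiffAt ((isOpen_univ.prod isOpen_cone).mem_nhds
      ⟨mem_univ τ, incl_mem x⟩)).differentiableAt (by simp))).differentiableAt
  have h0 := ne_zero_of_mem_cone (hΦ.mapsTo τ _ (incl_mem x))
  have h1 : HasFDerivAt (fun p => ‖Φ (τ, p)‖⁻¹) _ (incl x) :=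
    (hasDerivAt_inv (norm_ne_zero_iff.2 h0)).comp_hasFDerivAt (incl x)
      ((hasFDerivAt_norm h0).comp (incl x) hd.hasFDerivAt)
  have h2 := h1.fun_smul hd.hasFDerivAt
  have hsm : ContMDiff (𝓡 (n + n - 1)) (𝓡 (n + n - 1)) ∞
      fun x : sphereMinus n k => radial x₀ (Φ (τ, incl x)) :=
    (hΦ.contMDiff_radial x₀).comp (contMDiff_const.prodMk contMDiff_id)
  rw [alphaSt_apply, alphaSt_apply, dincl_dmap hsm (F := fun p => ‖Φ (τ, p)‖⁻¹ • Φ (τ, p))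
    (hΦ.incl_radial x₀ τ) x h2.differentiableAt v, h2.fderiv, hΦ.incl_radial x₀ τ]
  simp only [ContinuousLinearMap.map_smul, add_apply, inner_add_right, smul_apply,
    real_inner_smul_left, real_inner_smul_right, hΦ.symp τ _ (incl_mem x),
    ContinuousLinearMap.smulRight_apply, (isComplexStructure_stdJ n).inner_self]
  ring

/-- By homogeneity the image of x is Φ of the rescaled point ‖Φ(x)‖⁻¹ x, so the map induced by `Γ`
is a left inverse. Its differentiability along the image yields both the embedding and the immersion
property. -/
lemma IsHomogeneousIsotopy.isContactEmbedding
    (hΦ : IsHomogeneousIsotopy (stdJ n) (cone n k) Φ Γ) (x₀ : sphereMinus n k) (τ : ℝ) :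
    IsContactEmbedding (alphaSt n k) fun x => radial x₀ (Φ (τ, incl x)) := by
  have hsm : ContMDiff (𝓡 (n + n - 1)) (𝓡 (n + n - 1)) ∞
      fun x : sphereMinus n k => radial x₀ (Φ (τ, incl x)) :=
    (hΦ.contMDiff_radial x₀).comp (contMDiff_const.prodMk contMDiff_id)
  let f : sphereMinus n k → sphereMinus n k := fun x => radial x₀ (Φ (τ, incl x))
  let g : sphereMinus n k → sphereMinus n k := fun x => radial x₀ (Γ (τ, incl x))
  have hpos : ∀ x : sphereMinus n k, 0 < ‖Φ (τ, incl x)‖⁻¹ := fun x =>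
    inv_pos.2 (norm_pos_of_mem_cone (hΦ.mapsTo τ _ (incl_mem x)))
  have hmem : ∀ x : sphereMinus n k, ‖Φ (τ, incl x)‖⁻¹ • incl x ∈ cone n k := fun x =>
    smul_mem_cone (hpos x).ne' (incl_mem x)
  have hf : ∀ x, incl (f x) = Φ (τ, ‖Φ (τ, incl x)‖⁻¹ • incl x) := fun x => by
    rw [hΦ.map_smul τ _ (hpos x) _ (incl_mem x)]
    exact hΦ.incl_radial x₀ τ x
  have hΓ : ∀ x, Γ (τ, incl (f x)) = ‖Φ (τ, incl x)‖⁻¹ • incl x := fun x => by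
    rw [hf, hΦ.left_inv τ _ (hmem x)]
  have hgf : Function.LeftInverse g f := fun x => incl_injective <| by
    change incl (radial x₀ (Γ (τ, incl (f x)))) = _
    rw [hΓ, ContactCone.incl_radial x₀ (hmem x), norm_smul, norm_incl, mul_one, norm_inv, norm_norm,
      inv_inv, smul_smul, mul_inv_cancel₀ (inv_pos.1 (hpos x) |>.ne'), one_smul]
  have hg : ∀ x, MDifferentiableAt (𝓡 (n + n - 1)) (𝓡 (n + n - 1)) g (f x) := fun x => by
    have h1 : DifferentiableAt ℝ (fun q => Γ (τ, q)) (incl (f x)) := by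
      rw [hf]
      exact hΦ.differentiableAt_inv τ _ (hmem x)
    have h2 : MDifferentiableAt 𝓘(ℝ, R2 n) (𝓡 (n + n - 1)) (radial x₀) (Γ (τ, incl (f x))) := by
      rw [hΓ]
      exact (contMDiffAt_radial x₀ (hmem x)).mdifferentiableAt (by simp)
    exact h2.comp (f x) (h1.mdifferentiableAt.comp (f x)
      (contMDiff_incl.mdifferentiable (by simp) (f x)))
  refine ⟨hsm, isEmbedding_of_leftInverse hsm.continuous (fun x => (hg x).continuousAt) hgf,
    fun x => ?_, fun x v => ?_⟩
  · have h1 := (hg x).hasMFDerivAt.comp x (hsm.mdifferentiable (by simp) x).hasMFDerivAt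
    rw [hgf.comp_eq_id] at h1
    have h2 := hasMFDerivAt_unique h1 (hasMFDerivAt_id x)
    exact Function.LeftInverse.injective (g := mfderiv (𝓡 (n + n - 1)) (𝓡 (n + n - 1)) g (f x))
      fun v => congrArg (fun A => A v) h2
  · have h1 := hΦ.alphaSt_dmap x₀ τ x v
    have h2 : (‖Φ (τ, incl x)‖ ^ 2)⁻¹ ≠ 0 :=
      inv_ne_zero (pow_ne_zero 2 (inv_pos.1 (hpos x) |>.ne'))
    refine (iff_of_eq (congrArg (· = 0) h1)).trans ?_
    exact mul_eq_zero_iff_left h2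

lemma IsHomogeneousIsotopy.contactlyIsotopicToId
    (hΦ : IsHomogeneousIsotopy (stdJ n) (cone n k) Φ Γ) (x₀ : sphereMinus n k) (τ : ℝ) :
    ContactlyIsotopicToId (alphaSt n k) fun x => radial x₀ (Φ (τ, incl x)) := by
  refine ⟨fun t x => radial x₀ (Φ (t * τ, incl x)), ?_,
    fun t _ => hΦ.isContactEmbedding x₀ (t * τ), funext fun x => ?_, by simp⟩
  · have h1 : ContMDiff (𝓘(ℝ, ℝ).prod (𝓡 (n + n - 1))) (𝓘(ℝ, ℝ).prod (𝓡 (n + n - 1))) ∞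
        fun z : ℝ × sphereMinus n k => (z.1 * τ, z.2) :=
      ((contDiff_id.mul contDiff_const).contMDiff.comp contMDiff_fst).prodMk contMDiff_snd
    exact ((hΦ.contMDiff_radial x₀).comp h1).contMDiffOn
  · simp [hΦ.zero_apply _ (incl_mem x), radial_incl]

end Homogeneous

/-! ### Splitting off an isotropic subspace -/

section Splitting

variable {E : Type} [NormedAddCommGroup E] [InnerProductSpace ℝ E] {J P : E →L[ℝ] E}

/-- `P` is the orthogonal projection to an isotropic subspace. -/
structure IsIsotropicProjection (J P : E →L[ℝ] E) : Prop where
  idem : ∀ p, P (P p) = P p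
  symm : ∀ p q, inner ℝ (P p) q = (inner ℝ p (P q) : ℝ)
  isotropic : ∀ p, P (J (P p)) = 0

/-- The component `y` of `p = x + J y + z`, where `x` and `y` lie in the range of `P`. -/
def yPart (J P : E →L[ℝ] E) : E →L[ℝ] E := -(P ∘L J)

/-- The component `z` of `p = x + J y + z`, where `x` and `y` lie in the range of `P`. -/
def zPart (J P : E →L[ℝ] E) : E →L[ℝ] E := .id ℝ E - P - J ∘L yPart J P

lemma yPart_apply (p : E) : yPart J P p = - P (J p) := rfl

lemma zPart_apply (p : E) : zPart J P p = p - P p - J (yPart J P p) := rfl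

lemma add_yPart_add_zPart (p : E) : P p + J (yPart J P p) + zPart J P p = p := by
  rw [zPart_apply]
  abel

namespace IsIsotropicProjection

lemma map_yPart (hP : IsIsotropicProjection J P) (p : E) : P (yPart J P p) = yPart J P p := by
  rw [yPart_apply, map_neg, hP.idem]

lemma map_J (hP : IsIsotropicProjection J P) {x : E} (hx : P x = x) : P (J x) = 0 := by
  rw [← hx, hP.isotropic]

lemma inner_eq_zero (hP : IsIsotropicProjection J P) {x z : E} (hx : P x = x) (hz : P z = 0) : inner ℝ x z = (0 : ℝ) := by
  rw [← hx, hP.symm, hz, inner_zero_right]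

lemma map_zPart (hP : IsIsotropicProjection J P) (p : E) : P (zPart J P p) = 0 := by
  rw [zPart_apply, map_sub, map_sub, hP.idem, hP.map_J (hP.map_yPart p), sub_self, sub_zero]

lemma map_J_zPart (hP : IsIsotropicProjection J P) (hJ : IsComplexStructure J) (p : E) : P (J (zPart J P p)) = 0 := by
  rw [zPart_apply, map_sub, map_sub, map_sub, map_sub, hP.isotropic, hJ.sq, map_neg, hP.map_yPart,
    yPart_apply]
  abel

variable {x y z : E}

lemma map_add_add (hP : IsIsotropicProjection J P) (hx : P x = x) (hy : P y = y) (hz : P z = 0) : P (x + J y + z) = x := by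
  rw [map_add, map_add, hx, hP.map_J hy, hz, add_zero, add_zero]

lemma yPart_add_add (hP : IsIsotropicProjection J P) (hJ : IsComplexStructure J) (hx : P x = x) (hy : P y = y)
    (hJz : P (J z) = 0) : yPart J P (x + J y + z) = y := by
  rw [yPart_apply, map_add, map_add, map_add, map_add, hP.map_J hx, hJ.sq, map_neg, hy, hJz]
  simp

lemma zPart_add_add (hP : IsIsotropicProjection J P) (hJ : IsComplexStructure J) (hx : P x = x) (hy : P y = y)
    (hz : P z = 0) (hJz : P (J z) = 0) : zPart J P (x + J y + z) = z := by
  rw [zPart_apply, hP.map_add_add hx hy hz, hP.yPart_add_add hJ hx hy hJz]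
  abel

/-- Isotropy and the J-invariance of the space of z-components remove all mixed terms, which leaves
x and y as conjugate variables. -/
lemma inner_J (hP : IsIsotropicProjection J P) (hJ : IsComplexStructure J) (p v : E) : inner ℝ (J p) v
    = inner ℝ (P p) (yPart J P v) - inner ℝ (yPart J P p) (P v)
      + (inner ℝ (J (zPart J P p)) (zPart J P v) : ℝ) := by
  have hz := hP.map_zPart
  have hJz := hP.map_J_zPart hJ
  have hy := hP.map_yPart
  have hJx : ∀ {x : E}, P x = x → P (J x) = 0 := hP.map_J
  conv_lhs => rw [← add_yPart_add_zPart (J := J) (P := P) p,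
    ← add_yPart_add_zPart (J := J) (P := P) v]
  simp only [map_add, inner_add_left, inner_add_right, hJ.inner_map_map, hJ.sq, inner_neg_left]
  have e1 : inner ℝ (J (P p)) (P v) = (0 : ℝ) := by
    rw [real_inner_comm, hP.inner_eq_zero (hP.idem v) (hP.isotropic p)]
  have e2 : inner ℝ (J (P p)) (zPart J P v) = (0 : ℝ) := by
    rw [hJ.skew, hP.inner_eq_zero (hP.idem p) (hJz v), neg_zero]
  have e3 : inner ℝ (yPart J P p) (J (yPart J P v)) = (0 : ℝ) :=
    hP.inner_eq_zero (hy p) (hJx (hy v))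
  have e4 : inner ℝ (yPart J P p) (zPart J P v) = (0 : ℝ) := hP.inner_eq_zero (hy p) (hz v)
  have e5 : inner ℝ (J (zPart J P p)) (P v) = (0 : ℝ) := by
    rw [real_inner_comm, hP.inner_eq_zero (hP.idem v) (hJz p)]
  have e6 : inner ℝ (zPart J P p) (yPart J P v) = (0 : ℝ) := by
    rw [real_inner_comm, hP.inner_eq_zero (hy v) (hz p)]
  rw [e1, e2, e3, e4, e5, e6]
  ring

lemma norm_sq (hP : IsIsotropicProjection J P) (hJ : IsComplexStructure J) (p : E) :
    ‖p‖ ^ 2 = ‖P p‖ ^ 2 + ‖yPart J P p‖ ^ 2 + ‖zPart J P p‖ ^ 2 := by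
  have hz := hP.map_zPart
  have hy := hP.map_yPart
  simp only [← real_inner_self_eq_norm_sq]
  conv_lhs => rw [← add_yPart_add_zPart (J := J) (P := P) p]
  simp only [inner_add_left, inner_add_right, hJ.inner_map_map]
  have e1 : inner ℝ (P p) (J (yPart J P p)) = (0 : ℝ) :=
    hP.inner_eq_zero (hP.idem p) (hP.map_J (hy p))
  have e2 : inner ℝ (P p) (zPart J P p) = (0 : ℝ) := hP.inner_eq_zero (hP.idem p) (hz p)
  have e3 : inner ℝ (J (yPart J P p)) (zPart J P p) = (0 : ℝ) := by
    rw [hJ.skew, hP.inner_eq_zero (hy p) (hP.map_J_zPart hJ p), neg_zero]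
  rw [real_inner_comm (P p) (J (yPart J P p)), real_inner_comm (P p) (zPart J P p),
    real_inner_comm (J (yPart J P p)) (zPart J P p), e1, e2, e3]
  ring

end IsIsotropicProjection

/-- The symplectic scaling `x + J y + z ↦ e^τ x + e^{-τ} J y + z`. -/
def scaling (J P : E →L[ℝ] E) (w : ℝ × E) : E :=
  Real.exp w.1 • P w.2 + J (Real.exp (-w.1) • yPart J P w.2) + zPart J P w.2

lemma contDiff_scaling : ContDiff ℝ ∞ (scaling J P) := by
  unfold scaling
  fun_prop

lemma IsIsotropicProjection.map_scaling (hP : IsIsotropicProjection J P) (τ : ℝ) (p : E) :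
    P (scaling J P (τ, p)) = Real.exp τ • P p :=
  hP.map_add_add (by simp [hP.idem]) (by simp [hP.map_yPart]) (hP.map_zPart p)

lemma IsIsotropicProjection.yPart_scaling (hP : IsIsotropicProjection J P)
    (hJ : IsComplexStructure J) (τ : ℝ) (p : E) :
    yPart J P (scaling J P (τ, p)) = Real.exp (-τ) • yPart J P p :=
  hP.yPart_add_add hJ (by simp [hP.idem]) (by simp [hP.map_yPart]) (hP.map_J_zPart hJ p)

lemma IsIsotropicProjection.zPart_scaling (hP : IsIsotropicProjection J P)
    (hJ : IsComplexStructure J) (τ : ℝ) (p : E) :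
    zPart J P (scaling J P (τ, p)) = zPart J P p :=
  hP.zPart_add_add hJ (by simp [hP.idem]) (by simp [hP.map_yPart]) (hP.map_zPart p)
    (hP.map_J_zPart hJ p)

lemma IsIsotropicProjection.isHomogeneousIsotopy_scaling (hP : IsIsotropicProjection J P)
    (hJ : IsComplexStructure J) :
    IsHomogeneousIsotopy J {p | P p ≠ 0} (scaling J P) fun w => scaling J P (-w.1, w.2) := by
  have hx : ∀ τ p, P (scaling J P (τ, p)) = Real.exp τ • P p := hP.map_scaling
  have hy := hP.yPart_scaling hJ
  have hz := hP.zPart_scaling hJ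
  refine ⟨contDiff_scaling.contDiffOn, fun τ p hp => ?_, fun τ c _ p _ => ?_, fun τ p _ => ?_,
    fun τ p _ => ?_, fun τ p _ v => ?_, fun p _ => ?_⟩
  · simpa [hx] using hp
  · simp only [scaling, map_smul, smul_add]
    simp only [smul_comm c]
  · change Real.exp (-τ) • P (scaling J P (τ, p))
      + J (Real.exp (- -τ) • yPart J P (scaling J P (τ, p))) + zPart J P (scaling J P (τ, p)) = p
    rw [hx, hy, hz, smul_smul, smul_smul, ← Real.exp_add, ← Real.exp_add]
    simp [add_yPart_add_zPart]
  · exact (contDiff_scaling.comp (contDiff_prodMk_right (-τ))).differentiable (by simp) _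
  · let A : E →L[ℝ] E := Real.exp τ • P + J ∘L (Real.exp (-τ) • yPart J P) + zPart J P
    have hA : (fun p => scaling J P (τ, p)) = A := by
      ext p
      simp [A, scaling]
    rw [hA, A.fderiv, ← hA, hP.inner_J hJ, hP.inner_J hJ p v, hx, hy, hz, hx, hy, hz]
    simp only [real_inner_smul_left, real_inner_smul_right]
    have := Real.exp_add τ (-τ)
    rw [add_neg_cancel, Real.exp_zero] at this
    linear_combination (inner ℝ (yPart J P p) (P v) - inner ℝ (P p) (yPart J P v)) * this
  · simp [scaling, add_yPart_add_zPart]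

end Splitting

/-! ### Homogeneous coordinates adapted to an isotropic subspace -/

section Model

variable {E : Type} [NormedAddCommGroup E] [InnerProductSpace ℝ E] {J P : E →L[ℝ] E}

/-- Twice the Liouville form in the coordinates `(ξ, U, z)`. -/
def modelForm (J : E →L[ℝ] E) (m v : E × E × E) : ℝ :=
  inner ℝ m.1 v.2.1 + inner ℝ (J m.2.2) v.2.2

/-- The homogeneous coordinates `(ξ, U, z)` of `x + J y + z`: position `U` and momentum `ξ`. -/
def toModel (J P : E →L[ℝ] E) (p : E) : E × E × E :=
  (‖P p‖ • P p, (2 * ‖P p‖⁻¹) • yPart J P p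
    - (inner ℝ (P p) (yPart J P p) * (‖P p‖ ^ 3)⁻¹) • P p, zPart J P p)

/-- The point with homogeneous coordinates `(ξ, U, z)`. -/
def ofModel (J : E →L[ℝ] E) (m : E × E × E) : E :=
  (√‖m.1‖)⁻¹ • m.1 + J ((√‖m.1‖ / 2) • (m.2.1 + (inner ℝ m.1 m.2.1 * (‖m.1‖ ^ 2)⁻¹) • m.1)) + m.2.2

/-- The cotangent lift of the map `U ↦ U / √(1 + s |U|²)`. -/
def shrink (w : ℝ × E × E × E) : E × E × E :=
  (√(1 + w.1 * ‖w.2.2.1‖ ^ 2) • (w.2.1 + (w.1 * inner ℝ w.2.2.1 w.2.1) • w.2.2.1),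
    (√(1 + w.1 * ‖w.2.2.1‖ ^ 2))⁻¹ • w.2.2.1, w.2.2.2)

/-- The unit vector in the direction of the momentum. -/
def direction (m : E × E × E) : E := ‖m.1‖⁻¹ • m.1

/-- Adds `s |z|²` to the length of the momentum, and compensates for this by a rotation of `z`
and a contraction of the component of `U` that is orthogonal to the momentum. -/
def twist (J : E →L[ℝ] E) (w : ℝ × E × E × E) : E × E × E :=
  ((‖w.2.1‖ + w.1 * ‖w.2.2.2‖ ^ 2) • direction w.2,
    inner ℝ (direction w.2) w.2.2.1 • direction w.2
      + (‖w.2.1‖ / (‖w.2.1‖ + w.1 * ‖w.2.2.2‖ ^ 2)) •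
        (w.2.2.1 - inner ℝ (direction w.2) w.2.2.1 • direction w.2),
    Real.cos (w.1 * inner ℝ (direction w.2) w.2.2.1) • w.2.2.2
      - Real.sin (w.1 * inner ℝ (direction w.2) w.2.2.1) • J w.2.2.2)

/-- Coordinates of actual points of the ambient space. -/
structure IsModelPoint (J P : E →L[ℝ] E) (m : E × E × E) : Prop where
  momentum : P m.1 = m.1
  position : P m.2.1 = m.2.1
  map_z : P m.2.2 = 0
  map_J_z : P (J m.2.2) = 0

lemma isModelPoint_toModel (hP : IsIsotropicProjection J P) (hJ : IsComplexStructure J) (p : E) :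
    IsModelPoint J P (toModel J P p) := by
  refine ⟨?_, ?_, hP.map_zPart p, hP.map_J_zPart hJ p⟩ <;> simp [toModel, hP.idem, hP.map_yPart]

lemma IsModelPoint.shrink {m : E × E × E} (h : IsModelPoint J P m) (s : ℝ) :
    IsModelPoint J P (shrink (s, m)) := by
  refine ⟨?_, ?_, h.map_z, h.map_J_z⟩ <;>
    simp [ContactCone.shrink, h.momentum, h.position]

lemma IsModelPoint.map_direction {m : E × E × E} (h : IsModelPoint J P m) :
    P (direction m) = direction m := by
  simp [direction, h.momentum]

lemma IsModelPoint.twist {m : E × E × E} (h : IsModelPoint J P m) (hJ : IsComplexStructure J)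
    (s : ℝ) : IsModelPoint J P (twist J (s, m)) := by
  refine ⟨?_, ?_, ?_, ?_⟩ <;>
    simp [ContactCone.twist, h.map_direction, h.position, h.map_z, h.map_J_z, hJ.sq]

lemma norm_toModel_fst (p : E) : ‖(toModel J P p).1‖ = ‖P p‖ ^ 2 := by
  rw [toModel, norm_smul, norm_norm, pow_two]

lemma toModel_fst_ne_zero {p : E} (hp : P p ≠ 0) : (toModel J P p).1 ≠ 0 :=
  smul_ne_zero (norm_ne_zero_iff.2 hp) hp

/-- From |ξ| = |x|² and ⟪ξ, U⟫ = ⟪x, y⟫ one recovers x and then y. -/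
lemma ofModel_toModel {p : E} (hp : P p ≠ 0) : ofModel J (toModel J P p) = p := by
  have hr := norm_ne_zero_iff.2 hp
  have h1 : √‖(toModel J P p).1‖ = ‖P p‖ := by
    rw [norm_toModel_fst, Real.sqrt_sq (norm_nonneg _)]
  have h2 : inner ℝ (toModel J P p).1 (toModel J P p).2.1
      = (inner ℝ (P p) (yPart J P p) : ℝ) := by
    simp only [toModel, inner_sub_right, real_inner_smul_left, real_inner_smul_right,
      real_inner_self_eq_norm_sq]
    field_simp
    ring
  rw [ofModel, h1, h2, norm_toModel_fst]
  conv_rhs => rw [← add_yPart_add_zPart (J := J) (P := P) p]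
  congr 2
  · simp [toModel, smul_smul, hr]
  · congr 1
    simp only [toModel]
    match_scalars <;> field_simp
    ring

lemma toModel_ofModel (hP : IsIsotropicProjection J P) (hJ : IsComplexStructure J)
    {m : E × E × E} (hm : IsModelPoint J P m) (h0 : m.1 ≠ 0) : toModel J P (ofModel J m) = m := by
  obtain ⟨ξ, U, z⟩ := m
  obtain ⟨h1, h2, h3, h4⟩ := hm
  simp only at h0 h1 h2 h3 h4
  have hξ : 0 < ‖ξ‖ := norm_pos_iff.2 h0
  obtain ⟨a, ha, haξ⟩ : ∃ a : ℝ, 0 < a ∧ ‖ξ‖ = a ^ 2 :=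
    ⟨√‖ξ‖, Real.sqrt_pos.2 hξ, (Real.sq_sqrt hξ.le).symm⟩
  have hx : P (a⁻¹ • ξ) = a⁻¹ • ξ := by simp [h1]
  have hy : P ((a / 2) • (U + (inner ℝ ξ U * (‖ξ‖ ^ 2)⁻¹) • ξ))
      = (a / 2) • (U + (inner ℝ ξ U * (‖ξ‖ ^ 2)⁻¹) • ξ) := by simp [h1, h2]
  have hn : ‖a⁻¹ • ξ‖ = a := by
    rw [norm_smul, haξ, norm_inv, Real.norm_of_nonneg ha.le]
    field_simp
  have hin : inner ℝ (a⁻¹ • ξ) ((a / 2) • (U + (inner ℝ ξ U * (‖ξ‖ ^ 2)⁻¹) • ξ))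
      = (inner ℝ ξ U : ℝ) := by
    simp only [inner_add_right, real_inner_smul_left, real_inner_smul_right,
      real_inner_self_eq_norm_sq]
    field_simp
    ring
  simp only [ofModel, toModel]
  rw [haξ, Real.sqrt_sq ha.le, ← haξ, hP.map_add_add hx hy h3, hP.yPart_add_add hJ hx hy h4,
    hP.zPart_add_add hJ hx hy h3 h4, hn, hin, haξ]
  refine Prod.ext ?_ (Prod.ext ?_ rfl)
  · simp [smul_smul, ha.ne']
  · simp only
    match_scalars <;> field_simp
    ring

/-! ### Domains and inverses -/

/-- The new momentum pairs with the old one to a positive multiple of |ξ|² + s⟪U, ξ⟫². -/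
lemma shrink_fst_ne_zero {s : ℝ} (hs : 0 ≤ s) {m : E × E × E} (h0 : m.1 ≠ 0) :
    (shrink (s, m)).1 ≠ 0 := by
  intro h
  have h1 := congrArg (fun w => (inner ℝ w m.1 : ℝ)) h
  have h2 : 0 < √(1 + s * ‖m.2.1‖ ^ 2) := Real.sqrt_pos.2 (by positivity)
  have h3 : 0 < ‖m.1‖ := norm_pos_iff.2 h0
  simp only [shrink, inner_add_left, real_inner_smul_left, real_inner_self_eq_norm_sq,
    inner_zero_left] at h1
  have h4 : 0 < √(1 + s * ‖m.2.1‖ ^ 2)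
      * (‖m.1‖ ^ 2 + s * inner ℝ m.2.1 m.1 * inner ℝ m.2.1 m.1) := by
    rw [mul_assoc s]
    have := mul_self_nonneg (inner ℝ m.2.1 m.1 : ℝ)
    positivity
  exact h4.ne' h1

lemma norm_shrink_snd_sq {s : ℝ} {m : E × E × E} (h : 0 < 1 + s * ‖m.2.1‖ ^ 2) :
    ‖(shrink (s, m)).2.1‖ ^ 2 = ‖m.2.1‖ ^ 2 / (1 + s * ‖m.2.1‖ ^ 2) := by
  simp only [shrink, norm_smul, norm_inv, mul_pow, inv_pow, Real.norm_eq_abs, sq_abs,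
    Real.sq_sqrt h.le]
  field_simp

/-- The square root for -s at the image is thus the reciprocal of the one for s at the source, which
is why opposite parameters give inverse maps. -/
lemma one_sub_norm_shrink {s : ℝ} {m : E × E × E} (h : 0 < 1 + s * ‖m.2.1‖ ^ 2) :
    1 + -s * ‖(shrink (s, m)).2.1‖ ^ 2 = (1 + s * ‖m.2.1‖ ^ 2)⁻¹ := by
  rw [norm_shrink_snd_sq h]
  field_simp
  ring

lemma shrink_neg_shrink {s : ℝ} {m : E × E × E} (h : 0 < 1 + s * ‖m.2.1‖ ^ 2) :
    shrink (-s, shrink (s, m)) = m := by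
  have h1 := one_sub_norm_shrink h
  obtain ⟨ξ, U, z⟩ := m
  simp only at h
  rw [shrink]
  simp only [h1]
  simp only [shrink]
  set ρ := √(1 + s * ‖U‖ ^ 2) with hρ
  have hρ0 : 0 < ρ := Real.sqrt_pos.2 h
  have hρ2 : ρ ^ 2 = 1 + s * ‖U‖ ^ 2 := Real.sq_sqrt h.le
  rw [Real.sqrt_inv, ← hρ]
  refine Prod.ext ?_ (Prod.ext ?_ rfl)
  · simp only [inner_add_right, real_inner_smul_left, real_inner_smul_right,
      real_inner_self_eq_norm_sq]
    match_scalars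
    · field_simp
    · field_simp
      linear_combination (s * inner ℝ U ξ) * hρ2
  · simp [smul_smul, hρ0.ne']

lemma norm_direction {m : E × E × E} (h0 : m.1 ≠ 0) : ‖direction m‖ = 1 := by
  rw [direction, norm_smul, norm_inv, norm_norm, inv_mul_cancel₀ (norm_ne_zero_iff.2 h0)]

lemma inner_direction_self {m : E × E × E} (h0 : m.1 ≠ 0) :
    inner ℝ (direction m) (direction m) = (1 : ℝ) := by
  rw [real_inner_self_eq_norm_sq, norm_direction h0, one_pow]

lemma norm_twist_fst {s : ℝ} {m : E × E × E} (h0 : m.1 ≠ 0) (h : 0 < ‖m.1‖ + s * ‖m.2.2‖ ^ 2) :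
    ‖(twist J (s, m)).1‖ = ‖m.1‖ + s * ‖m.2.2‖ ^ 2 := by
  simp only [twist, norm_smul, norm_direction h0, mul_one, Real.norm_of_nonneg h.le]

lemma twist_fst_ne_zero {s : ℝ} {m : E × E × E} (h0 : m.1 ≠ 0)
    (h : 0 < ‖m.1‖ + s * ‖m.2.2‖ ^ 2) : (twist J (s, m)).1 ≠ 0 := by
  rw [← norm_pos_iff, norm_twist_fst h0 h]
  exact h

lemma direction_twist {s : ℝ} {m : E × E × E} (h0 : m.1 ≠ 0)
    (h : 0 < ‖m.1‖ + s * ‖m.2.2‖ ^ 2) : direction (twist J (s, m)) = direction m := by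
  rw [direction, norm_twist_fst h0 h]
  simp only [twist]
  rw [smul_smul, inv_mul_cancel₀ h.ne', one_smul]

lemma inner_direction_twist_snd {s : ℝ} {m : E × E × E} (h0 : m.1 ≠ 0) :
    inner ℝ (direction m) (twist J (s, m)).2.1 = (inner ℝ (direction m) m.2.1 : ℝ) := by
  simp only [twist, inner_add_right, inner_sub_right, real_inner_smul_right,
    inner_direction_self h0]
  ring

/-- Rotations in the complex structure `J` preserve the norm. -/
lemma norm_rotation_sq (hJ : IsComplexStructure J) (θ : ℝ) (z : E) :
    ‖Real.cos θ • z - Real.sin θ • J z‖ ^ 2 = ‖z‖ ^ 2 := by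
  have h1 := hJ.inner_self z
  have h2 : inner ℝ z (J z) = (0 : ℝ) := by rw [real_inner_comm, h1]
  simp only [← real_inner_self_eq_norm_sq, inner_sub_left, inner_sub_right, real_inner_smul_left,
    real_inner_smul_right, hJ.inner_map_map, h1, h2]
  linear_combination (inner ℝ z z) * Real.sin_sq_add_cos_sq θ

lemma norm_twist_z_sq (hJ : IsComplexStructure J) (w : ℝ × E × E × E) :
    ‖(twist J w).2.2‖ ^ 2 = ‖w.2.2.2‖ ^ 2 :=
  norm_rotation_sq hJ _ _

/-- The momentum direction, the component of U along it and |z| are preserved, so the second twist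
has the opposite angle and the reciprocal contraction. -/
lemma twist_neg_twist (hJ : IsComplexStructure J) {s : ℝ} {m : E × E × E} (h0 : m.1 ≠ 0)
    (h : 0 < ‖m.1‖ + s * ‖m.2.2‖ ^ 2) : twist J (-s, twist J (s, m)) = m := by
  have hξ := norm_ne_zero_iff.2 h0
  conv_lhs => rw [twist]
  simp only [direction_twist h0 h, inner_direction_twist_snd h0, norm_twist_fst h0 h,
    norm_twist_z_sq hJ]
  have e1 : ‖m.1‖ + s * ‖m.2.2‖ ^ 2 + -s * ‖m.2.2‖ ^ 2 = ‖m.1‖ := by ring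
  rw [e1]
  refine Prod.ext ?_ (Prod.ext ?_ ?_)
  · simp [direction, smul_smul, hξ]
  · simp only [twist]
    have e2 : (‖m.1‖ + s * ‖m.2.2‖ ^ 2) / ‖m.1‖ * (‖m.1‖ / (‖m.1‖ + s * ‖m.2.2‖ ^ 2)) = 1 := by
      field_simp
    rw [add_sub_cancel_left, smul_smul, e2, one_smul]
    abel
  · simp only [twist, neg_mul, Real.cos_neg, Real.sin_neg, map_sub, map_smul, hJ.sq]
    have := Real.sin_sq_add_cos_sq (s * inner ℝ (direction m) m.2.1)
    match_scalars
    · linear_combination this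
    · ring

/-! ### Homogeneity -/

/-- The action of positive scalars in homogeneous coordinates. -/
def modelScale (c : ℝ) (m : E × E × E) : E × E × E := (c ^ 2 • m.1, m.2.1, c • m.2.2)

/-- The weights of ξ, U, z are 2, 0, 1. Maps that respect them correspond to maps homogeneous of
degree one on the cone. -/
lemma toModel_smul {c : ℝ} (hc : 0 < c) (p : E) :
    toModel J P (c • p) = modelScale c (toModel J P p) := by
  simp only [toModel, modelScale, map_smul, norm_smul, Real.norm_of_nonneg hc.le,
    real_inner_smul_left, real_inner_smul_right]
  refine Prod.ext ?_ (Prod.ext ?_ rfl) <;> simp only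
  · module
  · match_scalars <;> field_simp

lemma ofModel_modelScale {c : ℝ} (hc : 0 < c) (m : E × E × E) :
    ofModel J (modelScale c m) = c • ofModel J m := by
  have h1 : √(c ^ 2 * ‖m.1‖) = c * √‖m.1‖ := by
    rw [Real.sqrt_mul (sq_nonneg c), Real.sqrt_sq hc.le]
  simp only [ofModel, modelScale, h1, real_inner_smul_left, norm_smul, norm_pow,
    Real.norm_of_nonneg hc.le, smul_add]
  simp only [map_add, map_smul]
  match_scalars <;> field_simp

lemma shrink_modelScale (s c : ℝ) (m : E × E × E) :
    shrink (s, modelScale c m) = modelScale c (shrink (s, m)) := by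
  simp only [shrink, modelScale, real_inner_smul_right]
  refine Prod.ext ?_ rfl
  simp only
  module

lemma direction_modelScale {c : ℝ} (hc : 0 < c) (m : E × E × E) :
    direction (modelScale c m) = direction m := by
  simp only [direction, modelScale, norm_smul, norm_pow, Real.norm_of_nonneg hc.le, smul_smul]
  congr 1
  field_simp

lemma twist_modelScale {c : ℝ} (hc : 0 < c) (s : ℝ) (m : E × E × E) :
    twist J (s, modelScale c m) = modelScale c (twist J (s, m)) := by
  have h1 : ‖(modelScale c m).1‖ = c ^ 2 * ‖m.1‖ := by
    simp [modelScale, norm_smul]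
  have h2 : ‖(modelScale c m).2.2‖ ^ 2 = c ^ 2 * ‖m.2.2‖ ^ 2 := by
    simp [modelScale, norm_smul, mul_pow]
  simp only [twist, direction_modelScale hc, h1, h2]
  have h3 : c ^ 2 * ‖m.1‖ + s * (c ^ 2 * ‖m.2.2‖ ^ 2) = c ^ 2 * (‖m.1‖ + s * ‖m.2.2‖ ^ 2) := by ring
  rw [h3, mul_div_mul_left _ _ (pow_ne_zero 2 hc.ne')]
  simp only [modelScale, map_smul]
  refine Prod.ext ?_ (Prod.ext rfl ?_) <;> simp only
  · module
  · module

end Model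

/-! ### Smoothness -/

section ModelCalculus

variable {E : Type} [NormedAddCommGroup E] [InnerProductSpace ℝ E] {J P : E →L[ℝ] E}

lemma contDiffAt_toModel {p : E} (hp : P p ≠ 0) : ContDiffAt ℝ ∞ (toModel J P) p := by
  have h1 : ContDiffAt ℝ ∞ (fun p => ‖P p‖) p := P.contDiff.contDiffAt.norm ℝ hp
  have h2 := norm_ne_zero_iff.2 hp
  have hP : ContDiffAt ℝ ∞ (fun p => P p) p := P.contDiff.contDiffAt
  have hy : ContDiffAt ℝ ∞ (fun p => yPart J P p) p := (yPart J P).contDiff.contDiffAt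
  exact (h1.smul hP).prodMk ((((contDiffAt_const.mul (h1.inv h2)).smul hy).sub
    (((hP.inner ℝ hy).mul ((h1.pow 3).inv (pow_ne_zero 3 h2))).smul hP)).prodMk
      (zPart J P).contDiff.contDiffAt)

lemma contDiffAt_ofModel {m : E × E × E} (h0 : m.1 ≠ 0) : ContDiffAt ℝ ∞ (ofModel J) m := by
  have h1 : ContDiffAt ℝ ∞ (fun m : E × E × E => m.1) m := contDiffAt_fst
  have h2 : ContDiffAt ℝ ∞ (fun m : E × E × E => ‖m.1‖) m := h1.norm ℝ h0
  have hξ := norm_ne_zero_iff.2 h0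
  have h3 : ContDiffAt ℝ ∞ (fun m : E × E × E => √‖m.1‖) m := h2.sqrt hξ
  have hU : ContDiffAt ℝ ∞ (fun m : E × E × E => m.2.1) m := contDiffAt_fst.comp m contDiffAt_snd
  have hz : ContDiffAt ℝ ∞ (fun m : E × E × E => m.2.2) m := contDiffAt_snd.comp m contDiffAt_snd
  refine (((h3.inv ((Real.sqrt_ne_zero (norm_nonneg _)).2 hξ)).smul h1).add
    (J.contDiff.contDiffAt.comp m ?_)).add hz
  exact (h3.div_const 2).smul (hU.add (((h1.inner ℝ hU).mul
    ((h2.pow 2).inv (pow_ne_zero 2 hξ))).smul h1))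

lemma contDiffAt_shrink {w : ℝ × E × E × E} (h : 0 < 1 + w.1 * ‖w.2.2.1‖ ^ 2) :
    ContDiffAt ℝ ∞ shrink w := by
  have hs : ContDiffAt ℝ ∞ (fun w : ℝ × E × E × E => w.1) w := contDiffAt_fst
  have hξ : ContDiffAt ℝ ∞ (fun w : ℝ × E × E × E => w.2.1) w := by fun_prop
  have hU : ContDiffAt ℝ ∞ (fun w : ℝ × E × E × E => w.2.2.1) w := by fun_prop
  have hz : ContDiffAt ℝ ∞ (fun w : ℝ × E × E × E => w.2.2.2) w := by fun_prop
  have hρ : ContDiffAt ℝ ∞ (fun w : ℝ × E × E × E => √(1 + w.1 * ‖w.2.2.1‖ ^ 2)) w :=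
    (contDiffAt_const.add (hs.mul (hU.norm_sq ℝ))).sqrt h.ne'
  exact (hρ.smul (hξ.add ((hs.mul (hU.inner ℝ hξ)).smul hU))).prodMk
    (((hρ.inv (Real.sqrt_pos.2 h).ne').smul hU).prodMk hz)

lemma contDiffAt_direction {m : E × E × E} (h0 : m.1 ≠ 0) : ContDiffAt ℝ ∞ direction m :=
  (contDiffAt_normalize h0).comp m contDiffAt_fst

lemma contDiffAt_twist {w : ℝ × E × E × E} (h0 : w.2.1 ≠ 0)
    (h : 0 < ‖w.2.1‖ + w.1 * ‖w.2.2.2‖ ^ 2) : ContDiffAt ℝ ∞ (twist J) w := by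
  have hs : ContDiffAt ℝ ∞ (fun w : ℝ × E × E × E => w.1) w := contDiffAt_fst
  have hξ : ContDiffAt ℝ ∞ (fun w : ℝ × E × E × E => w.2.1) w := by fun_prop
  have hU : ContDiffAt ℝ ∞ (fun w : ℝ × E × E × E => w.2.2.1) w := by fun_prop
  have hz : ContDiffAt ℝ ∞ (fun w : ℝ × E × E × E => w.2.2.2) w := by fun_prop
  have hd : ContDiffAt ℝ ∞ (fun w : ℝ × E × E × E => direction w.2) w :=
    (contDiffAt_direction h0).comp w contDiffAt_snd
  have hA : ContDiffAt ℝ ∞ (fun w : ℝ × E × E × E => ‖w.2.1‖) w := hξ.norm ℝ h0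
  have hB : ContDiffAt ℝ ∞ (fun w : ℝ × E × E × E => ‖w.2.1‖ + w.1 * ‖w.2.2.2‖ ^ 2) w :=
    hA.add (hs.mul (hz.norm_sq ℝ))
  have hv := hd.inner ℝ hU
  have hvd := hv.smul hd
  refine (hB.smul hd).prodMk ((hvd.add ((hA.div hB h.ne').smul (hU.sub hvd))).prodMk ?_)
  exact ((hs.mul hv).cos.smul hz).sub ((hs.mul hv).sin.smul (J.contDiff.contDiffAt.comp w hz))

/-! ### Invariance of the Liouville form along curves -/

lemma _root_.HasDerivAt.unique_of_eventuallyEq {F : Type*} [NormedAddCommGroup F] [NormedSpace ℝ F]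
    {f g : ℝ → F} {f' g' : F} {t : ℝ} (hf : HasDerivAt f f' t) (hg : HasDerivAt g g' t)
    (h : f =ᶠ[𝓝 t] g) : f' = g' :=
  hf.unique (hg.congr_of_eventuallyEq h)

lemma hasDerivAt_components {F : Type*} [NormedAddCommGroup F] [NormedSpace ℝ F]
    {m : ℝ → F × F × F} {m' : F × F × F} {t : ℝ} (hm : HasDerivAt m m' t) :
    HasDerivAt (fun s => (m s).1) m'.1 t ∧ HasDerivAt (fun s => (m s).2.1) m'.2.1 t ∧
      HasDerivAt (fun s => (m s).2.2) m'.2.2 t :=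
  ⟨(ContinuousLinearMap.fst ℝ F (F × F)).hasFDerivAt.comp_hasDerivAt t hm,
    (ContinuousLinearMap.fst ℝ F F ∘L .snd ℝ F (F × F)).hasFDerivAt.comp_hasDerivAt t hm,
    (ContinuousLinearMap.snd ℝ F F ∘L .snd ℝ F (F × F)).hasFDerivAt.comp_hasDerivAt t hm⟩

/-- The coordinates are made for the identity ⟪ξ, dU⟫ = ⟪x, dy⟫ - ⟪y, dx⟫ with U of weight zero.
Along a curve only one-variable derivatives are needed. -/
lemma modelForm_toModel (hP : IsIsotropicProjection J P) (hJ : IsComplexStructure J) {p : ℝ → E}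
    {p' : E} {m' : E × E × E} {t : ℝ} (h0 : P (p t) ≠ 0) (hp : HasDerivAt p p' t)
    (hm : HasDerivAt (fun s => toModel J P (p s)) m' t) :
    modelForm J (toModel J P (p t)) m' = inner ℝ (J (p t)) p' := by
  have hx := P.hasFDerivAt.comp_hasDerivAt t hp
  have hy := (yPart J P).hasFDerivAt.comp_hasDerivAt t hp
  have hz := (zPart J P).hasFDerivAt.comp_hasDerivAt t hp
  simp only [Function.comp_def] at hx hy hz
  have hr : HasDerivAt (fun s => ‖P (p s)‖) _ t :=
    (hasFDerivAt_norm h0).comp_hasDerivAt t hx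
  have hU := (hasDerivAt_components hm).2.1
  have hz' : m'.2.2 = zPart J P p' := (hasDerivAt_components hm).2.2.unique hz
  have hn : ‖P (p t)‖ ≠ 0 := norm_ne_zero_iff.2 h0
  have hne : ∀ᶠ s in 𝓝 t, P (p s) ≠ 0 := hx.continuousAt.eventually_ne h0
  -- Denominators are cleared before differentiating: |x|³ U = 2|x|² y - ⟪x, y⟫ x. Pairing with x
  -- then leaves a scalar identity.
  have e1 := HasDerivAt.unique_of_eventuallyEq ((hr.fun_pow 3).fun_smul hU)
    ((((hr.fun_pow 2).const_mul 2).fun_smul hy).fun_sub ((hx.inner ℝ hy).fun_smul hx)) <| by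
      filter_upwards [hne] with s hs
      have := norm_ne_zero_iff.2 hs
      simp only [toModel]
      match_scalars <;> field_simp
  have e2 := congrArg (fun w => (inner ℝ (P (p t)) w : ℝ)) e1
  rw [modelForm, hz', hP.inner_J hJ (p t) p']
  simp only [toModel, inner_add_right, inner_sub_right, real_inner_smul_left,
    real_inner_smul_right, real_inner_self_eq_norm_sq, smul_apply, innerSL_apply_apply,
    smul_eq_mul] at e2 ⊢
  rw [real_inner_comm (yPart J P (p t)) (P p')] at e2
  refine mul_left_cancel₀ (pow_ne_zero 4 hn) ?_
  field_simp at e2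
  push_cast at e2
  linear_combination e2

/-- A cotangent lift preserves the canonical form. The derivative of the new position V is obtained
from √(1 + s|U|²) V = U, paired with U and with ξ. -/
lemma modelForm_shrink {m : ℝ → E × E × E} {m' n' : E × E × E} {s t : ℝ}
    (h : 0 < 1 + s * ‖(m t).2.1‖ ^ 2) (hm : HasDerivAt m m' t)
    (hn : HasDerivAt (fun r => shrink (s, m r)) n' t) :
    modelForm J (shrink (s, m t)) n' = modelForm J (m t) m' := by
  have hU := (hasDerivAt_components hm).2.1
  have hV := (hasDerivAt_components hn).2.1
  have hz : n'.2.2 = m'.2.2 := (hasDerivAt_components hn).2.2.unique (hasDerivAt_components hm).2.2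
  have hρ := ((((hU.inner ℝ hU)).const_mul s).const_add 1).sqrt
    (by rw [real_inner_self_eq_norm_sq]; exact h.ne')
  have hρ0 : 0 < √(1 + s * ‖(m t).2.1‖ ^ 2) := Real.sqrt_pos.2 h
  have hρ2 : √(1 + s * ‖(m t).2.1‖ ^ 2) ^ 2 = 1 + s * ‖(m t).2.1‖ ^ 2 := Real.sq_sqrt h.le
  have hpos : ∀ᶠ r in 𝓝 t, 0 < 1 + s * ‖(m r).2.1‖ ^ 2 :=
    (continuousAt_const.add (continuousAt_const.mul (hU.continuousAt.norm.pow 2))).eventually_const_lt h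
  simp only [real_inner_self_eq_norm_sq] at hρ
  have e1 := HasDerivAt.unique_of_eventuallyEq (hρ.fun_smul hV) hU <| by
      filter_upwards [hpos] with r hr
      simp only [shrink]
      rw [smul_smul, mul_inv_cancel₀ (Real.sqrt_pos.2 hr).ne', one_smul]
  have e2 := congrArg (fun w => (inner ℝ (m t).2.1 w : ℝ)) e1
  have e3 := congrArg (fun w => (inner ℝ (m t).1 w : ℝ)) e1
  simp only [modelForm, hz]
  simp only [shrink, inner_add_right, inner_add_left, real_inner_smul_left,
    real_inner_smul_right, real_inner_self_eq_norm_sq, real_inner_comm (m t).2.1 m'.2.1,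
    real_inner_comm (m t).1 (m t).2.1] at e2 e3 ⊢
  refine mul_left_cancel₀ (pow_ne_zero 2 hρ0.ne') ?_
  field_simp at e2 e3
  linear_combination e3 / 2 + (s * inner ℝ (m t).1 (m t).2.1 / 2) * e2
    + (s * inner ℝ (m t).2.1 m'.2.1 * inner ℝ (m t).1 (m t).2.1) * hρ2

/-- `twist` is the time-s Hamiltonian flow of |z|²⟪ξ, U⟫/|ξ|, which has weight two, so it preserves
the form itself. The computation uses that the direction stays a unit vector and that the component
of U along it is conserved. -/
lemma modelForm_twist (hJ : IsComplexStructure J) {m : ℝ → E × E × E} {m' n' : E × E × E}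
    {s t : ℝ} (h0 : (m t).1 ≠ 0) (h : 0 < ‖(m t).1‖ + s * ‖(m t).2.2‖ ^ 2)
    (hm : HasDerivAt m m' t) (hn : HasDerivAt (fun r => twist J (s, m r)) n' t) :
    modelForm J (twist J (s, m t)) n' = modelForm J (m t) m' := by
  have hU := (hasDerivAt_components hm).2.1
  have hz := (hasDerivAt_components hm).2.2
  have hV := (hasDerivAt_components hn).2.1
  have hd : HasDerivAt (fun r => direction (m r)) _ t :=
    ((contDiffAt_direction h0).differentiableAt (by simp)).hasFDerivAt.comp_hasDerivAt t hm
  set d' := fderiv ℝ direction (m t) m'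
  have hne : ∀ᶠ r in 𝓝 t, (m r).1 ≠ 0 := (hasDerivAt_components hm).1.continuousAt.eventually_ne h0
  have hv := hd.inner ℝ hU
  have e1 := (hd.inner ℝ hd).unique_of_eventuallyEq (hasDerivAt_const t (1 : ℝ)) <| by
    filter_upwards [hne] with r hr
    exact inner_direction_self hr
  have e2 := (hd.inner ℝ hV).unique_of_eventuallyEq hv <| by
    filter_upwards [hne] with r hr
    exact inner_direction_twist_snd hr
  have e3 : n'.2.2 = _ := (hasDerivAt_components hn).2.2.unique
    (((hv.const_mul s).cos.fun_smul hz).fun_sub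
      ((hv.const_mul s).sin.fun_smul (J.hasFDerivAt.comp_hasDerivAt t hz)))
  have e4 : (m t).1 = ‖(m t).1‖ • direction (m t) := by
    rw [direction, smul_smul, mul_inv_cancel₀ (norm_ne_zero_iff.2 h0), one_smul]
  have e5 := inner_direction_self h0
  have hc := Real.sin_sq_add_cos_sq (s * inner ℝ (direction (m t)) (m t).2.1)
  have j1 := hJ.inner_self (m t).2.2
  have j2 : inner ℝ (m t).2.2 (J (m t).2.2) = (0 : ℝ) := by rw [real_inner_comm, j1]
  rw [modelForm, e3, modelForm, e4]
  simp only [twist] at e2 ⊢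
  have hB := h.ne'
  have e6 : inner ℝ d' (direction (m t)) = (0 : ℝ) := by
    rw [real_inner_comm d'] at e1
    linarith
  simp only [map_sub, ContinuousLinearMap.map_smul, hJ.sq, hJ.inner_map_map,
    inner_sub_left, inner_add_right, inner_sub_right, real_inner_smul_left,
    real_inner_smul_right, inner_neg_left, e6, j1, j2,
    real_inner_self_eq_norm_sq] at e2 ⊢
  field_simp at e2
  linear_combination e2 + (inner ℝ (J (m t).2.2) m'.2.2 - s * ‖(m t).2.2‖ ^ 2
      * (inner ℝ (direction (m t)) m'.2.1 + inner ℝ d' (m t).2.1)) * hc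
    - Real.sin (s * inner ℝ (direction (m t)) (m t).2.1) ^ 2 * hJ.skew (m t).2.2 m'.2.2

end ModelCalculus

/-! ### An isotopy pushing the cone away from a coisotropic subspace -/

section Squeeze

variable {E : Type} [NormedAddCommGroup E] [InnerProductSpace ℝ E] {J P : E →L[ℝ] E}

/-- In homogeneous coordinates, first make the position bounded, then the transversal part. -/
def squeeze (J P : E →L[ℝ] E) (w : ℝ × E) : E :=
  ofModel J (twist J (w.1 ^ 2, shrink (w.1 ^ 2, toModel J P w.2)))

/-- The inverse of `squeeze`. -/
def unsqueeze (J P : E →L[ℝ] E) (w : ℝ × E) : E :=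
  ofModel J (shrink (-w.1 ^ 2, twist J (-w.1 ^ 2, toModel J P w.2)))

lemma shrink_zero (m : E × E × E) : shrink (0, m) = m := by
  simp [shrink]

lemma twist_zero {m : E × E × E} (h0 : m.1 ≠ 0) : twist J (0, m) = m := by
  have := norm_ne_zero_iff.2 h0
  refine Prod.ext ?_ (Prod.ext ?_ ?_)
  · simp [twist, direction, smul_smul, this]
  · simp [twist, this]
  · simp [twist]

/-- The parameter enters as τ², so that positivity holds at every real time of the isotopy. -/
lemma one_add_sq_mul_pos (τ a : ℝ) : 0 < 1 + τ ^ 2 * a ^ 2 := by positivity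

omit [InnerProductSpace ℝ E] in
lemma norm_add_sq_mul_pos {ξ : E} (h0 : ξ ≠ 0) (τ a : ℝ) : 0 < ‖ξ‖ + τ ^ 2 * a ^ 2 := by
  have := norm_pos_iff.2 h0
  positivity

lemma contDiffAt_squeeze (τ : ℝ) {p : E} (hp : P p ≠ 0) :
    ContDiffAt ℝ ∞ (squeeze J P) (τ, p) := by
  have h0 := toModel_fst_ne_zero (J := J) hp
  have h1 := shrink_fst_ne_zero (sq_nonneg τ) h0
  have hs : ContDiffAt ℝ ∞ (fun w : ℝ × E => w.1 ^ 2) (τ, p) := by fun_prop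
  have e1 : ContDiffAt ℝ ∞ (fun w : ℝ × E => toModel J P w.2) (τ, p) :=
    (contDiffAt_toModel hp).comp (τ, p) contDiffAt_snd
  have e2 : ContDiffAt ℝ ∞ (fun w : ℝ × E => shrink (w.1 ^ 2, toModel J P w.2)) (τ, p) :=
    (contDiffAt_shrink (one_add_sq_mul_pos _ _)).comp (τ, p) (hs.prodMk e1)
  have e3 : ContDiffAt ℝ ∞
      (fun w : ℝ × E => twist J (w.1 ^ 2, shrink (w.1 ^ 2, toModel J P w.2))) (τ, p) :=
    (contDiffAt_twist h1 (norm_add_sq_mul_pos h1 _ _)).comp (τ, p) (hs.prodMk e2)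
  exact (contDiffAt_ofModel (twist_fst_ne_zero h1 (norm_add_sq_mul_pos h1 _ _))).comp (τ, p) e3

lemma toModel_squeeze (hP : IsIsotropicProjection J P) (hJ : IsComplexStructure J) (τ : ℝ)
    {p : E} (hp : P p ≠ 0) : toModel J P (squeeze J P (τ, p))
      = twist J (τ ^ 2, shrink (τ ^ 2, toModel J P p)) := by
  have h1 := shrink_fst_ne_zero (sq_nonneg τ) (toModel_fst_ne_zero (J := J) hp)
  exact toModel_ofModel hP hJ (((isModelPoint_toModel hP hJ p).shrink _).twist hJ _)
    (twist_fst_ne_zero h1 (norm_add_sq_mul_pos h1 _ _))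

lemma map_squeeze_ne_zero (hP : IsIsotropicProjection J P) (hJ : IsComplexStructure J) (τ : ℝ)
    {p : E} (hp : P p ≠ 0) : P (squeeze J P (τ, p)) ≠ 0 := by
  have h1 := shrink_fst_ne_zero (sq_nonneg τ) (toModel_fst_ne_zero (J := J) hp)
  have h2 := twist_fst_ne_zero (J := J) h1 (norm_add_sq_mul_pos h1 τ _)
  rw [← toModel_squeeze hP hJ τ hp] at h2
  intro h
  exact h2 (by simp [toModel, h])

lemma unsqueeze_squeeze (hP : IsIsotropicProjection J P) (hJ : IsComplexStructure J) (τ : ℝ)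
    {p : E} (hp : P p ≠ 0) : unsqueeze J P (τ, squeeze J P (τ, p)) = p := by
  have h1 := shrink_fst_ne_zero (sq_nonneg τ) (toModel_fst_ne_zero (J := J) hp)
  simp only [unsqueeze, toModel_squeeze hP hJ τ hp]
  rw [twist_neg_twist hJ h1 (norm_add_sq_mul_pos h1 _ _),
    shrink_neg_shrink (one_add_sq_mul_pos _ _), ofModel_toModel hp]

/-- The inverses have parameter -τ² and are smooth only where |ξ| - τ²|z|² and, after untwisting, 1
- τ²|U|² are positive. This holds on the image of `squeeze`, and `IsHomogeneousIsotopy` asks for no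
more. -/
lemma differentiableAt_unsqueeze (hP : IsIsotropicProjection J P) (hJ : IsComplexStructure J)
    (τ : ℝ) {p : E} (hp : P p ≠ 0) :
    DifferentiableAt ℝ (fun q => unsqueeze J P (τ, q)) (squeeze J P (τ, p)) := by
  have h0 := toModel_fst_ne_zero (J := J) hp
  have h1 := shrink_fst_ne_zero (sq_nonneg τ) h0
  have h2 := norm_add_sq_mul_pos h1 τ ‖(shrink (τ ^ 2, toModel J P p)).2.2‖
  have h3 := twist_fst_ne_zero (J := J) h1 h2
  have e1 : ContDiffAt ℝ ∞ (toModel J P) (squeeze J P (τ, p)) :=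
    contDiffAt_toModel (map_squeeze_ne_zero hP hJ τ hp)
  have e2 : ContDiffAt ℝ ∞ (fun q => twist J (-τ ^ 2, toModel J P q)) (squeeze J P (τ, p)) := by
    refine ContDiffAt.comp (squeeze J P (τ, p)) (contDiffAt_twist ?_ ?_)
      (contDiffAt_const.prodMk e1)
    · simpa only [toModel_squeeze hP hJ τ hp] using h3
    · simp only [toModel_squeeze hP hJ τ hp, norm_twist_fst h1 h2, norm_twist_z_sq hJ]
      simpa using h1
  have h4 : twist J (-τ ^ 2, toModel J P (squeeze J P (τ, p))) = shrink (τ ^ 2, toModel J P p) := by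
    rw [toModel_squeeze hP hJ τ hp, twist_neg_twist hJ h1 h2]
  have e3 : ContDiffAt ℝ ∞ (fun q => shrink (-τ ^ 2, twist J (-τ ^ 2, toModel J P q)))
      (squeeze J P (τ, p)) := by
    refine ContDiffAt.comp (squeeze J P (τ, p)) (contDiffAt_shrink ?_)
      (contDiffAt_const.prodMk e2)
    simp only [h4]
    rw [one_sub_norm_shrink (one_add_sq_mul_pos _ _)]
    exact inv_pos.2 (one_add_sq_mul_pos _ _)
  refine (ContDiffAt.comp (squeeze J P (τ, p)) (contDiffAt_ofModel ?_) e3).differentiableAt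
    (by simp)
  simp only [h4]
  rwa [shrink_neg_shrink (one_add_sq_mul_pos _ _)]

/-- Both sides are compared in model coordinates along the line p + r v. The derivative of `ofModel`
is never computed, since `modelForm_toModel` applies to the image curve as well. -/
lemma inner_J_fderiv_squeeze (hP : IsIsotropicProjection J P) (hJ : IsComplexStructure J)
    (τ : ℝ) {p : E} (hp : P p ≠ 0) (v : E) :
    inner ℝ (J (squeeze J P (τ, p))) (fderiv ℝ (fun p => squeeze J P (τ, p)) p v)
      = (inner ℝ (J p) v : ℝ) := by
  let γ : ℝ → E := fun r => p + r • v
  have hγ0 : γ 0 = p := by simp [γ]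
  have hγ : HasDerivAt γ v 0 := by
    simpa [γ] using ((hasDerivAt_id (0 : ℝ)).smul_const v).const_add p
  have hγp : ∀ᶠ r in 𝓝 (0 : ℝ), P (γ r) ≠ 0 :=
    (P.continuous.continuousAt.comp hγ.continuousAt).eventually_ne (by rwa [Function.comp_apply, hγ0])
  have h0 := toModel_fst_ne_zero (J := J) hp
  have h1 := shrink_fst_ne_zero (sq_nonneg τ) h0
  have h2 := norm_add_sq_mul_pos h1 τ ‖(shrink (τ ^ 2, toModel J P p)).2.2‖
  have hq : HasDerivAt (fun r => squeeze J P (τ, γ r))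
      (fderiv ℝ (fun p => squeeze J P (τ, p)) p v) 0 := by
    have : DifferentiableAt ℝ (fun p => squeeze J P (τ, p)) (γ 0) := by
      rw [hγ0]
      exact (hasFDerivAt_space ((contDiffAt_squeeze τ hp).differentiableAt
        (by simp))).differentiableAt
    simpa only [hγ0, Function.comp_def] using this.hasFDerivAt.comp_hasDerivAt (0 : ℝ) hγ
  have e0 : DifferentiableAt ℝ (fun r => toModel J P (γ r)) 0 := by
    have : DifferentiableAt ℝ (toModel J P) (γ 0) := by
      rw [hγ0]
      exact (contDiffAt_toModel hp).differentiableAt (by simp)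
    exact this.comp (0 : ℝ) hγ.differentiableAt
  have e1 : DifferentiableAt ℝ (fun r => shrink (τ ^ 2, toModel J P (γ r))) 0 :=
    DifferentiableAt.comp (0 : ℝ) ((contDiffAt_shrink (one_add_sq_mul_pos _ _)).differentiableAt
      (by simp)) ((differentiableAt_const _).prodMk e0)
  have e2 : DifferentiableAt ℝ (fun r => twist J (τ ^ 2, shrink (τ ^ 2, toModel J P (γ r)))) 0 := by
    refine DifferentiableAt.comp (0 : ℝ) ((contDiffAt_twist ?_ ?_).differentiableAt
      (by simp)) ((differentiableAt_const _).prodMk e1)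
    · simpa only [hγ0] using h1
    · simpa only [hγ0] using h2
  have e3 : HasDerivAt (fun r => toModel J P (squeeze J P (τ, γ r))) _ 0 :=
    e2.hasDerivAt.congr_of_eventuallyEq <| by
      filter_upwards [hγp] with r hr
      exact toModel_squeeze hP hJ τ hr
  have f0 := modelForm_toModel hP hJ (by rwa [hγ0]) hγ e0.hasDerivAt
  have f1 := modelForm_shrink (J := J) (s := τ ^ 2) (m := fun r => toModel J P (γ r))
    (one_add_sq_mul_pos _ _) e0.hasDerivAt e1.hasDerivAt
  have f2 := modelForm_twist hJ (s := τ ^ 2) (m := fun r => shrink (τ ^ 2, toModel J P (γ r)))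
    (by simpa only [hγ0] using h1) (by simpa only [hγ0] using h2)
    e1.hasDerivAt e2.hasDerivAt
  have f3 := modelForm_toModel hP hJ (p := fun r => squeeze J P (τ, γ r))
    (by simpa only [hγ0] using map_squeeze_ne_zero hP hJ τ hp) hq e3
  simp only [hγ0] at f0 f1 f2 f3
  rw [← f3, toModel_squeeze hP hJ τ hp, f2, f1, f0]

lemma isHomogeneousIsotopy_squeeze (hP : IsIsotropicProjection J P) (hJ : IsComplexStructure J) :
    IsHomogeneousIsotopy J {p | P p ≠ 0} (squeeze J P) (unsqueeze J P) where
  smooth := fun w hw => (contDiffAt_squeeze w.1 hw.2).contDiffWithinAt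
  mapsTo τ _ hp := map_squeeze_ne_zero hP hJ τ hp
  map_smul τ c hc p _ := by
    simp only [squeeze]
    rw [toModel_smul hc, shrink_modelScale, twist_modelScale hc, ofModel_modelScale hc]
  left_inv τ _ hp := unsqueeze_squeeze hP hJ τ hp
  differentiableAt_inv τ _ hp := differentiableAt_unsqueeze hP hJ τ hp
  symp τ _ hp v := inner_J_fderiv_squeeze hP hJ τ hp v
  zero_apply p hp := by
    have h0 := toModel_fst_ne_zero (J := J) (p := p) (P := P) hp
    simp only [squeeze, zero_pow two_ne_zero]
    rw [shrink_zero, twist_zero h0, ofModel_toModel hp]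

/-! ### Bounds for the time-one squeeze -/

/-- y is |x|/2 times the sum of U and its orthogonal projection to the line of x. -/
lemma norm_yPart_le {p : E} (hp : P p ≠ 0) :
    ‖yPart J P p‖ ≤ ‖P p‖ * ‖(toModel J P p).2.1‖ := by
  have hr : 0 < ‖P p‖ := norm_pos_iff.2 hp
  have h1 : inner ℝ (P p) (toModel J P p).2.1 * ‖P p‖ = (inner ℝ (P p) (yPart J P p) : ℝ) := by
    simp only [toModel, inner_sub_right, real_inner_smul_right, real_inner_self_eq_norm_sq]
    field_simp
    ring
  have h2 : yPart J P p = (‖P p‖ / 2) • ((toModel J P p).2.1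
      + (inner ℝ (P p) (toModel J P p).2.1 * (‖P p‖ ^ 2)⁻¹) • P p) := by
    rw [show inner ℝ (P p) (toModel J P p).2.1 * (‖P p‖ ^ 2)⁻¹
      = inner ℝ (P p) (yPart J P p) * (‖P p‖ ^ 3)⁻¹ by rw [← h1]; field_simp]
    simp only [toModel]
    match_scalars <;> field_simp
    ring
  have h3 : ‖(inner ℝ (P p) (toModel J P p).2.1 * (‖P p‖ ^ 2)⁻¹) • P p‖
      ≤ ‖(toModel J P p).2.1‖ := by
    rw [norm_smul, norm_mul, norm_inv, norm_pow, norm_norm]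
    have := norm_inner_le_norm (𝕜 := ℝ) (P p) (toModel J P p).2.1
    calc _ ≤ ‖P p‖ * ‖(toModel J P p).2.1‖ * (‖P p‖ ^ 2)⁻¹ * ‖P p‖ := by gcongr
      _ = _ := by field_simp
  rw [h2, norm_smul, Real.norm_of_nonneg (by positivity)]
  calc _ ≤ ‖P p‖ / 2 * (‖(toModel J P p).2.1‖ + ‖(toModel J P p).2.1‖) := by
        gcongr
        exact (norm_add_le _ _).trans (by gcongr)
    _ = _ := by ring

/-- The new position is a convex combination of U and its projection to the momentum direction. -/
lemma norm_twist_snd_le {s : ℝ} (hs : 0 ≤ s) {m : E × E × E} (h0 : m.1 ≠ 0) :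
    ‖(twist J (s, m)).2.1‖ ≤ ‖m.2.1‖ := by
  have hA : 0 < ‖m.1‖ := norm_pos_iff.2 h0
  have h1 : 0 < ‖m.1‖ + s * ‖m.2.2‖ ^ 2 := by positivity
  set c := ‖m.1‖ / (‖m.1‖ + s * ‖m.2.2‖ ^ 2) with hc
  have hc0 : 0 ≤ c := by positivity
  have hc1 : c ≤ 1 := (div_le_one h1).2 (le_add_of_nonneg_right (by positivity))
  have h2 : (twist J (s, m)).2.1
      = ((1 - c) * inner ℝ (direction m) m.2.1) • direction m + c • m.2.1 := by
    simp only [twist, ← hc]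
    module
  have h3 := norm_inner_le_norm (𝕜 := ℝ) (direction m) m.2.1
  rw [norm_direction h0, one_mul] at h3
  have h4 : 0 ≤ 1 - c := sub_nonneg.2 hc1
  rw [h2]
  refine (norm_add_le _ _).trans ?_
  rw [norm_smul, norm_smul, norm_mul, norm_direction h0, mul_one, Real.norm_of_nonneg hc0,
    Real.norm_of_nonneg h4]
  calc _ ≤ (1 - c) * ‖m.2.1‖ + c * ‖m.2.1‖ := by gcongr
    _ = _ := by ring

/-- `shrink` gives |U| ≤ 1, which `twist` keeps, so |y| ≤ |x|; and `twist` gives |z|² ≤ |ξ| = |x|².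
The constant 3 counts the components x, y, z. -/
lemma norm_squeeze_sq_le (hP : IsIsotropicProjection J P) (hJ : IsComplexStructure J) {p : E}
    (hp : P p ≠ 0) : ‖squeeze J P (1, p)‖ ^ 2 ≤ 3 * ‖P (squeeze J P (1, p))‖ ^ 2 := by
  have h1 := shrink_fst_ne_zero zero_le_one (toModel_fst_ne_zero (J := J) hp)
  have hq := map_squeeze_ne_zero hP hJ 1 hp
  have hm := toModel_squeeze hP hJ 1 hp
  rw [one_pow] at hm
  have hpos : 0 < ‖(shrink (1, toModel J P p)).1‖
      + 1 * ‖(shrink (1, toModel J P p)).2.2‖ ^ 2 := by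
    have := norm_pos_iff.2 h1
    positivity
  have hU : ‖(toModel J P (squeeze J P (1, p))).2.1‖ ≤ 1 := by
    rw [hm]
    refine (norm_twist_snd_le zero_le_one h1).trans ?_
    have h2 := norm_shrink_snd_sq (s := 1) (m := toModel J P p) (by positivity)
    have h3 : ‖(shrink (1, toModel J P p)).2.1‖ ^ 2 ≤ 1 := by
      rw [h2, div_le_one (by positivity)]
      linarith
    exact (sq_le_one_iff₀ (norm_nonneg _)).1 h3
  have hz : ‖zPart J P (squeeze J P (1, p))‖ ^ 2 ≤ ‖P (squeeze J P (1, p))‖ ^ 2 := by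
    rw [← norm_toModel_fst (J := J) (P := P)]
    change ‖(toModel J P (squeeze J P (1, p))).2.2‖ ^ 2 ≤ _
    rw [hm, norm_twist_z_sq hJ, norm_twist_fst h1 hpos]
    simp
  have hy : ‖yPart J P (squeeze J P (1, p))‖ ^ 2 ≤ ‖P (squeeze J P (1, p))‖ ^ 2 := by
    gcongr
    exact (norm_yPart_le hq).trans (mul_le_of_le_one_right (norm_nonneg _) hU)
  rw [hP.norm_sq hJ]
  linarith

end Squeeze

/-! ### Conformal factors -/

section Factor

variable {n k : ℕ} [NeZero n]

/-- The factor is read off on the tangent vector J p, where α takes the value 1/2. -/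
lemma Contactomorphism.factor_eq_of_eventuallyEq {h : Contactomorphism (alphaSt n k)}
    {f : sphereMinus n k → sphereMinus n k} {x : sphereMinus n k} {c : ℝ}
    (hf : h.toDiffeo =ᶠ[𝓝 x] f)
    (hc : ∀ v : EuclideanSpace ℝ (Fin (n + n - 1)),
      alphaSt n k (f x) (dmap f x v) = c * alphaSt n k x v) : h.factor x = c := by
  obtain ⟨u, hu⟩ := exists_dincl_eq x (w := stdJ n (incl x))
    (by rw [real_inner_comm, (isComplexStructure_stdJ n).inner_self])
  have h1 : ∀ v : EuclideanSpace ℝ (Fin (n + n - 1)),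
      alphaSt n k (h.toDiffeo x) (dmap h.toDiffeo x v) = h.factor x * alphaSt n k x v :=
    fun v => h.pullback_eq x v
  have h2 : dmap h.toDiffeo x = dmap f x := hf.mfderiv_eq
  have h3 := h1 u
  have h4 := hc u
  rw [alphaSt_apply, alphaSt_apply x, hu] at h3 h4
  rw [h2, hf.eq_of_nhds, h4, (isComplexStructure_stdJ n).inner_map_map, inner_incl_self] at h3
  linarith

/-- The conformal factor of a contact embedding, as a function of a unit vector. -/
def conformalFactor (x₀ : sphereMinus n k) (σ : sphereMinus n k → sphereMinus n k) (p : R2 n) :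
    ℝ :=
  inner ℝ (stdJ n (coneMap x₀ σ p)) (fderiv ℝ (coneMap x₀ σ) p (stdJ n p))

lemma contDiffOn_coneMap (x₀ : sphereMinus n k) {σ : sphereMinus n k → sphereMinus n k}
    (hσ : ContMDiff (𝓡 (n + n - 1)) (𝓡 (n + n - 1)) ∞ σ) :
    ContDiffOn ℝ ∞ (coneMap x₀ σ) (cone n k) := by
  have h1 : ContDiffOn ℝ ∞ (fun p => incl (σ (radial x₀ p))) (cone n k) :=
    ((contMDiff_incl.comp hσ).comp_contMDiffOn (contMDiffOn_radial x₀)).contDiffOn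
  exact (contDiff_id.contDiffOn.norm ℝ fun p hp => ne_zero_of_mem_cone hp).smul h1

lemma continuousOn_conformalFactor (x₀ : sphereMinus n k)
    {σ : sphereMinus n k → sphereMinus n k}
    (hσ : ContMDiff (𝓡 (n + n - 1)) (𝓡 (n + n - 1)) ∞ σ) :
    ContinuousOn (conformalFactor x₀ σ) (cone n k) := by
  have h1 := contDiffOn_coneMap x₀ hσ
  exact ((stdJ n).continuous.comp_continuousOn h1.continuousOn).inner
    ((h1.continuousOn_fderiv_of_isOpen isOpen_cone (by simp)).clm_apply
      (stdJ n).continuous.continuousOn)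

/-- A tangent vector is a multiple of J p plus a vector in the contact hyperplane, on which the
pulled-back form vanishes. So the factor is determined on J p, and this explicit formula makes it
continuous. -/
lemma IsContactEmbedding.alphaSt_dmap {σ : sphereMinus n k → sphereMinus n k}
    (hσ : IsContactEmbedding (alphaSt n k) σ) (x₀ x : sphereMinus n k)
    (v : EuclideanSpace ℝ (Fin (n + n - 1))) :
    alphaSt n k (σ x) (dmap σ x v) = conformalFactor x₀ σ (incl x) * alphaSt n k x v := by
  have hJ := isComplexStructure_stdJ n
  obtain ⟨u, hu⟩ := exists_dincl_eq x (w := stdJ n (incl x))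
    (by rw [real_inner_comm, hJ.inner_self])
  have hd : ∀ v, dincl (σ x) (dmap σ x v) = fderiv ℝ (coneMap x₀ σ) (incl x) (dincl x v) :=
    dincl_dmap hσ.smooth (fun y => (coneMap_incl x₀ σ y).symm) x
      (((contDiffOn_coneMap x₀ hσ.smooth).contDiffAt
        (isOpen_cone.mem_nhds (incl_mem x))).differentiableAt (by simp))
  set c : ℝ := inner ℝ (stdJ n (incl x)) (dincl x v) with hc
  have h1 : inner ℝ (stdJ n (incl x)) (dincl x (v - c • u)) = (0 : ℝ) := by
    rw [map_sub, map_smul, hu, inner_sub_right, real_inner_smul_right, hJ.inner_map_map,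
      inner_incl_self, ← hc]
    ring
  have h2 := (hσ.inner_eq_zero_iff x (v - c • u)).2 h1
  rw [map_sub, map_smul, map_sub, map_smul, inner_sub_right, real_inner_smul_right, sub_eq_zero]
    at h2
  rw [alphaSt_apply, alphaSt_apply, h2, ← hc, hd u, hu, ← coneMap_incl x₀]
  simp only [conformalFactor]
  ring

end Factor

/-! ### The isotropic coordinate projection -/

section CoordinateProjection

variable {n k : ℕ}

/-- The projection to the span of the first `2n - k` standard basis vectors. -/
def coordProj (n k : ℕ) : R2 n →L[ℝ] R2 n :=
  LinearMap.toContinuousLinearMap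
    { toFun := fun p => WithLp.toLp 2 fun j => if (j : ℕ) + k < n + n then p j else 0
      map_add' := fun p q => by
        ext j
        by_cases h : (j : ℕ) + k < n + n <;> simp [h]
      map_smul' := fun c p => by
        ext j
        by_cases h : (j : ℕ) + k < n + n <;> simp [h] }

lemma coordProj_apply (p : R2 n) (j : Fin (n + n)) :
    coordProj n k p j = if (j : ℕ) + k < n + n then p j else 0 := rfl

/-- As n ≤ k, only x-coordinates survive the projection, and J exchanges x- and y-coordinates. -/
lemma isIsotropicProjection_coordProj (hnk : n ≤ k) :
    IsIsotropicProjection (stdJ n) (coordProj n k) where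
  idem p := by
    ext j
    by_cases h : (j : ℕ) + k < n + n <;> simp [coordProj_apply, h]
  symm p q := by
    rw [PiLp.inner_apply, PiLp.inner_apply]
    refine Finset.sum_congr rfl fun j _ => ?_
    by_cases h : (j : ℕ) + k < n + n <;> simp [coordProj_apply, h]
  isotropic p := by
    ext j
    refine Fin.addCases (fun i => ?_) (fun i => ?_) j
    · have h : ¬ ((Fin.natAdd n i : Fin (n + n)) : ℕ) + k < n + n := by
        rw [Fin.val_natAdd]
        omega
      rw [coordProj_apply, stdJ_castAdd, coordProj_apply, if_neg h, neg_zero, ite_self]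
      rfl
    · rw [coordProj_apply, if_neg (by rw [Fin.val_natAdd]; omega)]
      rfl

lemma cone_eq : cone n k = {p | coordProj n k p ≠ 0} := by
  ext p
  rw [cone, mem_ofPred_eq, mem_ofPred_eq, mem_coordSubspace, not_iff_not]
  constructor
  · intro h
    ext j
    rw [coordProj_apply]
    split_ifs with hj
    exacts [h j hj, rfl]
  · intro h j hj
    have := congrArg (fun q : R2 n => q j) h
    simpa [coordProj_apply, hj] using this

lemma norm_coordProj_pos (x : sphereMinus n k) : 0 < ‖coordProj n k (incl x)‖ := by
  have := incl_mem x
  rw [cone_eq] at this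
  exact norm_pos_iff.2 this

lemma nonempty_sphereMinus [NeZero n] (hk : k < 2 * n) : Nonempty (sphereMinus n k) := by
  have h0 : 0 < n + n := by have := NeZero.pos n; omega
  refine ⟨⟨⟨EuclideanSpace.single ⟨0, h0⟩ 1, by simp⟩, fun h => ?_⟩⟩
  have := mem_coordSubspace.1 h ⟨0, h0⟩ (by simp only; omega)
  simp at this

lemma isClosed_setOf_le_norm_coordProj (ε : ℝ) :
    IsClosed {x : sphereMinus n k | ε ≤ ‖coordProj n k (incl x)‖ ^ 2} :=
  isClosed_le continuous_const (((coordProj n k).continuous.comp continuous_incl).norm.pow 2)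

/-- These sets stay away from Π_k, so they are closed in the whole sphere; as ε decreases to 0 they
exhaust U_k. -/
lemma isCompact_setOf_le_norm_coordProj [NeZero n] (x₀ : sphereMinus n k) {ε : ℝ} (hε : 0 < ε) :
    IsCompact {x : sphereMinus n k | ε ≤ ‖coordProj n k (incl x)‖ ^ 2} := by
  have h1 : IsCompact (sphere (0 : R2 n) 1 ∩ {p | ε ≤ ‖coordProj n k p‖ ^ 2}) :=
    (isCompact_sphere _ _).inter_right
      (isClosed_le continuous_const ((coordProj n k).continuous.norm.pow 2))
  have h2 : sphere (0 : R2 n) 1 ∩ {p | ε ≤ ‖coordProj n k p‖ ^ 2} ⊆ cone n k := by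
    rintro p ⟨-, hp⟩
    rw [cone_eq]
    intro h
    rw [mem_ofPred_eq, h, norm_zero, zero_pow two_ne_zero] at hp
    exact hp.not_gt hε
  refine (h1.image_of_continuousOn ((contMDiffOn_radial x₀).continuousOn.mono h2)).of_isClosed_subset
    (isClosed_setOf_le_norm_coordProj ε) fun x hx => ?_
  exact ⟨incl x, ⟨by simp, hx⟩, radial_incl x₀ x⟩

end CoordinateProjection

/-! ### Non-orderability -/

section Main

variable {n k : ℕ} [NeZero n]

omit [NeZero n] in
lemma isHomogeneousIsotopy_squeeze_coordProj (hnk : n ≤ k) :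
    IsHomogeneousIsotopy (stdJ n) (cone n k) (squeeze (stdJ n) (coordProj n k))
      (unsqueeze (stdJ n) (coordProj n k)) := by
  rw [cone_eq]
  exact isHomogeneousIsotopy_squeeze (isIsotropicProjection_coordProj hnk)
    (isComplexStructure_stdJ n)

omit [NeZero n] in
lemma isHomogeneousIsotopy_scaling_coordProj (hnk : n ≤ k) :
    IsHomogeneousIsotopy (stdJ n) (cone n k) (scaling (stdJ n) (coordProj n k))
      fun w => scaling (stdJ n) (coordProj n k) (-w.1, w.2) := by
  rw [cone_eq]
  exact (isIsotropicProjection_coordProj hnk).isHomogeneousIsotopy_scaling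
    (isComplexStructure_stdJ n)

/-- The sphere minus a coisotropic coordinate subspace is convex at infinity. -/
lemma exists_mem_contractingEmbeddings (hnk : n ≤ k) (x₀ : sphereMinus n k) :
    ∃ σ ∈ contractingEmbeddings (alphaSt n k),
      ∀ x, 1 / 3 ≤ ‖coordProj n k (incl (σ x))‖ ^ 2 := by
  have hΦ := isHomogeneousIsotopy_squeeze_coordProj (n := n) (k := k) hnk
  have h1 : ∀ x : sphereMinus n k, 1 / 3 ≤ ‖coordProj n k (incl (radial x₀
      (squeeze (stdJ n) (coordProj n k) (1, incl x))))‖ ^ 2 := by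
    intro x
    have h2 := norm_squeeze_sq_le (isIsotropicProjection_coordProj hnk)
      (isComplexStructure_stdJ n) (norm_pos_iff.1 (norm_coordProj_pos x))
    have h3 := norm_pos_of_mem_cone (hΦ.mapsTo 1 _ (incl_mem x))
    rw [hΦ.incl_radial x₀, map_smul, norm_smul, norm_inv, norm_norm, mul_pow, inv_pow,
      inv_mul_eq_div, le_div_iff₀ (by positivity)]
    linarith
  refine ⟨_, ⟨hΦ.isContactEmbedding x₀ 1, hΦ.contactlyIsotopicToId x₀ 1, ?_⟩, h1⟩
  refine (isCompact_setOf_le_norm_coordProj x₀ (ε := 1 / 3) (by norm_num)).of_isClosed_subset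
    isClosed_closure (closure_minimal ?_ (isClosed_setOf_le_norm_coordProj _))
  rintro _ ⟨x, rfl⟩
  exact h1 x

lemma gPlus_nonempty (hnk : n ≤ k) (x₀ : sphereMinus n k) : (gPlus (alphaSt n k)).Nonempty := by
  obtain ⟨σ, hσ, h1⟩ := exists_mem_contractingEmbeddings hnk x₀
  -- The function vanishes where |x|² ≤ 1/8 and is positive where |x|² ≥ 1/3, hence on the image of
  -- σ.
  refine ⟨fun x => Real.smoothTransition (8 * ‖coordProj n k (incl x)‖ ^ 2 - 1), ⟨?_, ?_⟩,
    fun x => Real.smoothTransition.nonneg _, σ, hσ, ?_⟩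
  · have h2 : ContDiff ℝ ∞ fun p : R2 n =>
        Real.smoothTransition (8 * ‖coordProj n k p‖ ^ 2 - 1) :=
      Real.smoothTransition.contDiff.comp
        ((contDiff_const.mul ((coordProj n k).contDiff.norm_sq ℝ)).sub contDiff_const)
    exact h2.contMDiff.comp contMDiff_incl
  · refine HasCompactSupport.intro
      (isCompact_setOf_le_norm_coordProj x₀ (ε := 1 / 8) (by norm_num)) fun x hx => ?_
    rw [mem_ofPred_eq, not_le] at hx
    exact Real.smoothTransition.zero_of_nonpos (by linarith)
  · rintro _ ⟨x, rfl⟩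
    exact Real.smoothTransition.pos_of_pos (by linarith [h1 x])

lemma const_mul_mem_gPlus {s : ℝ} (hs : 0 < s) {H : sphereMinus n k → ℝ}
    (hH : H ∈ gPlus (alphaSt n k)) : (fun x => s * H x) ∈ gPlus (alphaSt n k) := by
  obtain ⟨⟨h1, h2⟩, h3, σ, hσ, h4⟩ := hH
  exact ⟨⟨contMDiff_const.mul h1, h2.mul_left⟩, fun x => mul_nonneg hs.le (h3 x), σ, hσ,
    fun x hx => mul_pos hs (h4 x hx)⟩

theorem allComparable_alphaSt (hnk : n ≤ k) (x₀ : sphereMinus n k) :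
    AllComparable (alphaSt n k) := by
  rintro K₁ ⟨⟨hK₁, hs₁⟩, hpos₁, -⟩ K₂ ⟨⟨hK₂, -⟩, hpos₂, σ, ⟨hσ, hσi, -⟩, hσK₂⟩
  have hP := isIsotropicProjection_coordProj (n := n) (k := k) hnk
  have hJ := isComplexStructure_stdJ n
  have hA := isHomogeneousIsotopy_scaling_coordProj (n := n) (k := k) hnk
  -- For large T the scaled support of K₁ lies in this fixed compact set, so the bound `C` can be
  -- chosen before T.
  let N : Set (sphereMinus n k) := {x | 1 / 2 ≤ ‖coordProj n k (incl x)‖ ^ 2}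
  have hN : IsCompact N := isCompact_setOf_le_norm_coordProj x₀ (by norm_num)
  have hK₂σ : ∀ x, 0 < K₂ (σ x) := fun x => hσK₂ _ ⟨x, rfl⟩
  obtain ⟨C, hC⟩ := hN.exists_bound_of_continuousOn
    (f := fun x => conformalFactor x₀ σ (incl x) / K₂ (σ x))
    ((((continuousOn_conformalFactor x₀ hσ.smooth).comp_continuous continuous_incl incl_mem).div
      (hK₂.continuous.comp hσ.smooth.continuous) fun x => (hK₂σ x).ne').continuousOn)
  obtain ⟨M, hM⟩ := hs₁.isCompact.exists_bound_of_continuousOn hK₁.continuous.continuousOn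
  obtain ⟨D, hD⟩ := hs₁.isCompact.exists_bound_of_continuousOn
    (f := fun x => ‖coordProj n k (incl x)‖⁻¹)
    ((((coordProj n k).continuous.comp continuous_incl).norm.inv₀ fun x =>
      (norm_coordProj_pos x).ne').continuousOn)
  -- `D` bounds 1/|x| on the support. The summand 1 will put the image into `N`, and |C| |M| will
  -- absorb the bounds for σ and K₁.
  obtain ⟨T, hT0, hT⟩ : ∃ T : ℝ, 0 ≤ T ∧ ∀ x ∈ tsupport K₁,
      1 + |C| * |M| ≤ Real.exp T * ‖coordProj n k (incl x)‖ := by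
    have h1 : 1 ≤ (1 + |C| * |M|) * (1 + |D|) := by
      have := mul_nonneg (abs_nonneg C) (abs_nonneg M)
      nlinarith [abs_nonneg D]
    refine ⟨Real.log ((1 + |C| * |M|) * (1 + |D|)), Real.log_nonneg h1, fun x hx => ?_⟩
    rw [Real.exp_log (zero_lt_one.trans_le h1), mul_assoc]
    refine le_mul_of_one_le_right (by positivity) ?_
    have h2 := norm_coordProj_pos x
    have h3 := hD x hx
    rw [norm_inv, norm_norm, inv_le_iff_one_le_mul₀ h2] at h3
    refine h3.trans (mul_le_mul_of_nonneg_right ?_ h2.le)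
    linarith [le_abs_self D]
  let a : sphereMinus n k → sphereMinus n k := fun x =>
    radial x₀ (scaling (stdJ n) (coordProj n k) (T, incl x))
  obtain ⟨h, hh, hev⟩ := (hσi.comp (hA.contactlyIsotopicToId x₀ T)).exists_contactGroup hs₁ x₀
  refine ⟨h, hh, fun x => ?_⟩
  obtain ⟨y, rfl⟩ : ∃ y, h.toDiffeo y = x := h.toDiffeo.surjective x
  rw [Ad, h.toDiffeo.symm_apply_apply]
  by_cases hy : y ∈ tsupport K₁
  swap
  · rw [image_eq_zero_of_notMem_tsupport hy, mul_zero]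
    exact hpos₂ _
  have hfac : h.factor y = conformalFactor x₀ σ (incl (a y))
      * (‖scaling (stdJ n) (coordProj n k) (T, incl y)‖ ^ 2)⁻¹ := by
    refine Contactomorphism.factor_eq_of_eventuallyEq (hev y hy) fun v => ?_
    have h1 : dmap (σ ∘ a) y v = dmap σ (a y) (dmap a y v) :=
      congrArg (fun B => B v) (mfderiv_comp y (hσ.smooth.mdifferentiable (by simp) _)
        ((hA.isContactEmbedding x₀ T).smooth.mdifferentiable (by simp) y))
    have h2 := hA.alphaSt_dmap x₀ T y v
    have h3 := hσ.alphaSt_dmap x₀ (a y) (dmap a y v)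
    rw [mul_assoc, ← h2, ← h3, ← h1]
    rfl
  have hhy : h.toDiffeo y = σ (a y) := (hev y hy).self_of_nhds
  rw [hhy]
  set q := scaling (stdJ n) (coordProj n k) (T, incl y) with hq
  have hq0 : 0 < ‖q‖ := norm_pos_of_mem_cone (hA.mapsTo T _ (incl_mem y))
  have hPq : coordProj n k q = Real.exp T • coordProj n k (incl y) := hP.map_scaling T _
  have hPq1 : 1 + |C| * |M| ≤ ‖coordProj n k q‖ := by
    rw [hPq, norm_smul, Real.norm_of_nonneg (Real.exp_pos T).le]
    exact hT y hy
  have hCM : 0 ≤ |C| * |M| := by positivity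
  have hPq2 : 1 + |C| * |M| ≤ ‖coordProj n k q‖ ^ 2 := by nlinarith
  have hqn := hP.norm_sq hJ q
  -- As T ≥ 0 the y-part shrinks and the z-part is constant, so together they contribute at most 1.
  -- The x-part contributes at least 1, hence at least half of |q|².
  have hqy : ‖yPart (stdJ n) (coordProj n k) q‖ ^ 2 + ‖zPart (stdJ n) (coordProj n k) q‖ ^ 2 ≤ 1 := by
    have h1 := hP.norm_sq hJ (incl y)
    have h2 : Real.exp (-T) ≤ 1 := Real.exp_le_one_iff.2 (neg_nonpos.2 hT0)
    have h3 : ‖yPart (stdJ n) (coordProj n k) q‖ ≤ ‖yPart (stdJ n) (coordProj n k) (incl y)‖ := by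
      rw [hq, hP.yPart_scaling hJ, norm_smul, Real.norm_of_nonneg (Real.exp_pos _).le]
      exact mul_le_of_le_one_left (norm_nonneg _) h2
    have h4 := pow_le_pow_left₀ (norm_nonneg _) h3 2
    rw [norm_incl] at h1
    rw [hq, hP.zPart_scaling hJ, ← hq]
    linarith [sq_nonneg ‖coordProj n k (incl y)‖]
  have haN : a y ∈ N := by
    change 1 / 2 ≤ ‖coordProj n k (incl (a y))‖ ^ 2
    rw [hA.incl_radial x₀ T y, map_smul, norm_smul, norm_inv, norm_norm, mul_pow, inv_pow,
      inv_mul_eq_div, le_div_iff₀ (by positivity)]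
    linarith
  have hb := (le_abs_self _).trans (hC (a y) haN)
  rw [div_le_iff₀ (hK₂σ _)] at hb
  have hMy : K₁ y ≤ |M| := ((le_abs_self _).trans (hM y hy)).trans (le_abs_self M)
  have hCb : conformalFactor x₀ σ (incl (a y)) ≤ |C| * K₂ (σ (a y)) :=
    hb.trans (mul_le_mul_of_nonneg_right (le_abs_self C) (hK₂σ _).le)
  -- The factor of h at y is that of σ at `a y` divided by |q|², and |q|² ≥ |P q|² ≥ |C| |M|.
  calc h.factor y * K₁ y ≤ h.factor y * |M| := by
        gcongr
        exact (h.factor_pos y).le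
    _ = conformalFactor x₀ σ (incl (a y)) * (|M| * (‖q‖ ^ 2)⁻¹) := by rw [hfac]; ring
    _ ≤ |C| * K₂ (σ (a y)) * (|M| * (‖q‖ ^ 2)⁻¹) := by gcongr
    _ = K₂ (σ (a y)) * ((|C| * |M|) / ‖q‖ ^ 2) := by ring
    _ ≤ K₂ (σ (a y)) * 1 := by
        gcongr
        · exact (hK₂σ _).le
        · rw [div_le_one (by positivity), hqn]
          nlinarith [sq_nonneg ‖yPart (stdJ n) (coordProj n k) q‖,
            sq_nonneg ‖zPart (stdJ n) (coordProj n k) q‖]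
    _ = K₂ (σ (a y)) := mul_one _

/-- Comparing H with H/2 gives the self-contraction; the only further input is a non-empty cone,
which the contracting embedding provides. -/
theorem nonOrderableUpToConjugation_alphaSt (hnk : n ≤ k) (hk : k < 2 * n) :
    NonOrderableUpToConjugation (alphaSt n k) := by
  obtain ⟨x₀⟩ := nonempty_sphereMinus (n := n) hk
  have hcomp := allComparable_alphaSt hnk x₀
  obtain ⟨H, hH⟩ := gPlus_nonempty hnk x₀
  obtain ⟨g, hg, hle⟩ := hcomp H hH _ (const_mul_mem_gPlus (s := 1 / 2) (by norm_num) hH)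
  exact ⟨⟨H, hH, g, hg, 1 / 2, by norm_num, by norm_num, hle⟩, hcomp⟩

end Main

end ContactCone

end

theorem mainTheorem6 (n k : ℕ) [NeZero n] (hnk : n ≤ k) (hk : k < 2 * n) :
    ContactCone.NonOrderableUpToConjugation (ContactCone.alphaSt n k) := ContactCone.nonOrderableUpToConjugation_alphaSt hnk hk
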